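/- \textbf{Lemma.} Let $T_1,\dots,T_6$ be six lines in the complex projective plane $\mathbb P^2$ in general position, i.e. pairwise distinct with no three of them passing through a common point. For integers $b_1,\dots,b_6\ge 1$ let $(\mathbb P^2,\sum_i b_iT_i)$ denote the pair $(\mathbb P^2,\beta)$, where $\beta:\mathbb P^2\to\mathbb N$ is the function $\beta(p)=\prod_{i:\,p\in T_i}b_i$ (so $\beta=1$ off the lines with $b_i>1$, and at a node $p=T_i\cap T_j$ one has $\beta(p)=b_ib_j$); terms with $b_i=1$ are omitted from the notation. Say that $(\mathbb P^2,\beta)$ is \emph{uniformized} by a connected complex surface $M$ if there are a properly discontinuous group $G\subset\mathrm{Aut}(M)$ of holomorphic automorphisms of $M$ and a map $\varphi:M\to\mathbb P^2$ that identifies $\mathbb P^2$ with the quotient $M/G$ as complex analytic spaces, such that $\beta(\varphi(q))=|G_q|$ for every $q\in M$, where $G_q$ is the isotropy group of $q$ in $G$. A \emph{K3 surface} is a compact connected complex manifold $M$ of dimension $2$ with trivial canonical bundle and $H^1(M,\mathcal O_M)=0$. Then each of the orbifolds \begin{align*} \mathcal E_1&=(\mathbb P^2,\ 6T_1+6T_2+6T_3+2T_4),\\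 \mathcal E_2&=(\mathbb P^2,\ 4T_1+4T_2+4T_3+4T_4),\\ \mathcal E_3&=(\mathbb P^2,\ 2T_1+2T_2+2T_3+2T_4+2T_5+2T_6) \end{align*} is uniformized by a K3 surface. -/

import Mathlib

open scoped Manifold ContDiff

namespace K3Uniformization

universe u

/-! ### The complex projective plane -/

/-- The complex projective plane: the set of lines through the origin of `ℂ³`. -/
abbrev ProjectivePlane : Type := Projectivization ℂ (Fin 3 → ℂ)

/-- The usual topology of the projective plane: the quotient topology from `ℂ³ ∖ {0}`. -/
noncomputable instance instTopologicalSpaceProjectivePlane : TopologicalSpace ProjectivePlane :=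
  TopologicalSpace.coinduced
    (fun v : {v : Fin 3 → ℂ // v ≠ 0} => Projectivization.mk ℂ v.1 v.2) inferInstance

open Classical in
/-- The pullback to `ℂ³` of a function on the projective plane (the value at `0` is irrelevant). -/
noncomputable def coneFun (f : ProjectivePlane → ℂ) (v : Fin 3 → ℂ) : ℂ :=
  if h : v ≠ 0 then f (Projectivization.mk ℂ v h) else 0

/-- The cone (without its vertex) in `ℂ³` over a subset of the projective plane. -/
def coneSet (U : Set ProjectivePlane) : Set (Fin 3 → ℂ) :=
  {v | ∃ h : v ≠ 0, Projectivization.mk ℂ v h ∈ U}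

/-- Holomorphic functions on an open subset `U` of the projective plane, for its standard complex
structure as the quotient of `ℂ³ ∖ {0}` by `ℂˣ`: those whose pullback to the cone over `U` is
holomorphic. -/
def HolomorphicOnPlane (f : ProjectivePlane → ℂ) (U : Set ProjectivePlane) : Prop :=
  DifferentiableOn ℂ (coneFun f) (coneSet U)

/-- `L` is a line of the projective plane: the zero locus of a nonzero linear form. -/
def IsLine (L : Set ProjectivePlane) : Prop :=
  ∃ a : Fin 3 → ℂ, a ≠ 0 ∧ L = {p | ∑ m, a m * p.rep m = 0}

/-- A family of lines in general position: the lines are distinct and no three of them meet. -/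
def InGeneralPosition {ι : Type*} (T : ι → Set ProjectivePlane) : Prop :=
  Function.Injective T ∧
    ∀ i j k, i ≠ j → i ≠ k → j ≠ k → T i ∩ T j ∩ T k = ∅

open Classical in
/-- The function `β : ℙ² → ℕ` of the orbifold `(ℙ², ∑ bᵢ Tᵢ)` for lines `Tᵢ` in general position.
Such an arrangement has only simple nodes, so `β` is `1` off the lines, `bᵢ` at the smooth points
of the arrangement that lie on `Tᵢ`, and `bᵢ * bⱼ` at the node `Tᵢ ∩ Tⱼ`. A line with
coefficient `1` does not contribute. -/
noncomputable def orbifoldWeight {ι : Type*} [Fintype ι] (T : ι → Set ProjectivePlane) (b : ι → ℕ)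
    (p : ProjectivePlane) : ℕ :=
  ∏ i, if p ∈ T i then b i else 1

/-! ### K3 surfaces -/

section Surface

variable (M : Type u) [TopologicalSpace M] [ChartedSpace (Fin 2 → ℂ) M]

/-- A holomorphic `2`-form on a complex surface, i.e. a holomorphic section of the canonical
bundle: in each chart `(z₁, z₂)` of the atlas it is `coeff e (z) dz₁ ∧ dz₂`, with the coefficient
holomorphic, and the coefficients in two charts differ by the Jacobian determinant of the change
of coordinates. -/
structure HolomorphicTwoForm where
  coeff : OpenPartialHomeomorph M (Fin 2 → ℂ) → (Fin 2 → ℂ) → ℂ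
  holomorphic : ∀ e ∈ atlas (Fin 2 → ℂ) M, DifferentiableOn ℂ (coeff e) e.target
  change : ∀ e ∈ atlas (Fin 2 → ℂ) M, ∀ e' ∈ atlas (Fin 2 → ℂ) M, ∀ x ∈ e.source ∩ e'.source,
    coeff e (e x) = coeff e' (e' x) * (fderiv ℂ (fun z => e' (e.symm z)) (e x)).det

variable {M} in
/-- The form vanishes at no point. -/
def HolomorphicTwoForm.NowhereVanishing (w : HolomorphicTwoForm M) : Prop :=
  ∀ e ∈ atlas (Fin 2 → ℂ) M, ∀ z ∈ e.target, w.coeff e z ≠ 0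

/-- `H¹(M, 𝒪_M) = 0`, in Čech terms: each `1`-cocycle of holomorphic functions on an open cover
is a coboundary on that cover. (For every sheaf, `H¹` of the space is the union of the
Čech groups `H¹` of its open covers.) -/
def StructureSheafH1Vanishes : Prop :=
  ∀ (ι : Type u) (U : ι → Set M), (∀ i, IsOpen (U i)) → (⋃ i, U i) = Set.univ →
    ∀ f : ι → ι → M → ℂ,
      (∀ i j, MDifferentiableOn 𝓘(ℂ, Fin 2 → ℂ) 𝓘(ℂ, ℂ) (f i j) (U i ∩ U j)) →
      (∀ i j k, ∀ x ∈ U i ∩ U j ∩ U k, f i j x + f j k x = f i k x) →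
      ∃ g : ι → M → ℂ,
        (∀ i, MDifferentiableOn 𝓘(ℂ, Fin 2 → ℂ) 𝓘(ℂ, ℂ) (g i) (U i)) ∧
        ∀ i j, ∀ x ∈ U i ∩ U j, f i j x = g j x - g i x

/-- A K3 surface: a compact connected complex manifold of dimension two with trivial canonical
bundle and `H¹(M, 𝒪_M) = 0`. -/
structure IsK3Surface : Prop where
  t2 : T2Space M
  compact : CompactSpace M
  connected : ConnectedSpace M
  complexManifold : IsManifold 𝓘(ℂ, Fin 2 → ℂ) ω M
  canonical_trivial : ∃ w : HolomorphicTwoForm M, w.NowhereVanishing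
  irregularity_zero : StructureSheafH1Vanishes M

/-! ### Uniformizations -/

variable {M}

/-- `φ : M → ℙ²` is a uniformization of `(ℙ², β)` with group `G`: the group `G` acts faithfully
and properly discontinuously on the complex surface `M` by holomorphic automorphisms, `φ` identifies
the projective plane with the quotient `M/G` as a topological space and as an analytic space
(the holomorphic functions on an open set of `ℙ²` correspond to the `G`-invariant holomorphic
functions on its preimage), and `β (φ q)` is the order of the isotropy group of `q`. -/
structure IsUniformization (G : Type*) [Group G] [MulAction G M]
    (φ : M → ProjectivePlane) (β : ProjectivePlane → ℕ) : Prop where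
  faithful : FaithfulSMul G M
  properlyDiscontinuous : ProperlyDiscontinuousSMul G M
  holomorphic_smul : ∀ g : G,
    MDifferentiable 𝓘(ℂ, Fin 2 → ℂ) 𝓘(ℂ, Fin 2 → ℂ) (fun x : M => g • x)
  quotientMap : Topology.IsQuotientMap φ
  fiber_eq_orbit : ∀ x y : M, φ x = φ y ↔ x ∈ MulAction.orbit G y
  holomorphic_iff : ∀ (U : Set ProjectivePlane), IsOpen U → ∀ f : ProjectivePlane → ℂ,
    HolomorphicOnPlane f U ↔
      MDifferentiableOn 𝓘(ℂ, Fin 2 → ℂ) 𝓘(ℂ, ℂ) (fun x => f (φ x)) (φ ⁻¹' U)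
  isotropy : ∀ q : M, β (φ q) = Nat.card (MulAction.stabilizer G q)

end Surface

/-- The orbifold `(ℙ², β)` is uniformized by a K3 surface. -/
def UniformizedByK3 (β : ProjectivePlane → ℕ) : Prop :=
  ∃ (M : Type) (_ : TopologicalSpace M) (_ : ChartedSpace (Fin 2 → ℂ) M)
    (G : Type) (_ : Group G) (_ : MulAction G M) (φ : M → ProjectivePlane),
    IsK3Surface M ∧ IsUniformization G φ β

end K3Uniformization

open scoped Manifold ContDiff

namespace K3Uniformization

open Set Metric Filter Topology MeasureTheory

/-! ### Holomorphic functions of several variables: Cauchy integrals, removable sets, division by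
linear forms -/

section SeveralVariables

variable {E : Type*} [NormedAddCommGroup E] [NormedSpace ℂ E]

/-! The three orbifolds are treated uniformly. Write `L i` for the forms defining the lines and
adjoin a root `y i` with `y i ^ b i = L i`; this gives a cone over `ℂ³ ∖ 0`. Let `N` be a common
multiple of the `b i` and `d i = N / b i`. Then `ℂˣ` acts with weight `N` on `v` and `d i` on `y i`,
and the surface is the quotient. Concretely one gets a sextic in `ℙ(1,1,1,3)`, a quartic in `ℙ³`,
and an intersection of three quadrics in `ℙ⁵`. By general position at most two roots vanish at a
point, and since three of the weights are `1`, some root of weight one is nonzero there. So the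
action is free, and the two possibly vanishing roots, normalized, are local coordinates. The product
of the groups of roots of unity acts with quotient `ℙ²`. Its image in the automorphisms is the
uniformizing group, and the isotropy over a point has order the product of the `b i` over the lines
through it (`card_stabilizer`).

The form `det (v, dv, dv) / ∏ y i ^ (b i - 1)` has no zeros or poles. It is invariant because
numerator and denominator have the weights `3 * N` and `∑ d i * (b i - 1)`, which agree; this is the
Calabi–Yau condition `∑ (1 - 1 / b i) = 3` (`coeff_change`).

Connectedness: a connected component is open and closed, so it maps onto `ℙ²`, and each change of a
single root has fixed points over its line, so it preserves the component.

For `H¹ = 0`, a cocycle is refined to a cover pulled back from `ℙ²` and expanded in the monomials `∏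
y i ^ s i`, `s i < b i` (`exists_monomial_decomposition`). The coefficients are homogeneous cocycles
on open cones in `ℂ³ ∖ 0`, and these are coboundaries with the same homogeneity
(`conical_cocycle_is_coboundary`), which is the vanishing of `H¹(ℙ², 𝒪(k))`. A partition of unity
solves the problem smoothly, a Cauchy transform in one direction corrects the solution off a
coordinate axis, and Hartogs' theorem crosses that axis because it has codimension two. -/

theorem norm_fderiv_le_of_bounded {f : E → ℂ} {p : E} {r C : ℝ} (hr : 0 < r)
    (hf : DifferentiableOn ℂ f (ball p r)) (hC : ∀ v ∈ ball p r, ‖f v‖ ≤ C) :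
    ‖fderiv ℂ f p‖ ≤ 2 * C / r := by
  refine Complex.norm_fderiv_le_div_of_mapsTo_ball hf (fun v hv => ?_) hr
  rw [mem_closedBall, dist_eq_norm]
  calc ‖f v - f p‖ ≤ ‖f v‖ + ‖f p‖ := norm_sub_le _ _
    _ ≤ C + C := add_le_add (hC v hv) (hC p (mem_ball_self hr))
    _ = 2 * C := by ring

theorem eq_of_eventuallyEq_line {f g : E → ℂ} {q e : E} (hf : ContinuousAt f q)
    (hg : ContinuousAt g q) (h : ∀ᶠ t : ℂ in 𝓝[≠] 0, f (q + t • e) = g (q + t • e)) :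
    f q = g q := by
  have hline : Tendsto (fun t : ℂ => q + t • e) (𝓝[≠] 0) (𝓝 q) := by
    have : ContinuousAt (fun t : ℂ => q + t • e) 0 := by fun_prop
    simpa using this.tendsto.mono_left (nhdsWithin_le_nhds (s := {0}ᶜ))
  exact tendsto_nhds_unique_of_eventuallyEq (hf.tendsto.comp hline) (hg.tendsto.comp hline) h

theorem eventually_add_smul_mem {U : Set E} {q : E} (hU : U ∈ 𝓝 q) (e : E) :
    ∀ᶠ t : ℂ in 𝓝[≠] 0, q + t • e ∈ U := by
  have : ContinuousAt (fun t : ℂ => q + t • e) 0 := by fun_prop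
  exact (this.tendsto.mono_left (nhdsWithin_le_nhds (s := {0}ᶜ))) (by simpa using hU)

theorem exists_uniform_disc {U : Set E} (hU : IsOpen U) {p : E} (hp : p ∈ U) (e : E) :
    ∃ r > 0, ∃ δ > 0, ∀ v ∈ ball p δ, ∀ τ ∈ closedBall (0 : ℂ) r, v + τ • e ∈ U := by
  obtain ⟨ε, hε, hεU⟩ := Metric.isOpen_iff.1 hU p hp
  refine ⟨ε / 2 / (‖e‖ + 1), by positivity, ε / 2, by positivity, fun v hv τ hτ => hεU ?_⟩
  have hre : ε / 2 / (‖e‖ + 1) * ‖e‖ < ε / 2 := by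
    rw [div_mul_eq_mul_div, div_lt_iff₀ (by positivity)]
    nlinarith [norm_nonneg e]
  rw [mem_ball, dist_eq_norm] at *
  have h1 : ‖τ‖ ≤ ε / 2 / (‖e‖ + 1) := by simpa using hτ
  calc ‖v + τ • e - p‖ = ‖(v - p) + τ • e‖ := by congr 1; abel
    _ ≤ ‖v - p‖ + ‖τ‖ * ‖e‖ := (norm_add_le _ _).trans (by rw [norm_smul])
    _ ≤ ‖v - p‖ + ε / 2 / (‖e‖ + 1) * ‖e‖ := by gcongr
    _ < ε := by linarith

/-- The Cauchy mean value of `f` along the circle of radius `r` in the direction `e`. -/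
noncomputable def circleMean (f : E → ℂ) (r : ℝ) (e v : E) : ℂ :=
  ∮ τ in C(0, r), (2 * Real.pi * Complex.I)⁻¹ * τ⁻¹ * f (v + τ • e)

theorem circleMean_eq {f : E → ℂ} {r : ℝ} (hr : 0 < r) {e v : E} {k : ℂ → ℂ} {s : Set ℂ}
    (hs : s.Countable) (hk : ContinuousOn k (closedBall 0 r))
    (hd : ∀ τ ∈ ball (0 : ℂ) r \ s, DifferentiableAt ℂ k τ)
    (hkf : ∀ τ ∈ sphere (0 : ℂ) r, f (v + τ • e) = k τ) : circleMean f r e v = k 0 := by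
  have h := Complex.circleIntegral_sub_inv_smul_of_differentiable_on_off_countable hs
    (mem_ball_self hr) hk hd
  have h2 : (2 * Real.pi * Complex.I : ℂ) ≠ 0 := by simp [Real.pi_ne_zero]
  rw [smul_eq_mul, ← inv_mul_eq_iff_eq_mul₀ h2, ← circleIntegral.integral_const_mul] at h
  rw [← h]
  refine circleIntegral.integral_congr hr.le fun τ hτ => ?_
  simp [hkf τ hτ, mul_assoc]

/-- Local extensions across a thin closed set glue: each point of `S` is a limit of points off `S`
along a complex line, so two continuous extensions have the same value there. -/
theorem exists_differentiableOn_extension {f : E → ℂ} {U S : Set E} (hU : IsOpen U)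
    (hS : IsClosed S) (hthin : ∀ q ∈ S, ∃ e : E, ∀ᶠ t : ℂ in 𝓝[≠] 0, q + t • e ∉ S)
    (hf : ∀ v ∈ U, v ∉ S → DifferentiableAt ℂ f v)
    (hloc : ∀ p ∈ U ∩ S, ∃ F : E → ℂ, ∃ W ∈ 𝓝 p, DifferentiableOn ℂ F W ∧
      ∀ v ∈ W, v ∉ S → F v = f v) :
    ∃ F : E → ℂ, DifferentiableOn ℂ F U ∧ ∀ v ∈ U, v ∉ S → F v = f v := by
  classical
  choose! F W hW hF hFf using hloc
  refine ⟨fun v => if v ∈ S then F v v else f v, fun p hp => ?_, fun v _ hv => if_neg hv⟩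
  by_cases hpS : p ∈ S
  · refine (((hF p ⟨hp, hpS⟩).differentiableAt (hW p ⟨hp, hpS⟩)).congr_of_eventuallyEq
      ?_).differentiableWithinAt
    filter_upwards [hU.mem_nhds hp, eventually_mem_nhds_iff.2 (hW p ⟨hp, hpS⟩)] with q hqU hqW
    by_cases hqS : q ∈ S
    · rw [if_pos hqS]
      obtain ⟨e, he⟩ := hthin q hqS
      refine eq_of_eventuallyEq_line (e := e)
        ((hF q ⟨hqU, hqS⟩).differentiableAt (hW q ⟨hqU, hqS⟩)).continuousAt
        ((hF p ⟨hp, hpS⟩).differentiableAt hqW).continuousAt ?_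
      filter_upwards [he, eventually_add_smul_mem (hW q ⟨hqU, hqS⟩) e,
        eventually_add_smul_mem hqW e] with t h1 h2 h3
      rw [hFf q ⟨hqU, hqS⟩ _ h2 h1, hFf p ⟨hp, hpS⟩ _ h3 h1]
    · rw [if_neg hqS, hFf p ⟨hp, hpS⟩ q (mem_of_mem_nhds hqW) hqS]
  · refine ((hf p hp hpS).congr_of_eventuallyEq ?_).differentiableWithinAt
    filter_upwards [hS.isOpen_compl.mem_nhds hpS] with v hv
    exact if_neg hv

variable [FiniteDimensional ℂ E]

/-- Holomorphic dependence on the base point of a Cauchy integral along a moving circle. -/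
theorem differentiableAt_circleIntegral_translate {f : E → ℂ} {U : Set E} (hU : IsOpen U)
    (hf : DifferentiableOn ℂ f U) {w : ℂ → ℂ} {r : ℝ} (hr : 0 ≤ r)
    (hw : ContinuousOn w (sphere 0 r)) {p e : E} (hp : ∀ τ ∈ sphere (0 : ℂ) r, p + τ • e ∈ U) :
    DifferentiableAt ℂ (fun v => ∮ τ in C(0, r), w τ * f (v + τ • e)) p := by
  borelize E
  have : ProperSpace E := FiniteDimensional.proper ℂ E
  have : SecondCountableTopology E := inferInstance
  set K : Set E := (fun τ : ℂ => p + τ • e) '' sphere 0 r with hK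
  have hKc : IsCompact K := (isCompact_sphere _ _).image (by fun_prop)
  have hKU : K ⊆ U := by rintro _ ⟨τ, hτ, rfl⟩; exact hp τ hτ
  obtain ⟨δ, hδ, hδU⟩ := hKc.exists_cthickening_subset_open hU hKU
  have hcomp : IsCompact (cthickening δ K) := hKc.cthickening
  obtain ⟨C, hC⟩ := hcomp.exists_bound_of_continuousOn (hf.continuousOn.mono hδU)
  obtain ⟨W, hW⟩ := (isCompact_sphere (0 : ℂ) r).exists_bound_of_continuousOn hw
  have hmem : ∀ v ∈ ball p (δ / 2), ∀ τ ∈ sphere (0 : ℂ) r,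
      ball (v + τ • e) (δ / 2) ⊆ cthickening δ K := by
    intro v hv τ hτ x hx
    refine thickening_subset_cthickening _ _ (mem_thickening_iff.2 ⟨p + τ • e, ⟨τ, hτ, rfl⟩, ?_⟩)
    rw [mem_ball] at hx hv
    calc dist x (p + τ • e) ≤ dist x (v + τ • e) + dist (v + τ • e) (p + τ • e) :=
          dist_triangle _ _ _
      _ = dist x (v + τ • e) + dist v p := by rw [dist_add_right]
      _ < δ := by linarith
  have hδ2 : 0 < δ / 2 := by linarith
  have hsph : ∀ θ : ℝ, circleMap 0 r θ ∈ sphere (0 : ℂ) r := fun θ =>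
    circleMap_mem_sphere _ hr θ
  have hdiff : ∀ v ∈ ball p (δ / 2), ∀ τ ∈ sphere (0 : ℂ) r, DifferentiableAt ℂ f (v + τ • e) :=
    fun v hv τ hτ => hf.differentiableAt
      (hU.mem_nhds (hδU (hmem v hv τ hτ (mem_ball_self hδ2))))
  have hbd : ∀ v ∈ ball p (δ / 2), ∀ τ ∈ sphere (0 : ℂ) r,
      ‖fderiv ℂ f (v + τ • e)‖ ≤ 2 * C / (δ / 2) := fun v hv τ hτ =>
    norm_fderiv_le_of_bounded hδ2 (hf.mono ((hmem v hv τ hτ).trans hδU))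
      fun x hx => hC x (hmem v hv τ hτ hx)
  have hwc : Continuous fun θ : ℝ => w (circleMap 0 r θ) :=
    hw.comp_continuous (continuous_circleMap 0 r) hsph
  have hdc : Continuous fun θ : ℝ => deriv (circleMap 0 r) θ := by
    simp only [deriv_circleMap]; fun_prop
  have hcont : ∀ v ∈ ball p (δ / 2), Continuous fun θ : ℝ =>
      deriv (circleMap 0 r) θ • (w (circleMap 0 r θ) * f (v + circleMap 0 r θ • e)) := by
    intro v hv
    refine hdc.smul (hwc.mul ?_)
    refine continuous_iff_continuousAt.2 fun θ => ?_
    exact ContinuousAt.comp (f := fun θ : ℝ => v + circleMap 0 r θ • e)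
      (hdiff v hv _ (hsph θ)).continuousAt (by fun_prop)
  refine (intervalIntegral.hasFDerivAt_integral_of_dominated_of_fderiv_le (𝕜 := ℂ)
    (F' := fun v θ => (deriv (circleMap 0 r) θ * w (circleMap 0 r θ)) •
      fderiv ℂ f (v + circleMap 0 r θ • e))
    (bound := fun _ => r * W * (2 * C / (δ / 2))) (s := ball p (δ / 2))
    (ball_mem_nhds _ hδ2) ?_ ?_ ?_ ?_ ?_ ?_).differentiableAt
  · filter_upwards [ball_mem_nhds p hδ2] with v hv
    exact (hcont v hv).aestronglyMeasurable
  · exact (hcont p (mem_ball_self hδ2)).intervalIntegrable _ _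
  · refine AEStronglyMeasurable.smul (hdc.mul hwc).aestronglyMeasurable ?_
    exact ((measurable_fderiv ℂ f).comp
      (by fun_prop : Measurable fun θ : ℝ => p + circleMap 0 r θ • e)).stronglyMeasurable
        |>.aestronglyMeasurable
  · refine Eventually.of_forall fun θ _ v hv => ?_
    rw [norm_smul, norm_mul]
    have h1 : ‖deriv (circleMap 0 r) θ‖ = r := by
      simp [deriv_circleMap, abs_of_nonneg hr]
    rw [h1]
    have h2 := hW _ (hsph θ)
    have h3 := hbd v hv _ (hsph θ)
    have h4 : (0 : ℝ) ≤ W := (norm_nonneg _).trans h2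
    gcongr
  · exact intervalIntegrable_const
  · refine Eventually.of_forall fun θ _ v hv => ?_
    have h := ((hdiff v hv _ (hsph θ)).hasFDerivAt.comp v
      ((hasFDerivAt_id v).add_const (circleMap 0 r θ • e))).const_mul
        (deriv (circleMap 0 r) θ * w (circleMap 0 r θ))
    have h' := h.congr_of_eventuallyEq (f₁ := fun x => deriv (circleMap 0 r) θ •
      (fun τ => w τ * f (x + τ • e)) (circleMap 0 r θ))
      (Eventually.of_forall fun x => by simp [mul_assoc])
    exact h'.congr_fderiv (by ext; simp)

/-- Cauchy's formula writes the derivative in the direction `e` as an integral of `f` against `(2πi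
τ²)⁻¹` over a circle in that direction, and such an integral is holomorphic in its base point. -/
theorem differentiableOn_fderiv_apply {f : E → ℂ} {U : Set E} (hU : IsOpen U)
    (hf : DifferentiableOn ℂ f U) (e : E) : DifferentiableOn ℂ (fun v => fderiv ℂ f v e) U := by
  intro p hp
  obtain ⟨r, hr0, δ, hδ, hmem⟩ := exists_uniform_disc hU hp e
  have key := (differentiableAt_circleIntegral_translate hU hf (w := fun τ => (2 * Real.pi *
    Complex.I)⁻¹ * (τ ^ 2)⁻¹) hr0.le (by
      refine continuousOn_const.mul (ContinuousOn.inv₀ (by fun_prop) fun τ hτ => ?_)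
      have : τ ≠ 0 := by rintro rfl; simp at hτ; linarith
      exact pow_ne_zero _ this) (p := p) (e := e)
      (fun τ hτ => hmem p (mem_ball_self hδ) τ (sphere_subset_closedBall hτ)))
  refine (key.congr_of_eventuallyEq ?_).differentiableWithinAt
  filter_upwards [ball_mem_nhds p hδ] with v hv
  have hd : DifferentiableOn ℂ (fun τ : ℂ => f (v + τ • e)) (closedBall 0 r) := fun τ hτ =>
    ((hf.differentiableAt (hU.mem_nhds (hmem v hv τ hτ))).comp τ
      (by fun_prop : DifferentiableAt ℂ (fun τ : ℂ => v + τ • e) τ)).differentiableWithinAt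
  have hv0 : v ∈ U := by simpa using hmem v hv 0 (by simpa using hr0.le)
  have hder : deriv (fun τ : ℂ => f (v + τ • e)) 0 = fderiv ℂ f v e := by
    have h1 : HasFDerivAt f (fderiv ℂ f v) (v + (0 : ℂ) • e) := by
      simpa using (hf.differentiableAt (hU.mem_nhds hv0)).hasFDerivAt
    have h2 : HasDerivAt (fun τ : ℂ => v + τ • e) e 0 := by
      simpa using ((hasDerivAt_id (0 : ℂ)).smul_const e).const_add v
    exact (h1.comp_hasDerivAt 0 h2).deriv
  have hc := DifferentiableOn.deriv_eq_smul_circleIntegral hr0 hd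
  rw [hder] at hc
  have h2 : (2 * Real.pi * Complex.I : ℂ) ≠ 0 := by simp [Real.pi_ne_zero]
  rw [smul_eq_mul, ← inv_mul_eq_iff_eq_mul₀ h2] at hc
  rw [← hc, ← circleIntegral.integral_const_mul]
  congr 1; ext τ; simp [mul_assoc]

theorem contDiffOn_of_differentiableOn {f : E → ℂ} {U : Set E} (hU : IsOpen U)
    (hf : DifferentiableOn ℂ f U) (n : ℕ) : ContDiffOn ℂ n f U := by
  induction n generalizing f with
  | zero => exact contDiffOn_zero.2 hf.continuousOn
  | succ n ih =>
    push_cast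
    rw [contDiffOn_succ_iff_fderiv_of_isOpen hU]
    exact ⟨hf, by simp, contDiffOn_clm_apply.2 fun e => ih (differentiableOn_fderiv_apply hU hf e)⟩

theorem differentiableAt_circleMean {f : E → ℂ} {U : Set E} (hU : IsOpen U)
    (hf : DifferentiableOn ℂ f U) {r : ℝ} (hr : 0 < r) {p e : E}
    (hp : ∀ τ ∈ sphere (0 : ℂ) r, p + τ • e ∈ U) :
    DifferentiableAt ℂ (circleMean f r e) p := by
  refine differentiableAt_circleIntegral_translate hU hf
    (w := fun τ => (2 * Real.pi * Complex.I)⁻¹ * τ⁻¹) hr.le ?_ hp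
  refine continuousOn_const.mul (ContinuousOn.inv₀ (by fun_prop) fun τ hτ => ?_)
  rintro rfl
  simp at hτ
  linarith

/-- Riemann's removable singularity theorem along a hyperplane, for continuous functions. -/
theorem differentiableOn_of_continuousOn_off_hyperplane {f : E → ℂ} {U : Set E} (hU : IsOpen U)
    {l : E →L[ℂ] ℂ} (hl : l ≠ 0) (hc : ContinuousOn f U)
    (hd : ∀ v ∈ U, l v ≠ 0 → DifferentiableAt ℂ f v) : DifferentiableOn ℂ f U := by
  intro p hp
  by_cases hlp : l p = 0
  swap
  · exact (hd p hp hlp).differentiableWithinAt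
  obtain ⟨e, he⟩ : ∃ e, l e = 1 := by
    obtain ⟨x, hx⟩ := DFunLike.ne_iff.1 hl
    exact ⟨(l x)⁻¹ • x, by simp at hx ⊢; field_simp⟩
  obtain ⟨r, hr, δ, hδ, hmem⟩ := exists_uniform_disc hU hp e
  have hV : IsOpen (U ∩ {v | l v ≠ 0}) := hU.inter (isOpen_ne_fun l.continuous continuous_const)
  have key : DifferentiableAt ℂ (circleMean f r e) p := by
    refine differentiableAt_circleMean hV (fun v hv => (hd v hv.1 hv.2).differentiableWithinAt) hr
      fun τ hτ => ⟨hmem p (mem_ball_self hδ) τ (sphere_subset_closedBall hτ), ?_⟩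
    have : τ ≠ 0 := by rintro rfl; simp at hτ; linarith
    simpa [hlp, he] using this
  refine (key.congr_of_eventuallyEq ?_).differentiableWithinAt
  filter_upwards [ball_mem_nhds p hδ] with v hv
  -- Along the line `v + τ • e` the form `l` takes the value `l v + τ`, so only `τ = -l v` is
  -- exceptional; Cauchy's formula tolerates countably many such points.
  rw [circleMean_eq hr (k := fun τ => f (v + τ • e)) (countable_singleton (-l v)) ?_ ?_
    fun _ _ => rfl]
  · simp
  · exact hc.comp (by fun_prop) fun τ hτ => hmem v hv τ hτ
  · rintro τ ⟨hτ, hτs⟩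
    refine DifferentiableAt.comp (f := fun τ : ℂ => v + τ • e) τ
      (hd _ (hmem v hv τ (ball_subset_closedBall hτ)) ?_) (by fun_prop)
    simp only [map_add, map_smul, he, smul_eq_mul, mul_one]
    intro h
    exact hτs (eq_neg_of_add_eq_zero_right h)

/-- Hartogs' extension theorem across a linear subspace of codimension two. -/
theorem exists_extension_of_codim_two {f : E → ℂ} {U : Set E} (hU : IsOpen U)
    {l l' : E →L[ℂ] ℂ} {e e' : E} (he : l e = 1) (he' : l' e = 0) (he'' : l' e' = 1)
    (hf : ∀ v ∈ U, ¬ (l v = 0 ∧ l' v = 0) → DifferentiableAt ℂ f v) :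
    ∃ F : E → ℂ, DifferentiableOn ℂ F U ∧ ∀ v ∈ U, ¬ (l v = 0 ∧ l' v = 0) → F v = f v := by
  have hS : IsClosed {v | l v = 0 ∧ l' v = 0} :=
    (isClosed_eq l.continuous continuous_const).inter (isClosed_eq l'.continuous continuous_const)
  have hV : IsOpen (U ∩ {v | l v = 0 ∧ l' v = 0}ᶜ) := hU.inter hS.isOpen_compl
  have hfV : DifferentiableOn ℂ f (U ∩ {v | l v = 0 ∧ l' v = 0}ᶜ) := fun v hv =>
    (hf v hv.1 hv.2).differentiableWithinAt
  refine exists_differentiableOn_extension hU hS (fun q hq => ⟨e', ?_⟩)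
    (fun v hv hvS => hf v hv hvS) ?_
  · filter_upwards [self_mem_nhdsWithin] with t ht h
    have h2 := h.2
    simp only [map_add, map_smul, hq.2, he'', smul_eq_mul, mul_one, zero_add] at h2
    exact ht h2
  rintro p ⟨hpU, hp, hp'⟩
  obtain ⟨r, hr, δ, hδ, hmem⟩ := exists_uniform_disc hU hpU e
  -- The bound on `l v` keeps the zero of `l` on the line strictly inside the circle, so the circle
  -- of integration avoids the singular set. As `l'` is constant on the line, the whole disc avoids
  -- it when `l' v ≠ 0`, and there the mean returns `f`.
  set W : Set E := ball p δ ∩ {v | ‖l v‖ < r} with hWdef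
  have hWo : IsOpen W := isOpen_ball.inter (isOpen_lt l.continuous.norm continuous_const)
  have hdiff : DifferentiableOn ℂ (circleMean f r e) W := by
    rintro v ⟨hv, hv'⟩
    refine (differentiableAt_circleMean hV hfV hr fun τ hτ =>
      ⟨hmem v hv τ (sphere_subset_closedBall hτ), ?_⟩).differentiableWithinAt
    rintro ⟨h, -⟩
    simp only [map_add, map_smul, he, smul_eq_mul, mul_one] at h
    rw [mem_ofPred_eq, eq_neg_of_add_eq_zero_left h, norm_neg] at hv'
    simp at hτ
    linarith
  have heq : ∀ v ∈ W, l' v ≠ 0 → circleMean f r e v = f v := by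
    rintro v ⟨hv, -⟩ hlv
    have hd : ∀ τ ∈ closedBall (0 : ℂ) r, DifferentiableAt ℂ (fun τ : ℂ => f (v + τ • e)) τ :=
      fun τ hτ => DifferentiableAt.comp (f := fun τ : ℂ => v + τ • e) τ
        (hf _ (hmem v hv τ hτ) (by simp [he', hlv])) (by fun_prop)
    rw [circleMean_eq hr (k := fun τ => f (v + τ • e)) (countable_empty)
      (fun τ hτ => (hd τ hτ).continuousAt.continuousWithinAt)
      (fun τ hτ => hd τ (ball_subset_closedBall hτ.1)) fun _ _ => rfl]
    simp
  refine ⟨circleMean f r e, W, hWo.mem_nhds ⟨mem_ball_self hδ, by simpa [hp] using hr⟩,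
    hdiff, fun v hv hvS => ?_⟩
  by_cases hlv : l' v = 0
  · have hvU : v ∈ U := by simpa using hmem v hv.1 0 (by simpa using hr.le)
    refine eq_of_eventuallyEq_line (e := e')
      (hdiff.differentiableAt (hWo.mem_nhds hv)).continuousAt (hf v hvU hvS).continuousAt ?_
    filter_upwards [eventually_add_smul_mem (hWo.mem_nhds hv) e', self_mem_nhdsWithin] with t h1 h2
    exact heq _ h1 (by simpa [hlv, he''] using h2)
  · exact heq v hv hlv

/-- The quotient `H / l` extends across `l = 0`. Restricted to a line transversal to the hyperplane
it is a divided difference of `H`, hence holomorphic, so its circle mean supplies the extension. -/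
theorem exists_eq_mul_of_vanishing {H : E → ℂ} {U : Set E} (hU : IsOpen U)
    (hH : DifferentiableOn ℂ H U) {l : E →L[ℂ] ℂ} (hl : l ≠ 0) (h0 : ∀ v ∈ U, l v = 0 → H v = 0) :
    ∃ K : E → ℂ, DifferentiableOn ℂ K U ∧ ∀ v ∈ U, H v = l v * K v := by
  obtain ⟨e, he⟩ : ∃ e, l e = 1 := by
    obtain ⟨x, hx⟩ := DFunLike.ne_iff.1 hl
    exact ⟨(l x)⁻¹ • x, by simp at hx ⊢; field_simp⟩
  have hS : IsClosed {v | l v = 0} := isClosed_eq l.continuous continuous_const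
  have hdH : ∀ v ∈ U, DifferentiableAt ℂ H v := fun v hv => hH.differentiableAt (hU.mem_nhds hv)
  have hf : ∀ v ∈ U, v ∉ {v | l v = 0} → DifferentiableAt ℂ (fun v => H v / l v) v :=
    fun v hv hlv => by
      simpa only [div_eq_mul_inv] using (hdH v hv).fun_mul (l.differentiableAt.fun_inv hlv)
  have hV : IsOpen (U ∩ {v | l v = 0}ᶜ) := hU.inter hS.isOpen_compl
  suffices hex : ∃ K : E → ℂ, DifferentiableOn ℂ K U ∧
      ∀ v ∈ U, v ∉ {v | l v = 0} → K v = H v / l v by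
    obtain ⟨K, hK, hKH⟩ := hex
    refine ⟨K, hK, fun v hv => ?_⟩
    by_cases hlv : l v = 0
    · simp [hlv, h0 v hv hlv]
    · rw [hKH v hv hlv]; field_simp
  refine exists_differentiableOn_extension hU hS (fun q hq => ⟨e, ?_⟩) hf ?_
  · filter_upwards [self_mem_nhdsWithin] with t ht
    have : l q = 0 := hq
    simpa [this, he] using ht
  rintro p ⟨hpU, hp⟩
  have hp : l p = 0 := hp
  obtain ⟨r, hr, δ, hδ, hmem⟩ := exists_uniform_disc hU hpU e
  refine ⟨circleMean (fun v => H v / l v) r e, ball p δ ∩ {v | ‖l v‖ < r},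
    (isOpen_ball.inter (isOpen_lt l.continuous.norm continuous_const)).mem_nhds
      ⟨mem_ball_self hδ, by simpa [hp] using hr⟩, ?_, ?_⟩
  · rintro v ⟨hv, hv'⟩
    refine (differentiableAt_circleMean hV
      (fun v hv => (hf v hv.1 hv.2).differentiableWithinAt) hr fun τ hτ =>
      ⟨hmem v hv τ (sphere_subset_closedBall hτ), ?_⟩).differentiableWithinAt
    intro h
    simp only [mem_ofPred_eq, map_add, map_smul, he, smul_eq_mul, mul_one] at h
    rw [mem_ofPred_eq, eq_neg_of_add_eq_zero_left h, norm_neg] at hv'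
    simp at hτ
    linarith
  · rintro v ⟨hv, hv'⟩ hlv
    have hlv : l v ≠ 0 := hlv
    have hd : DifferentiableOn ℂ (fun τ : ℂ => H (v + τ • e)) (ball 0 r) := fun τ hτ =>
      (DifferentiableAt.comp (f := fun τ : ℂ => v + τ • e) τ
        (hdH _ (hmem v hv τ (ball_subset_closedBall hτ))) (by fun_prop)).differentiableWithinAt
    have hc : ContinuousOn (fun τ : ℂ => H (v + τ • e)) (closedBall 0 r) := fun τ hτ =>
      (DifferentiableAt.comp (f := fun τ : ℂ => v + τ • e) τ
        (hdH _ (hmem v hv τ hτ)) (by fun_prop)).continuousAt.continuousWithinAt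
    have hb : -l v ∈ ball (0 : ℂ) r := by simpa using hv'
    have hb' : ball (0 : ℂ) r ∈ 𝓝 (-l v) := isOpen_ball.mem_nhds hb
    have hz : H (v + (-l v) • e) = 0 :=
      h0 _ (hmem v hv _ (ball_subset_closedBall hb)) (by simp [he])
    have hds : DifferentiableOn ℂ (dslope (fun τ : ℂ => H (v + τ • e)) (-l v)) (ball 0 r) :=
      (Complex.differentiableOn_dslope hb').2 hd
    have hval : ∀ τ : ℂ, τ ≠ -l v →
        dslope (fun τ : ℂ => H (v + τ • e)) (-l v) τ = H (v + τ • e) / l (v + τ • e) := by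
      intro τ hτ
      rw [dslope_of_ne _ hτ, slope_def_field, hz]
      simp [he, add_comm]
    rw [circleMean_eq hr (k := dslope (fun τ : ℂ => H (v + τ • e)) (-l v)) countable_empty
      ?_ ?_ ?_, hval 0 (by simpa using hlv)]
    · simp
    · exact (continuousOn_dslope (mem_of_superset hb' ball_subset_closedBall)).2
        ⟨hc, hd.differentiableAt hb'⟩
    · exact fun τ hτ => hds.differentiableAt (isOpen_ball.mem_nhds hτ.1)
    · intro τ hτ
      refine (hval τ ?_).symm
      rintro rfl
      simp at hτ hv'
      linarith

theorem exists_eq_prod_mul_of_vanishing {ι : Type*} {U : Set E} (hU : IsOpen U)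
    (L : ι → E →L[ℂ] ℂ) (s : Finset ι)
    (hL : ∀ i ∈ s, ∀ j ∈ s, i ≠ j → ∃ e, L j e = 0 ∧ L i e ≠ 0) (hL0 : ∀ i ∈ s, L i ≠ 0)
    {H : E → ℂ} (hH : DifferentiableOn ℂ H U) (h0 : ∀ i ∈ s, ∀ v ∈ U, L i v = 0 → H v = 0) :
    ∃ K : E → ℂ, DifferentiableOn ℂ K U ∧ ∀ v ∈ U, H v = (∏ i ∈ s, L i v) * K v := by
  classical
  induction s using Finset.induction_on generalizing H with
  | empty => exact ⟨H, hH, by simp⟩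
  | insert i s his ih =>
    obtain ⟨K, hK, hHK⟩ := exists_eq_mul_of_vanishing hU hH (hL0 i (Finset.mem_insert_self i s))
      (h0 i (Finset.mem_insert_self i s))
    have hvan : ∀ j ∈ s, ∀ v ∈ U, L j v = 0 → K v = 0 := by
      intro j hj v hv hjv
      -- Off `L i = 0` the factor `L i` can be cancelled from `H = L i * K`. The points with `L i =
      -- 0` are then reached by continuity inside the hyperplane `L j = 0`.
      have hKz : ∀ w ∈ U, L j w = 0 → L i w ≠ 0 → K w = 0 := by
        intro w hw hjw hiw
        have := hHK w hw
        rw [h0 j (Finset.mem_insert_of_mem hj) w hw hjw] at this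
        exact (mul_eq_zero.1 this.symm).resolve_left hiw
      by_cases hiv : L i v = 0
      swap
      · exact hKz v hv hjv hiv
      obtain ⟨e, hje, hie⟩ := hL i (Finset.mem_insert_self i s) j (Finset.mem_insert_of_mem hj)
        (by rintro rfl; exact his hj)
      refine eq_of_eventuallyEq_line (g := fun _ => 0) (e := e)
        (hK.differentiableAt (hU.mem_nhds hv)).continuousAt continuousAt_const ?_
      filter_upwards [eventually_add_smul_mem (hU.mem_nhds hv) e, self_mem_nhdsWithin] with t h1 h2
      refine hKz _ h1 (by simp [hjv, hje]) ?_
      simpa [hiv, hie] using h2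
    obtain ⟨K', hK', hKK'⟩ := ih
      (fun j hj k hk => hL j (Finset.mem_insert_of_mem hj) k (Finset.mem_insert_of_mem hk))
      (fun j hj => hL0 j (Finset.mem_insert_of_mem hj)) hK hvan
    refine ⟨K', hK', fun v hv => ?_⟩
    rw [hHK v hv, hKK' v hv, Finset.prod_insert his, mul_assoc]

theorem differentiableOn_of_continuousOn_off_hyperplanes {ι : Type*} {U : Set E} (hU : IsOpen U)
    (L : ι → E →L[ℂ] ℂ) (s : Finset ι) (hL0 : ∀ i ∈ s, L i ≠ 0) {f : E → ℂ}
    (hc : ContinuousOn f U) (hd : ∀ v ∈ U, (∀ i ∈ s, L i v ≠ 0) → DifferentiableAt ℂ f v) :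
    DifferentiableOn ℂ f U := by
  classical
  induction s using Finset.induction_on generalizing U with
  | empty => exact fun v hv => (hd v hv (by simp)).differentiableWithinAt
  | insert i s his ih =>
    refine differentiableOn_of_continuousOn_off_hyperplane hU
      (hL0 i (Finset.mem_insert_self i s)) hc fun v hv hiv => ?_
    have hV : IsOpen (U ∩ {v | L i v ≠ 0}) :=
      hU.inter (isOpen_ne_fun (L i).continuous continuous_const)
    refine (ih hV (fun j hj => hL0 j (Finset.mem_insert_of_mem hj)) (hc.mono inter_subset_left)
      fun w hw hs => hd w hw.1 ?_).differentiableAt (hV.mem_nhds ⟨hv, hiv⟩)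
    intro j hj
    rcases Finset.mem_insert.1 hj with rfl | hj
    · exact hw.2
    · exact hs j hj

end SeveralVariables

end K3Uniformization

namespace K3Uniformization

open Set Metric Filter Topology MeasureTheory

/-! ### The Cauchy–Pompeiu formula and the `∂̄`-equation -/

section CauchyTransform

/-- For `c = 1` the function is the radial derivative in polar coordinates, and for `c = I` it is
the angular derivative divided by the radius. -/
theorem continuous_fderiv_polar {ψ : ℂ → ℂ} (hψ : ContDiff ℝ 1 ψ) (c : ℂ) :
    Continuous fun p : ℝ × ℝ =>
      fderiv ℝ ψ (p.1 * Complex.exp (p.2 * Complex.I)) (c * Complex.exp (p.2 * Complex.I)) :=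
  ((hψ.continuous_fderiv one_ne_zero).comp (by fun_prop)).clm_apply (by fun_prop)

theorem integrableOn_fderiv_polar {ψ : ℂ → ℂ} (hψ : ContDiff ℝ 1 ψ) (hs : HasCompactSupport ψ)
    (c : ℂ) : IntegrableOn (fun p : ℝ × ℝ =>
      fderiv ℝ ψ (p.1 * Complex.exp (p.2 * Complex.I)) (c * Complex.exp (p.2 * Complex.I)))
      (Ioi 0 ×ˢ Ioo (-Real.pi) Real.pi) := by
  obtain ⟨R, hR⟩ := (hs.fderiv (𝕜 := ℝ)).isCompact.isBounded.subset_closedBall 0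
  have hcont := continuous_fderiv_polar hψ c
  have h1 : IntegrableOn (fun p : ℝ × ℝ =>
      fderiv ℝ ψ (p.1 * Complex.exp (p.2 * Complex.I)) (c * Complex.exp (p.2 * Complex.I)))
      (Icc 0 R ×ˢ Icc (-Real.pi) Real.pi) :=
    hcont.continuousOn.integrableOn_compact (isCompact_Icc.prod isCompact_Icc)
  refine h1.of_forall_sdiff_eq_zero (measurableSet_Ioi.prod measurableSet_Ioo) ?_
  rintro ⟨r, θ⟩ ⟨⟨hr, hθ⟩, hn⟩
  have hrR : R < r := by
    by_contra hle
    exact hn ⟨⟨(mem_Ioi.1 hr).le, not_lt.1 hle⟩, Ioo_subset_Icc_self hθ⟩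
  have : fderiv ℝ ψ (r * Complex.exp (θ * Complex.I)) = 0 := by
    refine image_eq_zero_of_notMem_tsupport fun hmem => ?_
    have := hR hmem
    simp [Complex.norm_exp_ofReal_mul_I, abs_of_pos (mem_Ioi.1 hr)] at this
    linarith
  simp [this]

/-- The Cauchy–Pompeiu formula for compactly supported functions. -/
theorem integral_inv_mul_dbar {ψ : ℂ → ℂ} (hψ : ContDiff ℝ 1 ψ) (hs : HasCompactSupport ψ) :
    ∫ ζ : ℂ, ζ⁻¹ * (fderiv ℝ ψ ζ 1 + Complex.I * fderiv ℝ ψ ζ Complex.I) =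
      -(2 * Real.pi) * ψ 0 := by
  have hd : Differentiable ℝ ψ := hψ.differentiable one_ne_zero
  rw [← Complex.integral_comp_polarCoord_symm, polarCoord_target]
  have hA := integrableOn_fderiv_polar hψ hs 1
  have hB := integrableOn_fderiv_polar hψ hs Complex.I
  -- The Jacobian `r` cancels the modulus of `ζ⁻¹`, and the remaining phase `exp (-iθ)` rotates the
  -- Cartesian derivatives into the radial and angular ones.
  have hintegral : ∫ p in Ioi (0 : ℝ) ×ˢ Ioo (-Real.pi) Real.pi, p.1 • ((Complex.polarCoord.symm p)⁻¹ *
      (fderiv ℝ ψ (Complex.polarCoord.symm p) 1 + Complex.I *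
        fderiv ℝ ψ (Complex.polarCoord.symm p) Complex.I)) =
      ∫ p in Ioi (0 : ℝ) ×ˢ Ioo (-Real.pi) Real.pi,
        (fderiv ℝ ψ (p.1 * Complex.exp (p.2 * Complex.I)) (1 * Complex.exp (p.2 * Complex.I)) +
        Complex.I * fderiv ℝ ψ (p.1 * Complex.exp (p.2 * Complex.I))
          (Complex.I * Complex.exp (p.2 * Complex.I))) := by
    refine setIntegral_congr_fun (measurableSet_Ioi.prod measurableSet_Ioo) ?_
    rintro ⟨r, θ⟩ ⟨hr, -⟩
    have hr0 : (r : ℂ) ≠ 0 := by exact_mod_cast (mem_Ioi.1 hr).ne'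
    have hpt : Complex.polarCoord.symm (r, θ) = r * Complex.exp (θ * Complex.I) := by
      rw [Complex.polarCoord_symm_apply, Complex.exp_mul_I]
      push_cast; ring
    simp only [hpt]
    set D := fderiv ℝ ψ (r * Complex.exp (θ * Complex.I)) with hD
    have hlin : ∀ z : ℂ, D z = z.re * D 1 + z.im * D Complex.I := by
      intro z
      conv_lhs => rw [← Complex.re_add_im z]
      rw [map_add, ← mul_one (z.re : ℂ), ← Complex.real_smul, ← Complex.real_smul, map_smul,
        map_smul]
      simp
    rw [hlin (1 * Complex.exp (θ * Complex.I)), hlin (Complex.I * Complex.exp (θ * Complex.I))]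
    have hexp : Complex.exp (θ * Complex.I) = Complex.cos θ + Complex.sin θ * Complex.I :=
      Complex.exp_mul_I _
    have hre : (Complex.exp (θ * Complex.I)).re = Real.cos θ := Complex.exp_ofReal_mul_I_re θ
    have him : (Complex.exp (θ * Complex.I)).im = Real.sin θ := Complex.exp_ofReal_mul_I_im θ
    have hinv : (r : ℂ) * (r * Complex.exp (θ * Complex.I))⁻¹ =
        Complex.cos θ - Complex.sin θ * Complex.I := by
      rw [mul_inv, ← mul_assoc, mul_inv_cancel₀ hr0, one_mul, ← Complex.exp_neg, ← neg_mul,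
        Complex.exp_mul_I, Complex.cos_neg, Complex.sin_neg]
      ring
    rw [Complex.real_smul, ← mul_assoc, hinv]
    simp only [one_mul, Complex.mul_re, Complex.mul_im, Complex.I_re, Complex.I_im, hre, him]
    push_cast
    linear_combination (-(Complex.sin θ) * D Complex.I) * Complex.I_sq
  rw [hintegral, integral_add hA (hB.const_mul _), integral_const_mul]
  -- On each circle the integrand is the derivative of a `2π`-periodic function.
  have hzeroB : ∫ p in Ioi (0 : ℝ) ×ˢ Ioo (-Real.pi) Real.pi,
      fderiv ℝ ψ (p.1 * Complex.exp (p.2 * Complex.I)) (Complex.I * Complex.exp (p.2 * Complex.I))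
      = 0 := by
    rw [Measure.volume_eq_prod, setIntegral_prod _ hB]
    refine (setIntegral_congr_fun measurableSet_Ioi fun r hr => ?_).trans (integral_zero _ _)
    have hr : 0 < r := hr
    have hr0 : (r : ℂ) ≠ 0 := by exact_mod_cast hr.ne'
    simp only
    rw [← integral_Ioc_eq_integral_Ioo, ← intervalIntegral.integral_of_le
      (by linarith [Real.pi_pos] : -Real.pi ≤ Real.pi)]
    have hder : ∀ θ : ℝ, HasDerivAt (fun θ : ℝ => (r : ℂ)⁻¹ * ψ (r * Complex.exp (θ * Complex.I)))
        (fderiv ℝ ψ (r * Complex.exp (θ * Complex.I)) (Complex.I * Complex.exp (θ * Complex.I)))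
        θ := by
      intro θ
      have h1 : HasDerivAt (fun θ : ℝ => (r : ℂ) * Complex.exp (θ * Complex.I))
          (r * (Complex.exp (θ * Complex.I) * Complex.I)) θ := by
        have := ((hasDerivAt_id (θ : ℂ)).mul_const Complex.I).cexp.const_mul (r : ℂ)
        simpa using this.comp_ofReal
      have h2 := ((hd _).hasFDerivAt.comp_hasDerivAt θ h1).const_mul (r : ℂ)⁻¹
      refine h2.congr_deriv ?_
      rw [← Complex.real_smul (x := r) (z := Complex.exp (θ * Complex.I) * Complex.I), map_smul,
        Complex.real_smul, ← mul_assoc, inv_mul_cancel₀ hr0, one_mul, mul_comm Complex.I]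
    rw [intervalIntegral.integral_eq_sub_of_hasDerivAt (fun θ _ => hder θ)]
    · simp [Complex.exp_neg, Complex.exp_pi_mul_I]
    · exact ((continuous_fderiv_polar hψ Complex.I).comp
        (by fun_prop : Continuous fun θ : ℝ => (r, θ))).intervalIntegrable _ _
  -- On each ray the fundamental theorem of calculus gives `-ψ 0`; the angles contribute the factor
  -- `2π`.
  have hvalA : ∫ p in Ioi (0 : ℝ) ×ˢ Ioo (-Real.pi) Real.pi,
      fderiv ℝ ψ (p.1 * Complex.exp (p.2 * Complex.I)) (1 * Complex.exp (p.2 * Complex.I))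
      = -(2 * Real.pi) * ψ 0 := by
    rw [Measure.volume_eq_prod, ← setIntegral_prod_swap,
      setIntegral_prod (fun z : ℝ × ℝ => fderiv ℝ ψ (z.swap.1 * Complex.exp (z.swap.2 * Complex.I))
        (1 * Complex.exp (z.swap.2 * Complex.I))) hA.swap]
    have : ∀ θ : ℝ, ∫ r in Ioi (0 : ℝ), fderiv ℝ ψ (r * Complex.exp (θ * Complex.I))
        (1 * Complex.exp (θ * Complex.I)) = -ψ 0 := by
      intro θ
      have hder : ∀ r : ℝ, HasDerivAt (fun r : ℝ => ψ (r * Complex.exp (θ * Complex.I)))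
          (fderiv ℝ ψ (r * Complex.exp (θ * Complex.I)) (1 * Complex.exp (θ * Complex.I))) r := by
        intro r
        have h1 : HasDerivAt (fun r : ℝ => (r : ℂ) * Complex.exp (θ * Complex.I))
            (1 * Complex.exp (θ * Complex.I)) r :=
          ((hasDerivAt_id (r : ℂ)).mul_const _).comp_ofReal
        exact (hd _).hasFDerivAt.comp_hasDerivAt r h1
      have hc : ContDiff ℝ 1 (fun r : ℝ => ψ (r * Complex.exp (θ * Complex.I))) :=
        hψ.comp (Complex.ofRealCLM.contDiff.mul contDiff_const)
      have hcs : HasCompactSupport (fun r : ℝ => ψ (r * Complex.exp (θ * Complex.I))) := by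
        refine hs.comp_isClosedEmbedding (g := fun r : ℝ => (r : ℂ) * Complex.exp (θ * Complex.I))
          (Isometry.isClosedEmbedding (Isometry.of_dist_eq fun r s => ?_))
        rw [dist_eq_norm, ← sub_mul, norm_mul, Complex.norm_exp_ofReal_mul_I, mul_one,
          ← Complex.ofReal_sub, Complex.norm_real, dist_eq_norm]
      have := hcs.integral_Ioi_deriv_eq hc 0
      simp only [fun r => (hder r).deriv] at this
      simpa using this
    simp only [Prod.swap_prod_mk, this]
    rw [setIntegral_const]
    rw [Measure.real, Real.volume_Ioo, ENNReal.toReal_ofReal (by linarith [Real.pi_pos]),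
      Complex.real_smul]
    push_cast
    ring
  rw [hzeroB, hvalA]
  ring

local notation "ℂ³" => (Fin 3 → ℂ)

/-- The antiholomorphic derivative `2 ∂f/∂ē` of `f` in the direction `e`. -/
noncomputable def dbar (f : ℂ³ → ℂ) (v e : ℂ³) : ℂ :=
  fderiv ℝ f v e + Complex.I * fderiv ℝ f v (Complex.I • e)

theorem differentiableAt_of_dbar_eq_zero {f : ℂ³ → ℂ} {v : ℂ³} (hf : DifferentiableAt ℝ f v)
    (h : ∀ e, dbar f v e = 0) : DifferentiableAt ℂ f v := by
  have hI : ∀ e, fderiv ℝ f v (Complex.I • e) = Complex.I * fderiv ℝ f v e := by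
    intro e
    have := h e
    rw [dbar] at this
    linear_combination (-Complex.I) * this + fderiv ℝ f v (Complex.I • e) * Complex.I_sq
  let D : ℂ³ →L[ℂ] ℂ :=
    { toFun := fderiv ℝ f v
      map_add' := map_add _
      map_smul' := fun c e => by
        conv_lhs => rw [← Complex.re_add_im c, add_smul, map_add, mul_smul]
        have h1 : ((c.re : ℂ) • e : ℂ³) = c.re • e := rfl
        have h2 : ((c.im : ℂ) • (Complex.I • e) : ℂ³) = c.im • (Complex.I • e) := rfl
        rw [h1, h2, map_smul, map_smul, hI, Complex.real_smul, Complex.real_smul]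
        simp only [RingHom.id_apply, smul_eq_mul]
        linear_combination (fderiv ℝ f v e) * Complex.re_add_im c
      cont := (fderiv ℝ f v).continuous }
  exact (hasFDerivAt_of_restrictScalars ℝ (f' := D) hf.hasFDerivAt rfl).differentiableAt

theorem dbar_eq_zero_of_differentiableAt {f : ℂ³ → ℂ} {v : ℂ³} (hf : DifferentiableAt ℂ f v)
    (e : ℂ³) : dbar f v e = 0 := by
  rw [dbar, (hf.hasFDerivAt.restrictScalars ℝ).fderiv]
  simp only [ContinuousLinearMap.coe_restrictScalars', map_smul, smul_eq_mul]
  linear_combination (fderiv ℂ f v e) * Complex.I_sq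

theorem dbar_sub {f g : ℂ³ → ℂ} {v : ℂ³} (hf : DifferentiableAt ℝ f v)
    (hg : DifferentiableAt ℝ g v) (e : ℂ³) :
    dbar (fun v => f v - g v) v e = dbar f v e - dbar g v e := by
  rw [dbar, dbar, dbar, fderiv_fun_sub hf hg]
  simp only [sub_apply]
  ring

theorem dbar_congr {f g : ℂ³ → ℂ} {v : ℂ³} (h : f =ᶠ[𝓝 v] g) (e : ℂ³) :
    dbar f v e = dbar g v e := by
  rw [dbar, dbar, h.fderiv_eq]

theorem contDiffAt_dbar {f : ℂ³ → ℂ} {v : ℂ³} (hf : ContDiffAt ℝ 2 f v) (e : ℂ³) :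
    ContDiffAt ℝ 1 (fun v => dbar f v e) v := by
  have h : ContDiffAt ℝ 1 (fderiv ℝ f) v := hf.fderiv_right (by norm_num [one_add_one_eq_two])
  exact (h.clm_apply contDiffAt_const).add
    (contDiffAt_const.mul (h.clm_apply contDiffAt_const))

/-- This is `∂̄² = 0`, a consequence of the symmetry of the second derivative. It provides the
closedness that solving the `∂̄`-equation requires. -/
theorem dbar_dbar_comm {f : ℂ³ → ℂ} {v : ℂ³} (hf : ContDiffAt ℝ 2 f v) (e e' : ℂ³) :
    dbar (fun v => dbar f v e) v e' = dbar (fun v => dbar f v e') v e := by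
  have h : DifferentiableAt ℝ (fderiv ℝ f) v :=
    (hf.fderiv_right (m := 1) (by norm_num [one_add_one_eq_two])).differentiableAt one_ne_zero
  have hsymm : IsSymmSndFDerivAt ℝ f v := hf.isSymmSndFDerivAt (by simp)
  have key : ∀ x y : ℂ³, fderiv ℝ (fun v => dbar f v x) v y =
      fderiv ℝ (fderiv ℝ f) v y x + Complex.I * fderiv ℝ (fderiv ℝ f) v y (Complex.I • x) := by
    intro x y
    have h1 : ∀ z : ℂ³, HasFDerivAt (fun v => fderiv ℝ f v z)
        ((fderiv ℝ (fderiv ℝ f) v).flip z) v := fun z => by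
      have := h.hasFDerivAt.clm_apply (hasFDerivAt_const z v)
      refine this.congr_fderiv ?_
      ext; simp
    have h2 := (h1 x).add ((h1 (Complex.I • x)).const_mul Complex.I)
    have h3 : HasFDerivAt (fun v => dbar f v x) _ v := h2
    rw [h3.fderiv]
    simp
  rw [dbar, dbar, key, key, key, key, hsymm.eq e' e, hsymm.eq e' (Complex.I • e),
    hsymm.eq (Complex.I • e') e, hsymm.eq (Complex.I • e') (Complex.I • e)]
  ring

theorem integrableOn_inv_norm (R : ℝ) :
    IntegrableOn (fun ζ : ℂ => ‖ζ‖⁻¹) (closedBall 0 R) := by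
  have h : LocallyIntegrable (fun ζ : ℂ => ‖ζ‖⁻¹) volume := by
    refine locallyIntegrable_of_norm_le_rpow (C := 1) (α := 1) (by simp) (by simp) ?_ ?_
    · refine Eventually.of_forall fun ζ => ?_
      simp [Real.rpow_neg_one]
    · exact (measurable_norm.inv).aestronglyMeasurable
  exact h.integrableOn_isCompact (isCompact_closedBall _ _)

/-- Differentiation of the Cauchy transform in the direction `e₀`. -/
theorem hasFDerivAt_cauchyTransform {w : ℂ³ → ℂ} {p e₀ : ℂ³} {δ R : ℝ} (hδ : 0 < δ)
    (hw : ∀ v ∈ ball p δ, ∀ ζ : ℂ, ContDiffAt ℝ 1 w (v + ζ • e₀))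
    (hR : ∀ v ∈ ball p δ, ∀ ζ : ℂ, R < ‖ζ‖ → w (v + ζ • e₀) = 0) :
    Integrable (fun ζ : ℂ => ζ⁻¹ • fderiv ℝ w (p + ζ • e₀)) ∧
    HasFDerivAt (fun v => ∫ ζ : ℂ, ζ⁻¹ * w (v + ζ • e₀))
      (∫ ζ : ℂ, ζ⁻¹ • fderiv ℝ w (p + ζ • e₀)) p := by
  have hδ2 : 0 < δ / 2 := by linarith
  have hsub : closedBall p (δ / 2) ⊆ ball p δ := closedBall_subset_ball (by linarith)
  have hDc : ∀ v ∈ ball p δ, ∀ ζ : ℂ, ContinuousAt (fderiv ℝ w) (v + ζ • e₀) := fun v hv ζ =>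
    ((hw v hv ζ).fderiv_right (m := 0) (by simp)).continuousAt
  have hcomp : ContinuousOn (fun q : ℂ³ × ℂ => fderiv ℝ w (q.1 + q.2 • e₀))
      (closedBall p (δ / 2) ×ˢ closedBall 0 R) := by
    rintro ⟨v, ζ⟩ ⟨hv, -⟩
    exact (ContinuousAt.comp (f := fun q : ℂ³ × ℂ => q.1 + q.2 • e₀) (x := (v, ζ))
      (hDc v (hsub hv) ζ) (by fun_prop)).continuousWithinAt
  obtain ⟨C, hC⟩ := ((isCompact_closedBall p (δ / 2)).prod
    (isCompact_closedBall (0 : ℂ) R)).exists_bound_of_continuousOn hcomp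
  have hD0 : ∀ v ∈ ball p δ, ∀ ζ : ℂ, R < ‖ζ‖ → fderiv ℝ w (v + ζ • e₀) = 0 := by
    intro v hv ζ hζ
    have : w =ᶠ[𝓝 (v + ζ • e₀)] fun _ => 0 := by
      have : ∀ᶠ x in 𝓝 (v + ζ • e₀), x - ζ • e₀ ∈ ball p δ := by
        refine ContinuousAt.preimage_mem_nhds (f := fun x : ℂ³ => x - ζ • e₀) (by fun_prop) ?_
        simpa using isOpen_ball.mem_nhds hv
      filter_upwards [this] with x hx
      simpa using hR _ hx ζ hζ
    rw [this.fderiv_eq]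
    simp
  have hmeasinv : AEStronglyMeasurable (fun ζ : ℂ => ζ⁻¹) volume :=
    measurable_inv.aestronglyMeasurable
  have hwc : ∀ v ∈ ball p δ, Continuous fun ζ : ℂ => w (v + ζ • e₀) := fun v hv =>
    continuous_iff_continuousAt.2 fun ζ => ContinuousAt.comp (f := fun ζ : ℂ => v + ζ • e₀)
      (hw v hv ζ).continuousAt (by fun_prop)
  have hDwc : Continuous fun ζ : ℂ => fderiv ℝ w (p + ζ • e₀) :=
    continuous_iff_continuousAt.2 fun ζ => ContinuousAt.comp (f := fun ζ : ℂ => p + ζ • e₀)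
      (hDc p (mem_ball_self hδ) ζ) (by fun_prop)
  have hbint : ∀ C : ℝ, Integrable ((closedBall (0 : ℂ) R).indicator fun ζ => C * ‖ζ‖⁻¹) :=
    fun C => IntegrableOn.integrable_indicator (Integrable.const_mul (integrableOn_inv_norm R) C)
      measurableSet_closedBall
  have hbound : ∀ v ∈ ball p (δ / 2), ∀ ζ : ℂ, ‖ζ⁻¹ • fderiv ℝ w (v + ζ • e₀)‖ ≤
      (closedBall (0 : ℂ) R).indicator (fun ζ => C * ‖ζ‖⁻¹) ζ := by
    intro v hv ζ
    by_cases hζ : ζ ∈ closedBall (0 : ℂ) R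
    · rw [indicator_of_mem hζ, norm_smul, norm_inv, mul_comm]
      gcongr
      exact hC (v, ζ) ⟨ball_subset_closedBall hv, hζ⟩
    · rw [indicator_of_notMem hζ, norm_smul, hD0 v (hsub (ball_subset_closedBall hv)) ζ
        (by simpa using hζ), norm_zero, mul_zero]
  refine ⟨(hbint C).mono' (hmeasinv.smul hDwc.aestronglyMeasurable)
    (Eventually.of_forall (hbound p (mem_ball_self hδ2))), ?_⟩
  refine hasFDerivAt_integral_of_dominated_of_fderiv_le (𝕜 := ℝ)
    (F := fun v ζ => ζ⁻¹ * w (v + ζ • e₀)) (F' := fun v ζ => ζ⁻¹ • fderiv ℝ w (v + ζ • e₀))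
    (bound := (closedBall (0 : ℂ) R).indicator fun ζ => C * ‖ζ‖⁻¹) (s := ball p (δ / 2))
    (ball_mem_nhds _ hδ2) ?_ ?_ ?_ ?_ (hbint C) ?_
  · filter_upwards [ball_mem_nhds p hδ] with v hv
    exact hmeasinv.mul (hwc v hv).aestronglyMeasurable
  · have hw0 := hwc p (mem_ball_self hδ)
    obtain ⟨B, hB⟩ := (isCompact_closedBall (0 : ℂ) R).exists_bound_of_continuousOn hw0.continuousOn
    refine (hbint B).mono' (hmeasinv.mul hw0.aestronglyMeasurable) (Eventually.of_forall fun ζ => ?_)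
    by_cases hζ : ζ ∈ closedBall (0 : ℂ) R
    · rw [indicator_of_mem hζ, norm_mul, norm_inv, mul_comm]
      gcongr
      exact hB ζ hζ
    · rw [indicator_of_notMem hζ, hR p (mem_ball_self hδ) ζ (by simpa using hζ)]
      simp
  · exact hmeasinv.smul hDwc.aestronglyMeasurable
  · exact Eventually.of_forall fun ζ v hv => hbound v hv ζ
  · refine Eventually.of_forall fun ζ v hv => ?_
    have h1 : HasFDerivAt w (fderiv ℝ w (v + ζ • e₀)) (v + ζ • e₀) :=
      ((hw v (hsub (ball_subset_closedBall hv)) ζ).differentiableAt one_ne_zero).hasFDerivAt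
    have h2 := (h1.comp v ((hasFDerivAt_id v).add_const (ζ • e₀))).const_mul ζ⁻¹
    exact h2.congr_fderiv (by ext; simp)

/-- The solution `u` of the equation `∂̄u = η` given by the Cauchy transform in the direction `e₀`,
for a `∂̄`-closed form `η` with compact support on the complex lines of direction `e₀`. -/
theorem dbar_cauchyTransform {η : ℂ³ → ℂ³ → ℂ} {p e₀ : ℂ³} {δ R : ℝ} (hδ : 0 < δ)
    (hη : ∀ v ∈ ball p δ, ∀ ζ : ℂ, ∃ g : ℂ³ → ℂ, ContDiffAt ℝ 2 g (v + ζ • e₀) ∧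
      ∀ᶠ x in 𝓝 (v + ζ • e₀), ∀ e, η x e = dbar g x e)
    (hR : ∀ v ∈ ball p δ, ∀ ζ : ℂ, R < ‖ζ‖ → ∀ e, η (v + ζ • e₀) e = 0) :
    DifferentiableAt ℝ (fun v => -(2 * Real.pi : ℂ)⁻¹ * ∫ ζ : ℂ, ζ⁻¹ * η (v + ζ • e₀) e₀) p ∧
    ∀ e, dbar (fun v => -(2 * Real.pi : ℂ)⁻¹ * ∫ ζ : ℂ, ζ⁻¹ * η (v + ζ • e₀) e₀) p e = η p e := by
  have hC1 : ∀ e, ∀ v ∈ ball p δ, ∀ ζ : ℂ, ContDiffAt ℝ 1 (fun x => η x e) (v + ζ • e₀) := by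
    intro e v hv ζ
    obtain ⟨g, hg, hgη⟩ := hη v hv ζ
    exact (contDiffAt_dbar hg e).congr_of_eventuallyEq (hgη.mono fun x hx => hx e)
  obtain ⟨hintegral, hder⟩ := hasFDerivAt_cauchyTransform hδ (hC1 e₀) (fun v hv ζ hζ => hR v hv ζ hζ e₀)
  have hder' := hder.const_mul (-(2 * Real.pi : ℂ)⁻¹)
  refine ⟨hder'.differentiableAt, fun e => ?_⟩
  -- Closedness exchanges the two directions: the derivative of `η · e₀` along `e` becomes the
  -- derivative of `η · e` along the line of integration, where Cauchy–Pompeiu applies. Its constant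
  -- `-2π` explains the normalization of the transform.
  have hcomm : ∀ ζ : ℂ, dbar (fun x => η x e₀) (p + ζ • e₀) e =
      dbar (fun x => η x e) (p + ζ • e₀) e₀ := by
    intro ζ
    obtain ⟨g, hg, hgη⟩ := hη p (mem_ball_self hδ) ζ
    rw [dbar_congr (hgη.mono fun x hx => hx e₀), dbar_congr (hgη.mono fun x hx => hx e),
      dbar_dbar_comm hg]
  have hψ : ContDiff ℝ 1 fun ζ : ℂ => η (p + ζ • e₀) e := contDiff_iff_contDiffAt.2 fun ζ =>
    ContDiffAt.comp ζ (f := fun ζ : ℂ => p + ζ • e₀) (hC1 e p (mem_ball_self hδ) ζ)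
      (contDiffAt_const.add (contDiffAt_id.smul contDiffAt_const))
  have hψs : HasCompactSupport fun ζ : ℂ => η (p + ζ • e₀) e :=
    HasCompactSupport.intro (isCompact_closedBall (0 : ℂ) R) fun ζ hζ =>
      hR p (mem_ball_self hδ) ζ (by simpa using hζ) e
  have hpomp := integral_inv_mul_dbar hψ hψs
  have hfd : ∀ ζ z : ℂ, fderiv ℝ (fun ζ : ℂ => η (p + ζ • e₀) e) ζ z =
      fderiv ℝ (fun x => η x e) (p + ζ • e₀) (z • e₀) := by
    intro ζ z
    have h1 := ((hC1 e p (mem_ball_self hδ) ζ).differentiableAt one_ne_zero).hasFDerivAt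
    have h2 : HasFDerivAt (fun ζ : ℂ => p + ζ • e₀)
        ((ContinuousLinearMap.id ℝ ℂ).smulRight e₀) ζ :=
      ((hasFDerivAt_id ζ).smul_const e₀).const_add p
    have h3 := h1.comp ζ h2
    simp only [Function.comp_def] at h3
    rw [h3.fderiv]
    simp
  have happly : ∀ x : ℂ³, (∫ ζ : ℂ, ζ⁻¹ • fderiv ℝ (fun x => η x e₀) (p + ζ • e₀)) x =
      ∫ ζ : ℂ, ζ⁻¹ * fderiv ℝ (fun x => η x e₀) (p + ζ • e₀) x := by
    intro x
    rw [ContinuousLinearMap.integral_apply hintegral]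
    rfl
  rw [dbar, hder'.fderiv]
  simp only [smul_apply, smul_eq_mul, happly]
  have hsum : (∫ ζ : ℂ, ζ⁻¹ * fderiv ℝ (fun x => η x e₀) (p + ζ • e₀) e) +
      Complex.I * ∫ ζ : ℂ, ζ⁻¹ * fderiv ℝ (fun x => η x e₀) (p + ζ • e₀) (Complex.I • e) =
      -(2 * Real.pi) * η p e := by
    have hi : ∀ x : ℂ³, Integrable fun ζ : ℂ =>
        ζ⁻¹ * fderiv ℝ (fun x => η x e₀) (p + ζ • e₀) x := fun x => hintegral.apply_continuousLinearMap x
    rw [← integral_const_mul, ← integral_add (hi _) ((hi _).const_mul _)]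
    simp only [zero_smul, add_zero] at hpomp
    rw [← hpomp]
    congr 1
    ext ζ
    have := hcomm ζ
    rw [dbar, dbar] at this
    rw [hfd, hfd, one_smul, ← this]
    ring
  have hpi : (2 * Real.pi : ℂ) ≠ 0 := by simp [Real.pi_ne_zero]
  field_simp at hsum ⊢
  linear_combination -hsum

end CauchyTransform

end K3Uniformization

namespace K3Uniformization

open Set Metric Filter Topology MeasureTheory

/-! ### Homogeneous partitions of unity and cocycles on `ℂ³ ∖ 0` -/

section PartitionOfUnity

local notation "ℂ³" => (Fin 3 → ℂ)

/-- The squared Hermitian norm on `ℂ³`. -/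
noncomputable def sqNorm (v : ℂ³) : ℝ := ∑ j, Complex.normSq (v j)

theorem sqNorm_pos {v : ℂ³} (hv : v ≠ 0) : 0 < sqNorm v := by
  obtain ⟨j, hj⟩ := Function.ne_iff.1 hv
  exact Finset.sum_pos' (fun i _ => Complex.normSq_nonneg _)
    ⟨j, Finset.mem_univ j, Complex.normSq_pos.2 hj⟩

theorem sqNorm_smul (μ : ℂ) (v : ℂ³) : sqNorm (μ • v) = Complex.normSq μ * sqNorm v := by
  simp [sqNorm, Finset.mul_sum]

theorem contDiff_normSq {n : ℕ∞ω} : ContDiff ℝ n Complex.normSq := by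
  have : (Complex.normSq : ℂ → ℝ) = fun z => Complex.reCLM z * Complex.reCLM z +
      Complex.imCLM z * Complex.imCLM z := by
    ext z; simp [Complex.normSq_apply]
  rw [this]
  exact (Complex.reCLM.contDiff.mul Complex.reCLM.contDiff).add
    (Complex.imCLM.contDiff.mul Complex.imCLM.contDiff)

theorem contDiff_sqNorm {n : ℕ∞ω} : ContDiff ℝ n sqNorm :=
  ContDiff.sum fun j _ => contDiff_normSq.comp (contDiff_apply ℝ ℂ j)

/-- A measure of the distance between the lines spanned by `v` and `w`. -/
noncomputable def lineDist (w v : ℂ³) : ℝ :=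
  (∑ j, ∑ k, Complex.normSq (v j * w k - v k * w j)) / sqNorm v

theorem contDiffAt_lineDist {n : ℕ∞ω} (w : ℂ³) {v : ℂ³} (hv : v ≠ 0) :
    ContDiffAt ℝ n (lineDist w) v := by
  refine ContDiffAt.div ?_ contDiff_sqNorm.contDiffAt (sqNorm_pos hv).ne'
  refine ContDiff.contDiffAt (ContDiff.sum fun j _ => ContDiff.sum fun k _ => ?_)
  exact contDiff_normSq.comp (((contDiff_apply ℝ ℂ j).mul contDiff_const).sub
    ((contDiff_apply ℝ ℂ k).mul contDiff_const))

theorem lineDist_smul (w v : ℂ³) {μ : ℂ} (hμ : μ ≠ 0) : lineDist w (μ • v) = lineDist w v := by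
  have h : ∀ j k, Complex.normSq ((μ • v) j * w k - (μ • v) k * w j) =
      Complex.normSq μ * Complex.normSq (v j * w k - v k * w j) := by
    intro j k
    rw [← Complex.normSq_mul]
    congr 1
    simp only [Pi.smul_apply, smul_eq_mul]
    ring
  simp only [lineDist, sqNorm_smul, h, ← Finset.mul_sum]
  exact mul_div_mul_left _ _ (Complex.normSq_pos.2 hμ).ne'

theorem lineDist_self (w : ℂ³) : lineDist w w = 0 := by
  have : ∀ j k, w j * w k - w k * w j = 0 := fun j k => by ring
  simp [lineDist, this]

theorem lineDist_nonneg (w v : ℂ³) : 0 ≤ lineDist w v :=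
  div_nonneg (Finset.sum_nonneg fun _ _ => Finset.sum_nonneg fun _ _ => Complex.normSq_nonneg _)
    (Finset.sum_nonneg fun _ _ => Complex.normSq_nonneg _)

theorem exists_smul_eq_of_lineDist_eq_zero {w v : ℂ³} (hw : w ≠ 0) (hv : v ≠ 0)
    (h : lineDist w v = 0) : ∃ μ : ℂ, μ ≠ 0 ∧ v = μ • w := by
  rw [lineDist, div_eq_zero_iff, or_iff_left (sqNorm_pos hv).ne',
    Finset.sum_eq_zero_iff_of_nonneg
      (fun _ _ => Finset.sum_nonneg fun _ _ => Complex.normSq_nonneg _)] at h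
  have h' : ∀ j k, v j * w k = v k * w j := by
    intro j k
    have := (Finset.sum_eq_zero_iff_of_nonneg (fun _ _ => Complex.normSq_nonneg _)).1
      (h j (Finset.mem_univ j)) k (Finset.mem_univ k)
    exact sub_eq_zero.1 (Complex.normSq_eq_zero.1 this)
  obtain ⟨k, hk⟩ := Function.ne_iff.1 hw
  have hk : w k ≠ 0 := hk
  have hvw : v = (v k / w k) • w := by
    ext j
    simp only [Pi.smul_apply, smul_eq_mul]
    field_simp
    exact h' j k
  refine ⟨v k / w k, fun h0 => hv ?_, hvw⟩
  rw [hvw, h0, zero_smul]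

/-- The part of the unit sphere outside `O` is compact and `lineDist w` is positive on it, hence
bounded below; homogeneity carries the bound to all of `ℂ³ ∖ 0`. -/
theorem exists_lineDist_le_subset {O : Set ℂ³} (hO : IsOpen O)
    (hcone : ∀ μ : ℂ, μ ≠ 0 → ∀ v ∈ O, μ • v ∈ O) {w : ℂ³} (hw0 : w ≠ 0) (hw : w ∈ O) :
    ∃ ε > 0, ∀ v, v ≠ 0 → lineDist w v ≤ ε → v ∈ O := by
  have hK : IsCompact (sphere (0 : ℂ³) 1 \ O) := (isCompact_sphere _ _).diff hO
  have hne : ∀ v ∈ sphere (0 : ℂ³) 1, v ≠ 0 := fun v hv => ne_of_mem_sphere hv one_ne_zero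
  have hnorm : ∀ v : ℂ³, v ≠ 0 → ∃ μ : ℂ, μ ≠ 0 ∧ μ • v ∈ sphere (0 : ℂ³) 1 := by
    intro v hv
    have : ‖v‖ ≠ 0 := norm_ne_zero_iff.2 hv
    refine ⟨(‖v‖ : ℂ)⁻¹, by simpa using hv, ?_⟩
    simp [norm_smul, this]
  have hback : ∀ (μ : ℂ) (v : ℂ³), μ ≠ 0 → μ • v ∈ O → v ∈ O := by
    intro μ v hμ h
    have := hcone μ⁻¹ (inv_ne_zero hμ) _ h
    rwa [smul_smul, inv_mul_cancel₀ hμ, one_smul] at this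
  rcases (sphere (0 : ℂ³) 1 \ O).eq_empty_or_nonempty with hE | hE
  · refine ⟨1, one_pos, fun v hv _ => ?_⟩
    obtain ⟨μ, hμ, hs⟩ := hnorm v hv
    refine hback μ v hμ ?_
    by_contra hn
    have hmem : μ • v ∈ sphere (0 : ℂ³) 1 \ O := ⟨hs, hn⟩
    rw [hE] at hmem
    exact hmem
  · obtain ⟨x, hx, hmin⟩ := hK.exists_isMinOn hE (f := lineDist w) fun v hv =>
      (contDiffAt_lineDist (n := 0) w (hne v hv.1)).continuousAt.continuousWithinAt
    have hpos : 0 < lineDist w x := by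
      refine lt_of_le_of_ne (lineDist_nonneg w x) fun h0 => hx.2 ?_
      obtain ⟨μ, hμ, rfl⟩ := exists_smul_eq_of_lineDist_eq_zero hw0 (hne x hx.1) h0.symm
      exact hcone μ hμ w hw
    refine ⟨lineDist w x / 2, by positivity, fun v hv hle => ?_⟩
    obtain ⟨μ, hμ, hs⟩ := hnorm v hv
    refine hback μ v hμ ?_
    by_contra hn
    have := hmin (⟨hs, hn⟩ : μ • v ∈ sphere (0 : ℂ³) 1 \ O)
    rw [mem_ofPred_eq, lineDist_smul w v hμ] at this
    linarith

/-- A smooth bump function, homogeneous of degree zero, around the line spanned by `w`. -/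
noncomputable def coneBump (w : ℂ³) (ε : ℝ) (v : ℂ³) : ℝ :=
  Real.smoothTransition (1 - lineDist w v / ε)

theorem contDiffAt_coneBump {n : ℕ∞} (w : ℂ³) (ε : ℝ) {v : ℂ³} (hv : v ≠ 0) :
    ContDiffAt ℝ n (coneBump w ε) v :=
  Real.smoothTransition.contDiffAt.comp v
    (contDiffAt_const.sub ((contDiffAt_lineDist w hv).div_const ε))

theorem coneBump_smul (w v : ℂ³) (ε : ℝ) {μ : ℂ} (hμ : μ ≠ 0) :
    coneBump w ε (μ • v) = coneBump w ε v := by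
  rw [coneBump, coneBump, lineDist_smul w v hμ]

theorem coneBump_nonneg (w v : ℂ³) (ε : ℝ) : 0 ≤ coneBump w ε v := Real.smoothTransition.nonneg _

theorem coneBump_pos {w v : ℂ³} {ε : ℝ} (hε : 0 < ε) (h : lineDist w v < ε) :
    0 < coneBump w ε v :=
  Real.smoothTransition.pos_of_pos (by rw [sub_pos, div_lt_one hε]; exact h)

theorem coneBump_eq_zero {w v : ℂ³} {ε : ℝ} (hε : 0 < ε) (h : ε ≤ lineDist w v) :
    coneBump w ε v = 0 :=
  Real.smoothTransition.zero_of_nonpos (by rw [sub_nonpos, one_le_div hε]; exact h)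

theorem coneBump_eventually_zero {w v : ℂ³} {ε : ℝ} (hε : 0 < ε) (hv : v ≠ 0)
    (h : ε < lineDist w v) : ∀ᶠ x in 𝓝 v, coneBump w ε x = 0 := by
  filter_upwards [(contDiffAt_lineDist (n := 0) w hv).continuousAt.eventually (lt_mem_nhds h)]
    with x hx using coneBump_eq_zero hε hx.le

/-- A homogeneous smooth partition of unity subordinate to a cover of `ℂ³ ∖ 0` by open cones, with
only one member of the cover used near the first coordinate axis. -/
theorem exists_conical_partition {ι : Type*} (C : ι → Set ℂ³) (hC : ∀ a, IsOpen (C a))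
    (hcone : ∀ a, ∀ μ : ℂ, μ ≠ 0 → ∀ v ∈ C a, μ • v ∈ C a) (hcov : ∀ v, v ≠ 0 → ∃ a, v ∈ C a) :
    ∃ (κ : Type) (_ : Fintype κ) (ρ : κ → ℂ³ → ℂ) (α : κ → ι) (a₀ : ι) (ε : ℝ), 0 < ε ∧
      (∀ c v, v ≠ 0 → ContDiffAt ℝ 2 (ρ c) v) ∧
      (∀ c (μ : ℂ) v, μ ≠ 0 → ρ c (μ • v) = ρ c v) ∧
      (∀ v, v ≠ 0 → ∑ c, ρ c v = 1) ∧
      (∀ c v, v ≠ 0 → v ∉ C (α c) → ∀ᶠ x in 𝓝 v, ρ c x = 0) ∧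
      (∀ c v, ‖v 1‖ < ε * ‖v 0‖ → ‖v 2‖ < ε * ‖v 0‖ → α c ≠ a₀ → ρ c v = 0) := by
  classical
  set e₀ : ℂ³ := ![1, 0, 0] with he₀
  have he₀0 : e₀ ≠ 0 := fun h => by simpa [he₀] using congrFun h 0
  obtain ⟨a₀, ha₀⟩ := hcov e₀ he₀0
  -- Vectors on the first axis are assigned to `a₀`. For the others the cone is first deprived of
  -- the axis, so that the support of the bump stays away from `e₀`.
  have hloc : ∀ w : ℂ³, w ≠ 0 → ∃ a : ι, ∃ ε : ℝ, 0 < ε ∧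
      (∀ v, v ≠ 0 → lineDist w v ≤ ε → v ∈ C a) ∧ (a ≠ a₀ → ε < lineDist w e₀) := by
    intro w hw
    by_cases hax : w 1 = 0 ∧ w 2 = 0
    · have hwa : w ∈ C a₀ := by
        have hw0 : w 0 ≠ 0 := fun h => hw (by ext j; fin_cases j <;> simp [h, hax])
        have : w = w 0 • e₀ := by ext j; fin_cases j <;> simp [he₀, hax]
        rw [this]
        exact hcone a₀ _ hw0 _ ha₀
      obtain ⟨ε, hε, h⟩ := exists_lineDist_le_subset (hC a₀) (hcone a₀) hw hwa
      exact ⟨a₀, ε, hε, h, fun h => absurd rfl h⟩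
    · obtain ⟨a, ha⟩ := hcov w hw
      have hO : IsOpen (C a ∩ {v : ℂ³ | v 1 = 0 ∧ v 2 = 0}ᶜ) := by
        refine (hC a).inter (IsClosed.isOpen_compl (self := ?_))
        exact (isClosed_eq (continuous_apply 1) continuous_const).inter
          (isClosed_eq (continuous_apply 2) continuous_const)
      obtain ⟨ε, hε, h⟩ := exists_lineDist_le_subset hO (fun μ hμ v hv =>
        ⟨hcone a μ hμ v hv.1, fun h => hv.2 (by simpa [hμ] using h)⟩) hw ⟨ha, hax⟩
      refine ⟨a, ε, hε, fun v hv hle => (h v hv hle).1, fun _ => ?_⟩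
      by_contra hle
      exact (h e₀ he₀0 (not_lt.1 hle)).2 (by simp [he₀])
  have : Nonempty ι := ⟨a₀⟩
  choose! a ε hε hsub hax using hloc
  have hne : ∀ v ∈ sphere (0 : ℂ³) 1, v ≠ 0 := fun v hv => ne_of_mem_sphere hv one_ne_zero
  obtain ⟨t, htS, htcov⟩ := (isCompact_sphere (0 : ℂ³) 1).elim_nhds_subcover
    (fun w => {v | lineDist w v < ε w}) fun w hw => by
      refine (contDiffAt_lineDist (n := 0) w (hne w hw)).continuousAt.eventually (gt_mem_nhds ?_)
      rw [lineDist_self]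
      exact hε w (hne w hw)
  have ht0 : ∀ w : t, (w : ℂ³) ≠ 0 := fun w => hne w (htS w w.2)
  set B : t → ℂ³ → ℝ := fun w => coneBump w (ε w) with hB
  have hsum : ∀ v, v ≠ 0 → 0 < ∑ w, B w v := by
    intro v hv
    have hnv : ‖v‖ ≠ 0 := norm_ne_zero_iff.2 hv
    have hμ : (‖v‖ : ℂ)⁻¹ ≠ 0 := by simpa using hv
    have hs : (‖v‖ : ℂ)⁻¹ • v ∈ sphere (0 : ℂ³) 1 := by simp [norm_smul, hnv]
    obtain ⟨w, hw, hlt⟩ := mem_iUnion₂.1 (htcov hs)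
    rw [mem_ofPred_eq, lineDist_smul w v hμ] at hlt
    exact Finset.sum_pos' (fun _ _ => coneBump_nonneg _ _ _)
      ⟨⟨w, hw⟩, Finset.mem_univ _, coneBump_pos (hε w (hne w (htS w hw))) hlt⟩
  have hzero : ∀ w : t, ∀ v, B w v = 0 → ((B w v / ∑ w', B w' v : ℝ) : ℂ) = 0 := by
    intro w v h
    simp [h]
  have hsmul : ∀ (w : t) (μ : ℂ) (v : ℂ³), μ ≠ 0 → B w (μ • v) = B w v := fun w μ v hμ =>
    coneBump_smul _ _ _ hμ
  -- Normalizing `v 0 = 1` later turns this neighbourhood of `e₀` into the cone `‖v 1‖, ‖v 2‖ < r *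
  -- ‖v 0‖`.
  have hev : ∀ᶠ v in 𝓝 e₀, ∀ w : t, a w ≠ a₀ → B w v = 0 := by
    refine eventually_all.2 fun w => ?_
    by_cases hw : a w = a₀
    · exact Eventually.of_forall fun _ h => absurd hw h
    · filter_upwards [coneBump_eventually_zero (hε w (ht0 w)) he₀0 (hax w (ht0 w) hw)] with v hv _
      exact hv
  obtain ⟨r, hr, hrB⟩ := Metric.eventually_nhds_iff.1 hev
  refine ⟨t, inferInstance, fun w v => ((B w v / ∑ w', B w' v : ℝ) : ℂ), fun w => a w, a₀, r, hr,
    fun w v hv => ?_, fun w μ v hμ => ?_, fun v hv => ?_, fun w v hv hvC => ?_,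
    fun w v h1 h2 hw => hzero w v ?_⟩
  · refine Complex.ofRealCLM.contDiff.contDiffAt.comp v (ContDiffAt.div ?_ ?_ (hsum v hv).ne')
    · exact contDiffAt_coneBump (n := 2) _ _ hv
    · exact ContDiffAt.sum fun w _ => contDiffAt_coneBump (n := 2) _ _ hv
  · simp only [fun w' => hsmul w' μ v hμ]
  · rw [← Complex.ofReal_sum, ← Finset.sum_div, div_self (hsum v hv).ne', Complex.ofReal_one]
  · have : ε w < lineDist w v := by
      by_contra hle
      exact hvC (hsub w (ht0 w) v hv (not_lt.1 hle))
    filter_upwards [coneBump_eventually_zero (hε w (ht0 w)) hv this] with x hx using hzero w x hx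
  · have hv0 : v 0 ≠ 0 := by
      intro h
      rw [h, norm_zero, mul_zero] at h1
      exact absurd h1 (not_lt.2 (norm_nonneg _))
    rw [← hsmul w (v 0)⁻¹ v (inv_ne_zero hv0)]
    refine hrB ?_ w hw
    have hpos : 0 < ‖v 0‖ := norm_pos_iff.2 hv0
    rw [dist_pi_lt_iff hr]
    intro j
    fin_cases j
    · simpa [he₀, hv0] using hr
    · simpa [he₀, ← div_eq_inv_mul, div_lt_iff₀ hpos] using h1
    · simpa [he₀, ← div_eq_inv_mul, div_lt_iff₀ hpos] using h2

theorem dbar_smul_right (f : ℂ³ → ℂ) (v e : ℂ³) (c : ℂ) :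
    dbar f v (c • e) = (starRingEnd ℂ) c * dbar f v e := by
  have h1 : ∀ (r : ℝ) (x : ℂ³), fderiv ℝ f v ((r : ℂ) • x) = r * fderiv ℝ f v x := by
    intro r x
    have : ((r : ℂ) • x : ℂ³) = r • x := rfl
    rw [this, map_smul, Complex.real_smul]
  have h2 : c • e = (c.re : ℂ) • e + (c.im : ℂ) • (Complex.I • e) := by
    rw [smul_smul, ← add_smul, Complex.re_add_im]
  have h3 : Complex.I • c • e = (c.re : ℂ) • (Complex.I • e) + ((-c.im : ℝ) : ℂ) • e := by
    rw [smul_smul, smul_smul, ← add_smul]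
    congr 1
    conv_lhs => rw [← Complex.re_add_im c]
    push_cast
    linear_combination (c.im : ℂ) * Complex.I_sq
  have h4 : (starRingEnd ℂ) c = c.re - c.im * Complex.I := by
    apply Complex.ext <;> simp
  rw [dbar, dbar, h3, h2, map_add, map_add, h1, h1, h1, h1, h4]
  push_cast
  linear_combination (c.im * fderiv ℝ f v (Complex.I • e)) * Complex.I_sq

/-- The chain rule produces `c`, and the antilinearity of `dbar` in its direction produces the
inverse of the conjugate of `μ`. -/
theorem dbar_of_homogeneous {f : ℂ³ → ℂ} {v : ℂ³} {μ c : ℂ} (hμ : μ ≠ 0)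
    (hf : DifferentiableAt ℝ f (μ • v)) (hfv : DifferentiableAt ℝ f v)
    (h : ∀ᶠ x in 𝓝 v, f (μ • x) = c * f x) (e : ℂ³) :
    dbar f (μ • v) e = c * ((starRingEnd ℂ) μ)⁻¹ * dbar f v e := by
  have hd : ∀ x, fderiv ℝ f (μ • v) (μ • x) = c * fderiv ℝ f v x := by
    intro x
    have hm : HasFDerivAt (fun x : ℂ³ => μ • x)
        (μ • ContinuousLinearMap.id ℝ ℂ³) v := (hasFDerivAt_id v).const_smul μ
    have h1 := hf.hasFDerivAt.comp v hm
    have h2 := hfv.hasFDerivAt.const_mul c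
    have h3 := (h1.congr_of_eventuallyEq (h.mono fun x hx => hx.symm)).unique h2
    have h4 := DFunLike.congr_fun h3 x
    simpa using h4
  have he : dbar f (μ • v) e = dbar f (μ • v) (μ • (μ⁻¹ • e)) := by
    rw [smul_smul, mul_inv_cancel₀ hμ, one_smul]
  rw [he, mul_assoc, ← map_inv₀, ← dbar_smul_right, dbar, dbar, smul_comm Complex.I μ, hd, hd]
  ring

/-- Multiplication by `μ` is a rotation followed by a dilation by `‖μ‖` in real dimension two. -/
theorem integral_comp_complex_mul (F : ℂ → ℂ) {μ : ℂ} (hμ : μ ≠ 0) :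
    ∫ ζ, F (μ * ζ) = (Complex.normSq μ : ℂ)⁻¹ * ∫ ζ, F ζ := by
  have h1 : ∀ ζ, μ * ζ = ‖μ‖ • (rotation (Circle.exp μ.arg) ζ) := by
    intro ζ
    rw [rotation_apply, Complex.real_smul, Circle.coe_exp, ← mul_assoc,
      Complex.norm_mul_exp_arg_mul_I]
  simp only [h1]
  have h2 := (rotation (Circle.exp μ.arg)).measurePreserving.integral_comp
    (rotation (Circle.exp μ.arg)).toHomeomorph.measurableEmbedding (fun z => F (‖μ‖ • z))
  rw [h2, Measure.integral_comp_smul, Complex.finrank_real_complex, Complex.real_smul,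
    Complex.normSq_eq_norm_sq, abs_of_nonneg (by positivity)]
  push_cast
  rfl

/-- A cocycle of holomorphic functions on a cover of `ℂ³ ∖ 0` by open cones is a coboundary, with
the homogeneity preserved. -/
theorem conical_cocycle_is_coboundary {ι : Type*} (C : ι → Set ℂ³) (hC : ∀ a, IsOpen (C a))
    (h0 : ∀ a, (0 : ℂ³) ∉ C a) (hcone : ∀ a, ∀ μ : ℂ, μ ≠ 0 → ∀ v ∈ C a, μ • v ∈ C a)
    (hcov : ∀ v, v ≠ 0 → ∃ a, v ∈ C a) (h : ι → ι → ℂ³ → ℂ)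
    (hh : ∀ a b, DifferentiableOn ℂ (h a b) (C a ∩ C b))
    (hcoc : ∀ a b c, ∀ v ∈ C a ∩ C b ∩ C c, h a b v + h b c v = h a c v) :
    ∃ g : ι → ℂ³ → ℂ, (∀ a, DifferentiableOn ℂ (g a) (C a)) ∧
      (∀ a b, ∀ v ∈ C a ∩ C b, h a b v = g b v - g a v) ∧
      ∀ μ c : ℂ, μ ≠ 0 → (∀ a b, ∀ v ∈ C a ∩ C b, h a b (μ • v) = c * h a b v) →
        ∀ a, ∀ v ∈ C a, g a (μ • v) = c * g a v := by
  classical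
  obtain ⟨κ, _, ρ, α, a₀, ε, hε, hρd, hρs, hρ1, hρ0, hρax⟩ :=
    exists_conical_partition C hC hcone hcov
  have hne : ∀ {a v}, v ∈ C a → v ≠ 0 := fun {a v} hv h => h0 a (h ▸ hv)
  have hρmem : ∀ {c v}, v ≠ 0 → ρ c v ≠ 0 → v ∈ C (α c) := by
    intro c v hv hρ
    by_contra hn
    exact hρ (hρ0 c v hv hn).self_of_nhds
  have hsmooth : ∀ a b, ∀ v ∈ C a ∩ C b, ContDiffAt ℝ 2 (h a b) v := fun a b v hv =>
    (((contDiffOn_of_differentiableOn ((hC a).inter (hC b)) (hh a b) 2).contDiffAt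
      (((hC a).inter (hC b)).mem_nhds hv)).restrict_scalars ℝ)
  -- The usual smooth primitive of the cocycle. It remains to make it holomorphic by subtracting one
  -- function common to all `a`.
  set g : ι → ℂ³ → ℂ := fun a v => ∑ c, ρ c v * h (α c) a v with hg
  have hgd : ∀ a, ∀ v ∈ C a, ContDiffAt ℝ 2 (g a) v := by
    intro a v hv
    refine ContDiffAt.sum fun c _ => ?_
    by_cases hc : v ∈ C (α c)
    · exact (hρd c v (hne hv)).mul (hsmooth _ _ v ⟨hc, hv⟩)
    · refine (contDiffAt_const (c := (0 : ℂ))).congr_of_eventuallyEq ?_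
      filter_upwards [hρ0 c v (hne hv) hc] with x hx
      rw [hx, zero_mul]
  have hgcob : ∀ a b, ∀ v ∈ C a ∩ C b, h a b v = g b v - g a v := by
    intro a b v hv
    rw [hg]
    simp only
    rw [← Finset.sum_sub_distrib]
    have : ∀ c ∈ Finset.univ, ρ c v * h (α c) b v - ρ c v * h (α c) a v = ρ c v * h a b v := by
      intro c _
      by_cases hc : ρ c v = 0
      · simp [hc]
      · rw [← hcoc (α c) a b v ⟨⟨hρmem (hne hv.1) hc, hv.1⟩, hv.2⟩]
        ring
    rw [Finset.sum_congr rfl this, ← Finset.sum_mul, hρ1 v (hne hv.1), one_mul]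
  have hι : Nonempty ι := ⟨a₀⟩
  choose! idx hidx using hcov
  -- The forms `∂̄(g a)` agree on overlaps, since the differences of the `g a` are holomorphic; `η`
  -- is the resulting global form.
  set η : ℂ³ → ℂ³ → ℂ := fun v e => if v = 0 then 0 else dbar (g (idx v)) v e with hη
  have hηg : ∀ a, ∀ v ∈ C a, ∀ e, η v e = dbar (g a) v e := by
    intro a v hv e
    have hv' := hidx v (hne hv)
    rw [hη]
    simp only [if_neg (hne hv)]
    have hd1 : DifferentiableAt ℝ (g (idx v)) v := (hgd _ v hv').differentiableAt two_ne_zero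
    have hd2 : DifferentiableAt ℝ (g a) v := (hgd _ v hv).differentiableAt two_ne_zero
    have hmem : C a ∩ C (idx v) ∈ 𝓝 v := ((hC a).inter (hC _)).mem_nhds ⟨hv, hv'⟩
    have heq : (fun x => g (idx v) x - g a x) =ᶠ[𝓝 v] h a (idx v) := by
      filter_upwards [hmem] with x hx using (hgcob a (idx v) x hx).symm
    have h1 := dbar_congr heq e
    rw [dbar_sub hd1 hd2, dbar_eq_zero_of_differentiableAt ((hh _ _).differentiableAt hmem)] at h1
    exact sub_eq_zero.1 h1
  -- Near the axis only members with `α c = a₀` contribute, so `g a₀` is a sum of multiples of `h a₀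
  -- a₀ = 0`. This makes `η` compactly supported on the lines of direction `e₀` off the axis, as
  -- they enter this cone at infinity.
  have hηax : ∀ v : ℂ³, ‖v 1‖ < ε * ‖v 0‖ → ‖v 2‖ < ε * ‖v 0‖ → ∀ e, η v e = 0 := by
    intro v h1 h2 e
    have hmem0 : ∀ x : ℂ³, ‖x 1‖ < ε * ‖x 0‖ → ‖x 2‖ < ε * ‖x 0‖ → x ∈ C a₀ := by
      intro x hx1 hx2
      have hx0 : x ≠ 0 := by
        rintro rfl
        simp at hx1
      obtain ⟨c, -, hc⟩ := Finset.exists_ne_zero_of_sum_ne_zero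
        (by rw [hρ1 x hx0]; exact one_ne_zero : ∑ c, ρ c x ≠ 0)
      have hα : α c = a₀ := by
        by_contra hn
        exact hc (hρax c x hx1 hx2 hn)
      exact hα ▸ hρmem hx0 hc
    have hzero : g a₀ =ᶠ[𝓝 v] fun _ => 0 := by
      have o1 : IsOpen {x : ℂ³ | ‖x 1‖ < ε * ‖x 0‖} := isOpen_lt (by fun_prop) (by fun_prop)
      have o2 : IsOpen {x : ℂ³ | ‖x 2‖ < ε * ‖x 0‖} := isOpen_lt (by fun_prop) (by fun_prop)
      filter_upwards [o1.mem_nhds h1, o2.mem_nhds h2] with x hx1 hx2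
      have hx := hmem0 x hx1 hx2
      have h00 : h a₀ a₀ x = 0 := by simpa using hcoc a₀ a₀ a₀ x ⟨⟨hx, hx⟩, hx⟩
      refine Finset.sum_eq_zero fun c _ => ?_
      by_cases hα : α c = a₀
      · rw [hα, h00, mul_zero]
      · rw [hρax c x hx1 hx2 hα, zero_mul]
    rw [hηg a₀ v (hmem0 v h1 h2) e, dbar_congr hzero e, dbar]
    simp
  set e₀ : ℂ³ := ![1, 0, 0] with he₀
  set u : ℂ³ → ℂ := fun v => -(2 * Real.pi : ℂ)⁻¹ * ∫ ζ : ℂ, ζ⁻¹ * η (v + ζ • e₀) e₀ with hu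
  have hud : ∀ p : ℂ³, ¬ (p 1 = 0 ∧ p 2 = 0) →
      DifferentiableAt ℝ u p ∧ ∀ e, dbar u p e = η p e := by
    intro p hp
    obtain ⟨δ, hδ, hδp⟩ : ∃ δ > 0, ∀ v ∈ ball p δ, ¬ (v 1 = 0 ∧ v 2 = 0) := by
      have hcl : IsClosed {v : ℂ³ | v 1 = 0 ∧ v 2 = 0} :=
        (isClosed_eq (continuous_apply 1) continuous_const).inter
          (isClosed_eq (continuous_apply 2) continuous_const)
      exact Metric.isOpen_iff.1 hcl.isOpen_compl p hp
    -- All coordinates of `v` are smaller than `‖p‖ + δ`, so `‖ζ‖ > R` forces `‖v 0 + ζ‖ > (‖p‖ + δ)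
    -- / ε`, which places `v + ζ • e₀` in the cone where `η` vanishes.
    refine dbar_cauchyTransform (R := (‖p‖ + δ) + (‖p‖ + δ) / ε) hδ (fun v hv ζ => ?_)
      (fun v hv ζ hζ e => ?_)
    · have hx0 : v + ζ • e₀ ≠ 0 := by
        intro hz
        exact hδp v hv ⟨by simpa [he₀] using congrFun hz 1, by simpa [he₀] using congrFun hz 2⟩
      refine ⟨g (idx (v + ζ • e₀)), hgd _ _ (hidx _ hx0), ?_⟩
      filter_upwards [(hC _).mem_nhds (hidx _ hx0)] with x hx e using hηg _ x hx e
    · have hvn : ‖v‖ < ‖p‖ + δ := by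
        have := norm_sub_norm_le v p
        rw [mem_ball, dist_eq_norm] at hv
        linarith
      have hvj : ∀ j, ‖v j‖ < ‖p‖ + δ := fun j => (norm_le_pi_norm v j).trans_lt hvn
      have hz : (‖p‖ + δ) / ε < ‖v 0 + ζ‖ := by
        have h1 := norm_sub_le (v 0 + ζ) (v 0)
        rw [add_sub_cancel_left] at h1
        have := hvj 0
        linarith
      rw [div_lt_iff₀ hε, mul_comm] at hz
      refine hηax _ ?_ ?_ e
      · simpa [he₀] using (hvj 1).trans hz
      · simpa [he₀] using (hvj 2).trans hz
  -- The correction `u` is controlled only off the axis `v 1 = v 2 = 0`; this set has codimension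
  -- two, so Hartogs' theorem extends `g a - u` across it.
  have hhart : ∀ a, ∃ F : ℂ³ → ℂ, DifferentiableOn ℂ F (C a) ∧
      ∀ v ∈ C a, ¬ (v 1 = 0 ∧ v 2 = 0) → F v = g a v - u v := by
    intro a
    refine exists_extension_of_codim_two (f := fun v => g a v - u v) (hC a)
      (l := ContinuousLinearMap.proj 1)
      (l' := ContinuousLinearMap.proj 2) (e := ![0, 1, 0]) (e' := ![0, 0, 1]) (by simp) (by simp)
      (by simp) fun v hv hv' => ?_
    have hd1 : DifferentiableAt ℝ (g a) v := (hgd _ v hv).differentiableAt two_ne_zero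
    obtain ⟨hd2, hdb⟩ := hud v hv'
    refine differentiableAt_of_dbar_eq_zero (hd1.sub hd2) fun e => ?_
    rw [dbar_sub hd1 hd2, hdb, hηg a v hv, sub_self]
  choose F hF hFg using hhart
  have hline : ∀ v : ℂ³, v 1 = 0 ∧ v 2 = 0 → ∀ t : ℂ, t ≠ 0 →
      ¬ ((v + t • ![0, 1, 0] : ℂ³) 1 = 0 ∧ (v + t • ![0, 1, 0] : ℂ³) 2 = 0) := by
    intro v hv t ht hc
    exact ht (by simpa [hv.1] using hc.1)
  have hFc : ∀ a, ∀ v ∈ C a, ContinuousAt (F a) v := fun a v hv =>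
    ((hF a).differentiableAt ((hC a).mem_nhds hv)).continuousAt
  refine ⟨F, hF, fun a b v hv => ?_, fun μ c hμ hhom a v hv => ?_⟩
  · have hoff : ∀ x ∈ C a ∩ C b, ¬ (x 1 = 0 ∧ x 2 = 0) → h a b x = F b x - F a x := by
      intro x hx hx'
      rw [hFg a x hx.1 hx', hFg b x hx.2 hx', hgcob a b x hx]
      ring
    by_cases hv' : v 1 = 0 ∧ v 2 = 0
    swap
    · exact hoff v hv hv'
    refine eq_of_eventuallyEq_line (g := fun v => F b v - F a v) (e := ![0, 1, 0])
      (hsmooth a b v hv).continuousAt ((hFc b v hv.2).sub (hFc a v hv.1)) ?_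
    filter_upwards [eventually_add_smul_mem (((hC a).inter (hC b)).mem_nhds hv) ![0, 1, 0],
      self_mem_nhdsWithin] with t ht ht0
    exact hoff _ ht (hline v hv' t ht0)
  · have hghom : ∀ a, ∀ v ∈ C a, g a (μ • v) = c * g a v := by
      intro a v hv
      rw [hg]
      simp only
      rw [Finset.mul_sum]
      refine Finset.sum_congr rfl fun d _ => ?_
      rw [hρs d μ v hμ]
      by_cases hd : ρ d v = 0
      · simp [hd]
      · rw [hhom _ _ v ⟨hρmem (hne hv) hd, hv⟩]
        ring
    have hηhom : ∀ x e, η (μ • x) e = c * ((starRingEnd ℂ) μ)⁻¹ * η x e := by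
      intro x e
      by_cases hx : x = 0
      · simp [hη, hx]
      have hxi := hidx x hx
      have hxi' := hcone _ μ hμ x hxi
      rw [hηg _ _ hxi' e, hηg _ x hxi e]
      refine dbar_of_homogeneous hμ ((hgd _ _ hxi').differentiableAt two_ne_zero)
        ((hgd _ _ hxi).differentiableAt two_ne_zero) ?_ e
      filter_upwards [(hC _).mem_nhds hxi] with y hy using hghom _ y hy
    -- After the substitution `ζ ↦ μ * ζ`, the factors from `ζ⁻¹` and from `η` multiply to `c` over
    -- the squared modulus of `μ`, and the Jacobian cancels the denominator.
    have huhom : ∀ v, u (μ • v) = c * u v := by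
      intro v
      have hns : (Complex.normSq μ : ℂ) ≠ 0 := by
        exact_mod_cast (Complex.normSq_pos.2 hμ).ne'
      have hcs : (starRingEnd ℂ) μ ≠ 0 := by simpa using hμ
      have h1 := integral_comp_complex_mul (fun ζ => ζ⁻¹ * η (μ • v + ζ • e₀) e₀) hμ
      have h2 : ∀ ζ : ℂ, (μ * ζ)⁻¹ * η (μ • v + (μ * ζ) • e₀) e₀ =
          (μ⁻¹ * (c * ((starRingEnd ℂ) μ)⁻¹)) * (ζ⁻¹ * η (v + ζ • e₀) e₀) := by
        intro ζ
        rw [mul_smul, ← smul_add, hηhom, mul_inv]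
        ring
      simp only [h2] at h1
      rw [integral_const_mul, eq_inv_mul_iff_mul_eq₀ hns] at h1
      simp only [hu]
      rw [← h1, ← Complex.mul_conj]
      field_simp
    have hoff : ∀ x ∈ C a, ¬ (x 1 = 0 ∧ x 2 = 0) → F a (μ • x) = c * F a x := by
      intro x hx hx'
      rw [hFg a x hx hx', hFg a _ (hcone a μ hμ x hx) (by simpa [hμ] using hx'), hghom a x hx,
        huhom]
      ring
    by_cases hv' : v 1 = 0 ∧ v 2 = 0
    swap
    · exact hoff v hv hv'
    refine eq_of_eventuallyEq_line (f := fun v => F a (μ • v)) (g := fun v => c * F a v)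
      (e := ![0, 1, 0]) ?_ (continuousAt_const.mul (hFc a v hv)) ?_
    · exact ContinuousAt.comp (f := fun v : ℂ³ => μ • v) (hFc a _ (hcone a μ hμ v hv))
        (by fun_prop)
    filter_upwards [eventually_add_smul_mem ((hC a).mem_nhds hv) ![0, 1, 0],
      self_mem_nhdsWithin] with t ht ht0
    exact hoff _ ht (hline v hv' t ht0)

end PartitionOfUnity

end K3Uniformization

namespace K3Uniformization

open Set Metric Filter Topology MeasureTheory

/-! ### Principal roots on sectors -/

section Roots

/-- The open sector on which `w ↦ w ^ b` is injective with values in the slit plane. -/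
def sector (b : ℕ) : Set ℂ := {w | w ≠ 0 ∧ b * |w.arg| < Real.pi}

theorem one_mem_sector (b : ℕ) : (1 : ℂ) ∈ sector b := ⟨one_ne_zero, by simp [Real.pi_pos]⟩

theorem sector_subset_slitPlane {b : ℕ} (hb : b ≠ 0) : sector b ⊆ Complex.slitPlane := by
  rintro w ⟨hw, hw'⟩
  refine Complex.mem_slitPlane_iff_arg.2 ⟨fun h => ?_, hw⟩
  rw [h, abs_of_pos Real.pi_pos] at hw'
  have : (1 : ℝ) ≤ b := by exact_mod_cast Nat.one_le_iff_ne_zero.2 hb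
  nlinarith [Real.pi_pos]

theorem isOpen_sector {b : ℕ} (hb : b ≠ 0) : IsOpen (sector b) := by
  have h : sector b = Complex.slitPlane ∩ (fun w : ℂ => b * |w.arg|) ⁻¹' Iio Real.pi := by
    ext w
    exact ⟨fun h => ⟨sector_subset_slitPlane hb h, h.2⟩,
      fun h => ⟨Complex.slitPlane_ne_zero h.1, h.2⟩⟩
  rw [h]
  refine ContinuousOn.isOpen_inter_preimage (fun w hw => ?_) Complex.isOpen_slitPlane isOpen_Iio
  exact (continuousAt_const.mul (Complex.continuousAt_arg hw).abs).continuousWithinAt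

theorem pow_mem_slitPlane {b : ℕ} {w : ℂ} (hw : w ∈ sector b) : w ^ b ∈ Complex.slitPlane := by
  obtain ⟨hw, hw'⟩ := hw
  have h1 : |(b : ℝ) * w.arg| < Real.pi := by rwa [abs_mul, Nat.abs_cast]
  rw [abs_lt] at h1
  have him : ((b : ℂ) * Complex.log w).im = b * w.arg := by simp [Complex.log_im]
  have h2 : Complex.log (w ^ b) = b * Complex.log w := by
    conv_lhs => rw [← Complex.exp_log hw, ← Complex.exp_nat_mul]
    exact Complex.log_exp (by rw [him]; exact h1.1) (by rw [him]; exact h1.2.le)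
  refine Complex.mem_slitPlane_iff_arg.2 ⟨?_, pow_ne_zero b hw⟩
  rw [← Complex.log_im, h2, him]
  exact h1.2.ne

/-- Together with `pow_mem_slitPlane` and `cpow_inv_mem_sector` this makes the power and the
principal root inverse to each other between sector and slit plane, which is what inverts the
charts. -/
theorem pow_cpow_inv_of_mem_sector {b : ℕ} (hb : b ≠ 0) {w : ℂ} (hw : w ∈ sector b) :
    (w ^ b) ^ ((b : ℂ)⁻¹) = w := by
  obtain ⟨hw, hw'⟩ := hw
  have hb' : (0 : ℝ) < b := by exact_mod_cast Nat.pos_of_ne_zero hb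
  have h1 : |w.arg| < Real.pi / b := by rwa [lt_div_iff₀ hb', mul_comm]
  rw [abs_lt] at h1
  exact Complex.pow_cpow_nat_inv hb h1.1 h1.2.le

theorem cpow_inv_mem_sector {b : ℕ} (hb : b ≠ 0) {z : ℂ} (hz : z ∈ Complex.slitPlane) :
    z ^ ((b : ℂ)⁻¹) ∈ sector b := by
  have hz0 := Complex.slitPlane_ne_zero hz
  have hb' : (0 : ℝ) < b := by exact_mod_cast Nat.pos_of_ne_zero hb
  have hb1 : (1 : ℝ) ≤ b := by exact_mod_cast Nat.one_le_iff_ne_zero.2 hb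
  rw [Complex.cpow_def_of_ne_zero hz0]
  refine ⟨Complex.exp_ne_zero _, ?_⟩
  have him : (Complex.log z * (b : ℂ)⁻¹).im = z.arg * (b : ℝ)⁻¹ := by
    have : (b : ℂ)⁻¹ = (((b : ℝ)⁻¹ : ℝ) : ℂ) := by push_cast; rfl
    rw [this, Complex.im_mul_ofReal, Complex.log_im]
  have harg : |z.arg| < Real.pi := by
    refine lt_of_le_of_ne (Complex.abs_arg_le_pi z) fun h => ?_
    rcases abs_choice z.arg with h' | h'
    · exact (Complex.mem_slitPlane_iff_arg.1 hz).1 (h' ▸ h)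
    · have := Complex.neg_pi_lt_arg z
      linarith
  have hlt : |z.arg * (b : ℝ)⁻¹| < Real.pi := by
    rw [abs_mul, abs_of_pos (inv_pos.2 hb'), ← div_eq_mul_inv, div_lt_iff₀ hb']
    nlinarith [Real.pi_pos]
  have hlog : Complex.log (Complex.exp (Complex.log z * (b : ℂ)⁻¹)) = Complex.log z * (b : ℂ)⁻¹ :=
    Complex.log_exp (by rw [him]; exact (abs_lt.1 hlt).1) (by rw [him]; exact (abs_lt.1 hlt).2.le)
  rw [← Complex.log_im, hlog, him, abs_mul, abs_of_pos (inv_pos.2 hb')]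
  rwa [mul_comm, mul_assoc, inv_mul_cancel₀ hb'.ne', mul_one]

theorem contDiffAt_cpow_inv {b : ℕ} {n : ℕ∞ω} {z : ℂ} (hz : z ∈ Complex.slitPlane) :
    ContDiffAt ℂ n (fun z : ℂ => z ^ ((b : ℂ)⁻¹)) z := by
  have h : ContDiffAt ℂ n (fun z => Complex.exp (Complex.log z * (b : ℂ)⁻¹)) z :=
    Complex.contDiff_exp.contDiffAt.comp z ((Complex.contDiffAt_log hz).mul contDiffAt_const)
  refine h.congr_of_eventuallyEq ?_
  filter_upwards [Complex.isOpen_slitPlane.mem_nhds hz] with x hx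
  rw [Complex.cpow_def_of_ne_zero (Complex.slitPlane_ne_zero hx)]

end Roots

/-! ### The cone of roots and its quotient by the weighted action -/

section Construction

local notation "ℂ³" => (Fin 3 → ℂ)

/-- Six linear forms in general position on `ℂ³`, with branching orders `b i` such that
`∑ (1 - 1 / b i) = 3` and the first three of them are divisible by all others. -/
structure BranchData where
  L : Fin 6 → (Fin 3 → ℂ) →L[ℂ] ℂ
  b : Fin 6 → ℕ
  d : Fin 6 → ℕ
  N : ℕ
  N_ne_zero : N ≠ 0
  d_mul_b : ∀ i, d i * b i = N
  d_eq_one : ∀ k : Fin 6, k < 3 → d k = 1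
  sum_eq : ∑ i, d i * (b i - 1) = 3 * N
  independent : ∀ i j k, i ≠ j → i ≠ k → j ≠ k → ∀ v, L i v = 0 → L j v = 0 → L k v = 0 → v = 0

namespace BranchData

variable (A : BranchData)

theorem b_ne_zero (i : Fin 6) : A.b i ≠ 0 := fun h => A.N_ne_zero (by rw [← A.d_mul_b i, h, mul_zero])

theorem d_ne_zero (i : Fin 6) : A.d i ≠ 0 := fun h => A.N_ne_zero (by rw [← A.d_mul_b i, h, zero_mul])

theorem b_eq_of_d_eq_one {k : Fin 6} (hk : A.d k = 1) : A.b k = A.N := by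
  have := A.d_mul_b k
  rwa [hk, one_mul] at this

/-- The affine cone over the branched cover, without its vertex: points of `ℂ³ ∖ 0` with a choice
of a `b i`-th root `y i` of each form `L i`. -/
def Cone : Type := {x : ℂ³ × (Fin 6 → ℂ) // x.1 ≠ 0 ∧ ∀ i, x.2 i ^ A.b i = A.L i x.1}

instance : TopologicalSpace A.Cone := inferInstanceAs (TopologicalSpace
  {x : ℂ³ × (Fin 6 → ℂ) // x.1 ≠ 0 ∧ ∀ i, x.2 i ^ A.b i = A.L i x.1})

variable {A}

/-- The point of `ℂ³` under a point of the cone. -/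
def Cone.v (x : A.Cone) : ℂ³ := x.1.1

/-- The chosen roots. -/
def Cone.y (x : A.Cone) : Fin 6 → ℂ := x.1.2

theorem Cone.v_ne_zero (x : A.Cone) : x.v ≠ 0 := x.2.1

theorem Cone.y_pow (x : A.Cone) (i : Fin 6) : x.y i ^ A.b i = A.L i x.v := x.2.2 i

theorem Cone.ext {x x' : A.Cone} (h : x.v = x'.v) (h' : x.y = x'.y) : x = x' :=
  Subtype.ext (Prod.ext h h')

theorem Cone.continuous_v : Continuous (Cone.v : A.Cone → ℂ³) :=
  continuous_fst.comp continuous_subtype_val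

theorem Cone.continuous_y : Continuous (Cone.y : A.Cone → Fin 6 → ℂ) :=
  continuous_snd.comp continuous_subtype_val

theorem Cone.continuous_y_apply (i : Fin 6) : Continuous fun x : A.Cone => x.y i :=
  (continuous_apply i).comp Cone.continuous_y

/-- Build a point of the cone. -/
def Cone.mk (v : ℂ³) (y : Fin 6 → ℂ) (hv : v ≠ 0) (hy : ∀ i, y i ^ A.b i = A.L i v) : A.Cone :=
  ⟨(v, y), hv, hy⟩

@[simp] theorem Cone.mk_v (v : ℂ³) (y : Fin 6 → ℂ) (hv : v ≠ 0)
    (hy : ∀ i, y i ^ A.b i = A.L i v) : (Cone.mk (A := A) v y hv hy).v = v := rfl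

@[simp] theorem Cone.mk_y (v : ℂ³) (y : Fin 6 → ℂ) (hv : v ≠ 0)
    (hy : ∀ i, y i ^ A.b i = A.L i v) : (Cone.mk (A := A) v y hv hy).y = y := rfl

theorem Cone.y_eq_zero_iff (x : A.Cone) (i : Fin 6) : x.y i = 0 ↔ A.L i x.v = 0 := by
  rw [← x.y_pow i, pow_eq_zero_iff (A.b_ne_zero i)]

instance : MulAction ℂˣ A.Cone where
  smul c x := Cone.mk ((c : ℂ) ^ A.N • x.v) (fun i => (c : ℂ) ^ A.d i * x.y i)
    (smul_ne_zero (pow_ne_zero _ c.ne_zero) x.v_ne_zero) fun i => by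
      rw [mul_pow, ← pow_mul, A.d_mul_b, x.y_pow, map_smul, smul_eq_mul]
  one_smul x := Cone.ext
    (show ((1 : ℂˣ) : ℂ) ^ A.N • x.v = x.v by simp)
    (show (fun i => ((1 : ℂˣ) : ℂ) ^ A.d i * x.y i) = x.y by simp)
  mul_smul c c' x := Cone.ext
    (show ((c * c' : ℂˣ) : ℂ) ^ A.N • x.v = (c : ℂ) ^ A.N • ((c' : ℂ) ^ A.N • x.v) by
      rw [smul_smul, ← mul_pow, Units.val_mul])
    (show (fun i => ((c * c' : ℂˣ) : ℂ) ^ A.d i * x.y i) =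
        fun i => (c : ℂ) ^ A.d i * ((c' : ℂ) ^ A.d i * x.y i) by
      ext i
      rw [← mul_assoc, ← mul_pow, Units.val_mul])

@[simp] theorem Cone.smul_v (c : ℂˣ) (x : A.Cone) : (c • x).v = (c : ℂ) ^ A.N • x.v := rfl

@[simp] theorem Cone.smul_y (c : ℂˣ) (x : A.Cone) (i : Fin 6) :
    (c • x).y i = (c : ℂ) ^ A.d i * x.y i := rfl

theorem Cone.continuous_mk {X : Type*} [TopologicalSpace X] {f : X → A.Cone}
    (hv : Continuous fun x => (f x).v) (hy : ∀ i, Continuous fun x => (f x).y i) : Continuous f :=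
  Continuous.subtype_mk (f := fun x => ((f x).v, (f x).y)) (hv.prodMk (continuous_pi hy))
    fun x => (f x).2

instance : ContinuousConstSMul ℂˣ A.Cone where
  continuous_const_smul c := Cone.continuous_mk
    ((continuous_const (y := (c : ℂ) ^ A.N)).smul Cone.continuous_v) fun i =>
    continuous_const.mul (Cone.continuous_y_apply i)

variable (A) in
/-- The surface: the quotient of the cone by the weighted action of `ℂˣ`. -/
def Surface : Type := MulAction.orbitRel.Quotient ℂˣ A.Cone

instance : TopologicalSpace A.Surface :=
  inferInstanceAs (TopologicalSpace (Quotient (MulAction.orbitRel ℂˣ A.Cone)))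

/-- The projection from the cone to the surface. -/
def proj (x : A.Cone) : A.Surface := Quotient.mk (MulAction.orbitRel ℂˣ A.Cone) x

theorem isOpenQuotientMap_proj : IsOpenQuotientMap (proj : A.Cone → A.Surface) :=
  MulAction.isOpenQuotientMap_quotientMk

theorem proj_surjective : Function.Surjective (proj : A.Cone → A.Surface) :=
  isOpenQuotientMap_proj.surjective

theorem continuous_proj : Continuous (proj : A.Cone → A.Surface) := isOpenQuotientMap_proj.continuous

theorem proj_eq_iff {x x' : A.Cone} : proj x = proj x' ↔ ∃ c : ℂˣ, c • x' = x :=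
  Quotient.eq (r := MulAction.orbitRel ℂˣ A.Cone)

theorem proj_smul (c : ℂˣ) (x : A.Cone) : proj (c • x) = proj x := proj_eq_iff.2 ⟨c, rfl⟩

/-- Functions on the surface from invariant functions on the cone. -/
def lift {X : Type*} (f : A.Cone → X) (hf : ∀ (c : ℂˣ) x, f (c • x) = f x) : A.Surface → X :=
  Quotient.lift f fun _ x ⟨c, hc⟩ => by rw [← hc]; exact hf c x

@[simp] theorem lift_proj {X : Type*} (f : A.Cone → X) (hf : ∀ (c : ℂˣ) x, f (c • x) = f x)
    (x : A.Cone) : lift f hf (proj x) = f x := rfl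

/-- At every point of the cone all but two of the roots are nonzero. -/
theorem Cone.exists_pair (x : A.Cone) : ∃ i j, i ≠ j ∧ ∀ m, m ≠ i → m ≠ j → x.y m ≠ 0 := by
  by_contra! hcon
  -- Three applications yield distinct indices with vanishing roots; the pairs only have to exclude
  -- the indices already found. Three forms with a common zero contradict general position.
  obtain ⟨m₁, h1, h2, hm₁⟩ := hcon 0 1 (by decide)
  obtain ⟨m₂, h3, h4, hm₂⟩ := hcon m₁ (if m₁ = 0 then 1 else 0) (by split_ifs with h <;> simp [h])
  obtain ⟨m₃, h5, h6, hm₃⟩ := hcon m₁ m₂ h3.symm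
  exact x.v_ne_zero (A.independent m₁ m₂ m₃ h3.symm h5.symm h6.symm x.v ((x.y_eq_zero_iff _).1 hm₁)
    ((x.y_eq_zero_iff _).1 hm₂) ((x.y_eq_zero_iff _).1 hm₃))

theorem exists_weight_one (i j : Fin 6) : ∃ k, k ≠ i ∧ k ≠ j ∧ A.d k = 1 := by
  have : ∀ i j : Fin 6, ∃ k : Fin 6, k ≠ i ∧ k ≠ j ∧ k < 3 := by decide
  obtain ⟨k, h1, h2, h3⟩ := this i j
  exact ⟨k, h1, h2, A.d_eq_one k h3⟩

/-- At most two roots vanish and three have weight one. A nonzero root of weight one determines the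
scalar, so the action of `ℂˣ` is free. -/
theorem Cone.exists_weight_one_ne_zero (x : A.Cone) : ∃ k, A.d k = 1 ∧ x.y k ≠ 0 := by
  obtain ⟨i, j, -, h⟩ := x.exists_pair
  obtain ⟨k, h1, h2, h3⟩ := A.exists_weight_one i j
  exact ⟨k, h3, h k h1 h2⟩

theorem eq_of_forall_L {v w : ℂ³} (h : ∀ i, A.L i v = A.L i w) : v = w :=
  sub_eq_zero.1 (A.independent 0 1 2 (by decide) (by decide) (by decide) _ (by simp [h]) (by simp [h])
    (by simp [h]))

/-- Only the roots need comparing: they determine the values of all forms, and these determine `v`.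
-/
theorem proj_eq_of {x x' : A.Cone} {c : ℂ} (hc : c ≠ 0) (h : ∀ i, x'.y i = c ^ A.d i * x.y i) :
    proj x' = proj x := by
  refine proj_eq_iff.2 ⟨Units.mk0 c hc, (Cone.ext (eq_of_forall_L (A := A) fun i => ?_) ?_).symm⟩
  · rw [Cone.smul_v, map_smul, ← x'.y_pow, h, mul_pow, ← pow_mul, A.d_mul_b, x.y_pow]
    rfl
  · ext i
    exact h i

/-- The orbit relation is cut out by closed polynomial equations, which is what the Hausdorff
property of the quotient requires. -/
theorem proj_eq_iff_cross {x x' : A.Cone} : proj x = proj x' ↔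
    ∀ k m, A.d k = 1 → x.y m * x'.y k ^ A.d m = x'.y m * x.y k ^ A.d m := by
  constructor
  · intro h k m hk
    obtain ⟨c, rfl⟩ := proj_eq_iff.1 h
    simp only [Cone.smul_y, hk, pow_one, mul_pow]
    ring
  · intro h
    obtain ⟨k, hk, hxk⟩ := x.exists_weight_one_ne_zero
    have hx'k : x'.y k ≠ 0 := by
      intro h0
      obtain ⟨m, hm, hm'⟩ := x'.exists_weight_one_ne_zero
      have := h k m hk
      rw [h0, zero_pow (A.d_ne_zero m), mul_zero] at this
      exact mul_ne_zero hm' (pow_ne_zero _ hxk) this.symm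
    refine proj_eq_of (c := x.y k / x'.y k) (div_ne_zero hxk hx'k) fun i => ?_
    rw [div_pow, div_mul_eq_mul_div, eq_div_iff (pow_ne_zero _ hx'k), h k i hk, mul_comm]

instance : T2Space A.Surface := by
  rw [t2Space_iff_of_isOpenQuotientMap (isOpenQuotientMap_proj (A := A))]
  simp only [proj_eq_iff_cross, ofPred_forall]
  refine isClosed_iInter fun k => isClosed_iInter fun m => isClosed_iInter fun _ => ?_
  have h1 : ∀ i, Continuous fun q : A.Cone × A.Cone => q.1.y i := fun i =>
    (Cone.continuous_y_apply i).comp continuous_fst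
  have h2 : ∀ i, Continuous fun q : A.Cone × A.Cone => q.2.y i := fun i =>
    (Cone.continuous_y_apply i).comp continuous_snd
  exact isClosed_eq ((h1 m).mul ((h2 k).pow _)) ((h2 m).mul ((h1 k).pow _))

/-- Properness of the projection to `ℂ³ ∖ 0`: a root of norm at least `1` is bounded by its `b i`-th
power, that is, by the form `L i` on the compact set. -/
theorem isCompact_cone_preimage {K : Set ℂ³} (hK : IsCompact K) (h0 : (0 : ℂ³) ∉ K) :
    IsCompact {x : A.Cone | x.v ∈ K} := by
  have hemb : IsEmbedding (Subtype.val : A.Cone → ℂ³ × (Fin 6 → ℂ)) := IsEmbedding.subtypeVal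
  have himg : (Subtype.val : A.Cone → ℂ³ × (Fin 6 → ℂ)) '' {x : A.Cone | x.v ∈ K} =
      {q | q.1 ∈ K ∧ ∀ i, q.2 i ^ A.b i = A.L i q.1} := by
    ext q
    constructor
    · rintro ⟨x, hx, rfl⟩
      exact ⟨hx, x.2.2⟩
    · rintro ⟨hq, hq'⟩
      exact ⟨⟨q, fun h => h0 (h ▸ hq), hq'⟩, hq, rfl⟩
  refine hemb.isCompact_iff.2 (Eq.subst (motive := fun s => IsCompact s) himg.symm ?_)
  obtain ⟨R, hR⟩ : ∃ R, ∀ v ∈ K, ∀ i, ‖A.L i v‖ ≤ R := by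
    choose R hR using fun i => hK.exists_bound_of_continuousOn (A.L i).continuous.continuousOn
    obtain ⟨B, hB⟩ := Finite.bddAbove_range R
    exact ⟨B, fun v hv i => (hR i v hv).trans (hB (mem_range_self i))⟩
  have hsub : {q : ℂ³ × (Fin 6 → ℂ) | q.1 ∈ K ∧ ∀ i, q.2 i ^ A.b i = A.L i q.1} ⊆
      K ×ˢ closedBall 0 (max R 1) := by
    rintro ⟨v, y⟩ ⟨hv, hy⟩
    refine ⟨hv, mem_closedBall_zero_iff.2 ((pi_norm_le_iff_of_nonneg (by positivity)).2 fun i => ?_)⟩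
    by_contra! hlt
    have h1 : 1 ≤ ‖y i‖ := (le_max_right R 1).trans hlt.le
    have h2 : ‖y i‖ ≤ ‖y i‖ ^ A.b i := le_self_pow₀ h1 (A.b_ne_zero i)
    have h3 := hR v hv i
    rw [← hy i, norm_pow] at h3
    linarith [le_max_left R 1]
  refine IsCompact.of_isClosed_subset (hK.prod (isCompact_closedBall _ _)) ?_ hsub
  have hcl : IsClosed {q : ℂ³ × (Fin 6 → ℂ) | ∀ i, q.2 i ^ A.b i = A.L i q.1} := by
    simp only [ofPred_forall]
    exact isClosed_iInter fun i => isClosed_eq (by fun_prop) (by fun_prop)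
  exact (hK.isClosed.preimage continuous_fst).inter hcl

theorem Cone.exists_smul_mem_sphere (x : A.Cone) : ∃ c : ℂˣ, (c • x).v ∈ sphere (0 : ℂ³) 1 := by
  obtain ⟨c, hc⟩ := IsAlgClosed.exists_pow_nat_eq ((‖x.v‖ : ℂ)⁻¹) (Nat.pos_of_ne_zero A.N_ne_zero)
  have hn : ‖x.v‖ ≠ 0 := norm_ne_zero_iff.2 x.v_ne_zero
  have hc0 : c ≠ 0 := by
    rintro rfl
    rw [zero_pow A.N_ne_zero] at hc
    exact inv_ne_zero (by exact_mod_cast hn) hc.symm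
  refine ⟨Units.mk0 c hc0, ?_⟩
  simp [hc, norm_smul, hn]

instance : CompactSpace A.Surface := by
  have h := (isCompact_cone_preimage (A := A) (isCompact_sphere (0 : ℂ³) 1) (by simp)).image
    continuous_proj
  refine ⟨h.of_isClosed_subset isClosed_univ fun q _ => ?_⟩
  obtain ⟨x, rfl⟩ := proj_surjective q
  obtain ⟨c, hc⟩ := x.exists_smul_mem_sphere
  exact ⟨c • x, hc, proj_smul c x⟩

end BranchData

end Construction

end K3Uniformization

namespace K3Uniformization

open Set Metric Filter Topology MeasureTheory

namespace BranchData

/-! ### Charts and the complex structure -/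

section Charts

local notation "ℂ³" => (Fin 3 → ℂ)
local notation "ℂ²" => (Fin 2 → ℂ)

variable {A : BranchData}

theorem exists_dual {i j k : Fin 6} (hij : i ≠ j) (hik : i ≠ k) (hjk : j ≠ k) :
    ∃ e, A.L i e = 1 ∧ A.L j e = 0 ∧ A.L k e = 0 := by
  let f : ℂ³ →ₗ[ℂ] ℂ³ := LinearMap.pi ![(A.L i : ℂ³ →ₗ[ℂ] ℂ), A.L j, A.L k]
  have hf : Function.Injective f := by
    refine (injective_iff_map_eq_zero f).2 fun v hv => ?_
    exact A.independent i j k hij hik hjk v (congrFun hv 0) (congrFun hv 1) (congrFun hv 2)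
  obtain ⟨e, he⟩ := LinearMap.injective_iff_surjective.1 hf ![1, 0, 0]
  exact ⟨e, congrFun he 0, congrFun he 1, congrFun he 2⟩

variable (A) in
/-- The data of a chart: the coordinates are the normalized roots with indices `i` and `j`, the
normalization is `y k = 1`, and the `c m` select branches of the other roots. -/
structure ChartIndex where
  i : Fin 6
  j : Fin 6
  k : Fin 6
  hij : i ≠ j
  hki : k ≠ i
  hkj : k ≠ j
  hk : A.d k = 1
  c : Fin 6 → ℂ
  hc : ∀ m, c m ≠ 0

namespace ChartIndex

variable (p : A.ChartIndex)

/-- The basis vector dual to `L i`. -/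
noncomputable def Di : ℂ³ := (exists_dual (A := A) p.hij p.hki.symm p.hkj.symm).choose

/-- The basis vector dual to `L j`. -/
noncomputable def Dj : ℂ³ := (exists_dual (A := A) p.hij.symm p.hkj.symm p.hki.symm).choose

/-- The basis vector dual to `L k`. -/
noncomputable def Dk : ℂ³ := (exists_dual (A := A) p.hki p.hkj p.hij).choose

theorem Di_spec : A.L p.i p.Di = 1 ∧ A.L p.j p.Di = 0 ∧ A.L p.k p.Di = 0 :=
  (exists_dual (A := A) p.hij p.hki.symm p.hkj.symm).choose_spec

theorem Dj_spec : A.L p.j p.Dj = 1 ∧ A.L p.i p.Dj = 0 ∧ A.L p.k p.Dj = 0 :=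
  (exists_dual (A := A) p.hij.symm p.hkj.symm p.hki.symm).choose_spec

theorem Dk_spec : A.L p.k p.Dk = 1 ∧ A.L p.i p.Dk = 0 ∧ A.L p.j p.Dk = 0 :=
  (exists_dual (A := A) p.hki p.hkj p.hij).choose_spec

/-- The vector of `ℂ³` under the point with given coordinates. -/
noncomputable def vec (z : ℂ²) : ℂ³ := p.Dk + z 0 ^ A.b p.i • p.Di + z 1 ^ A.b p.j • p.Dj

theorem L_i_vec (z : ℂ²) : A.L p.i (p.vec z) = z 0 ^ A.b p.i := by
  simp [vec, p.Di_spec, p.Dj_spec, p.Dk_spec]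

theorem L_j_vec (z : ℂ²) : A.L p.j (p.vec z) = z 1 ^ A.b p.j := by
  simp [vec, p.Di_spec, p.Dj_spec, p.Dk_spec]

theorem L_k_vec (z : ℂ²) : A.L p.k (p.vec z) = 1 := by
  simp [vec, p.Di_spec, p.Dj_spec, p.Dk_spec]

theorem vec_ne_zero (z : ℂ²) : p.vec z ≠ 0 := fun h => by
  have := p.L_k_vec z
  simp [h] at this

theorem contDiff_vec {n : ℕ∞ω} : ContDiff ℂ n p.vec :=
  (contDiff_const.add (((contDiff_apply ℂ ℂ 0).pow _).smul contDiff_const)).add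
    (((contDiff_apply ℂ ℂ 1).pow _).smul contDiff_const)

/-- The roots at the point with given coordinates. -/
noncomputable def root (z : ℂ²) (m : Fin 6) : ℂ :=
  if m = p.i then z 0 else if m = p.j then z 1 else if m = p.k then 1 else
    -- The branch of the root that takes the value `c m` where `L m` equals `c m ^ b m`.
    p.c m * (A.L m (p.vec z) / p.c m ^ A.b m) ^ ((A.b m : ℂ)⁻¹)

@[simp] theorem root_i (z : ℂ²) : p.root z p.i = z 0 := if_pos rfl

@[simp] theorem root_j (z : ℂ²) : p.root z p.j = z 1 := by
  rw [root, if_neg p.hij.symm, if_pos rfl]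

@[simp] theorem root_k (z : ℂ²) : p.root z p.k = 1 := by
  rw [root, if_neg p.hki, if_neg p.hkj, if_pos rfl]

theorem root_of_ne (z : ℂ²) {m : Fin 6} (hi : m ≠ p.i) (hj : m ≠ p.j) (hk : m ≠ p.k) :
    p.root z m = p.c m * (A.L m (p.vec z) / p.c m ^ A.b m) ^ ((A.b m : ℂ)⁻¹) := by
  rw [root, if_neg hi, if_neg hj, if_neg hk]

theorem root_pow (z : ℂ²) (m : Fin 6) : p.root z m ^ A.b m = A.L m (p.vec z) := by
  by_cases hi : m = p.i
  · subst hi; rw [root_i, L_i_vec]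
  by_cases hj : m = p.j
  · subst hj; rw [root_j, L_j_vec]
  by_cases hk : m = p.k
  · subst hk; rw [root_k, L_k_vec, one_pow]
  have := pow_ne_zero (A.b m) (p.hc m)
  rw [p.root_of_ne z hi hj hk, mul_pow, Complex.cpow_nat_inv_pow _ (A.b_ne_zero m)]
  field_simp

/-- The point of the cone with given coordinates. -/
noncomputable def point (z : ℂ²) : A.Cone :=
  Cone.mk (p.vec z) (p.root z) (p.vec_ne_zero z) (p.root_pow z)

@[simp] theorem point_y (z : ℂ²) : (p.point z).y = p.root z := rfl

/-- The coordinates of a point of the cone. -/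
noncomputable def coord (x : A.Cone) : ℂ² :=
  ![x.y p.i / x.y p.k ^ A.d p.i, x.y p.j / x.y p.k ^ A.d p.j]

theorem normalized_smul (c : ℂˣ) (x : A.Cone) (m : Fin 6) :
    (c • x).y m / (c • x).y p.k ^ A.d m = x.y m / x.y p.k ^ A.d m := by
  rw [Cone.smul_y, Cone.smul_y, p.hk, pow_one, mul_pow]
  exact mul_div_mul_left _ _ (pow_ne_zero _ c.ne_zero)

theorem coord_smul (c : ℂˣ) (x : A.Cone) : p.coord (c • x) = p.coord x := by
  rw [coord, coord, p.normalized_smul, p.normalized_smul]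

/-- The condition that a point of the cone lies over the domain of the chart. -/
def Mem (x : A.Cone) : Prop :=
  x.y p.k ≠ 0 ∧ ∀ m, m ≠ p.i → m ≠ p.j → m ≠ p.k →
    x.y m / x.y p.k ^ A.d m / p.c m ∈ sector (A.b m)

theorem mem_smul (c : ℂˣ) (x : A.Cone) : p.Mem (c • x) = p.Mem x := by
  simp only [Mem, p.normalized_smul]
  simp [p.hk]

/-- The domain of the chart. -/
def source : Set A.Surface := {q | lift p.Mem p.mem_smul q}

@[simp] theorem proj_mem_source {x : A.Cone} : proj x ∈ p.source ↔ p.Mem x := Iff.rfl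

/-- The range of the chart. -/
def target : Set ℂ² := {z | ∀ m, m ≠ p.i → m ≠ p.j → m ≠ p.k →
  A.L m (p.vec z) / p.c m ^ A.b m ∈ Complex.slitPlane}

theorem isOpen_target : IsOpen p.target := by
  simp only [target, ofPred_forall]
  refine isOpen_iInter_of_finite fun m => isOpen_iInter_of_finite fun _ =>
    isOpen_iInter_of_finite fun _ => isOpen_iInter_of_finite fun _ => ?_
  refine Complex.isOpen_slitPlane.preimage ?_
  exact ((A.L m).continuous.comp (p.contDiff_vec (n := 0)).continuous).div_const _

theorem isOpen_mem : IsOpen {x : A.Cone | p.Mem x} := by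
  have h : {x : A.Cone | p.Mem x} = {x : A.Cone | x.y p.k ≠ 0} ∩ ⋂ m, ⋂ (_ : m ≠ p.i),
      ⋂ (_ : m ≠ p.j), ⋂ (_ : m ≠ p.k), ({x : A.Cone | x.y p.k ≠ 0} ∩
        (fun x : A.Cone => x.y m / x.y p.k ^ A.d m / p.c m) ⁻¹' sector (A.b m)) := by
    ext x
    simp only [Mem, mem_ofPred_eq, mem_inter_iff, mem_iInter, mem_preimage]
    exact ⟨fun h => ⟨h.1, fun m a b c => ⟨h.1, h.2 m a b c⟩⟩,
      fun h => ⟨h.1, fun m a b c => (h.2 m a b c).2⟩⟩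
  have hk : IsOpen {x : A.Cone | x.y p.k ≠ 0} :=
    isOpen_ne_fun (Cone.continuous_y_apply p.k) continuous_const
  rw [h]
  refine hk.inter (isOpen_iInter_of_finite fun m => isOpen_iInter_of_finite fun _ =>
    isOpen_iInter_of_finite fun _ => isOpen_iInter_of_finite fun _ => ?_)
  refine ContinuousOn.isOpen_inter_preimage ?_ hk (isOpen_sector (A.b_ne_zero m))
  exact (ContinuousOn.div (Cone.continuous_y_apply m).continuousOn
    ((Cone.continuous_y_apply p.k).pow _).continuousOn
    fun x hx => pow_ne_zero _ hx).div_const _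

theorem isOpen_source : IsOpen p.source :=
  isOpenQuotientMap_proj.isQuotientMap.isOpen_preimage.1 p.isOpen_mem

/-- The forms `L i`, `L j`, `L k` separate vectors and agree on both sides. Since `k` has weight
one, scaling by the inverse of `y k` normalizes that root to `1`. -/
theorem vec_coord {x : A.Cone} (hx : x.y p.k ≠ 0) :
    p.vec (p.coord x) = ((x.y p.k)⁻¹ ^ A.N) • x.v := by
  refine sub_eq_zero.1 (A.independent p.i p.j p.k p.hij p.hki.symm p.hkj.symm _ ?_ ?_ ?_)
  · rw [map_sub, map_smul, L_i_vec, ← x.y_pow, coord, ← A.d_mul_b p.i]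
    simp [← pow_mul, div_eq_inv_mul, mul_pow]
  · rw [map_sub, map_smul, L_j_vec, ← x.y_pow, coord, ← A.d_mul_b p.j]
    simp [← pow_mul, div_eq_inv_mul, mul_pow]
  · rw [map_sub, map_smul, L_k_vec, ← x.y_pow, A.b_eq_of_d_eq_one p.hk, smul_eq_mul, ← mul_pow,
      inv_mul_cancel₀ hx, one_pow, sub_self]

theorem L_vec_coord {x : A.Cone} (hx : x.y p.k ≠ 0) (m : Fin 6) :
    A.L m (p.vec (p.coord x)) / p.c m ^ A.b m =
      (x.y m / x.y p.k ^ A.d m / p.c m) ^ A.b m := by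
  rw [p.vec_coord hx, map_smul, ← x.y_pow, div_pow, div_pow, ← pow_mul, A.d_mul_b, smul_eq_mul,
    inv_pow, inv_mul_eq_div]

theorem root_coord {x : A.Cone} (hx : p.Mem x) (m : Fin 6) :
    p.root (p.coord x) m = (x.y p.k)⁻¹ ^ A.d m * x.y m := by
  by_cases hi : m = p.i
  · subst hi
    simp [coord, div_eq_inv_mul]
  by_cases hj : m = p.j
  · subst hj
    simp [coord, div_eq_inv_mul]
  by_cases hk : m = p.k
  · subst hk
    rw [root_k, p.hk, pow_one, inv_mul_cancel₀ hx.1]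
  rw [p.root_of_ne _ hi hj hk, p.L_vec_coord hx.1, pow_cpow_inv_of_mem_sector (A.b_ne_zero m)
    (hx.2 m hi hj hk), mul_div_cancel₀ _ (p.hc m), inv_pow, inv_mul_eq_div]

theorem mem_point {z : ℂ²} (hz : z ∈ p.target) : p.Mem (p.point z) := by
  refine ⟨by simp, fun m hi hj hk => ?_⟩
  rw [point_y, root_k, one_pow, div_one, p.root_of_ne z hi hj hk, mul_div_cancel_left₀ _ (p.hc m)]
  exact cpow_inv_mem_sector (A.b_ne_zero m) (hz m hi hj hk)

theorem contDiffAt_root {n : ℕ∞ω} {z : ℂ²} (hz : z ∈ p.target) (m : Fin 6) :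
    ContDiffAt ℂ n (fun z => p.root z m) z := by
  by_cases hi : m = p.i
  · subst hi
    simpa only [root_i] using (contDiff_apply ℂ ℂ (0 : Fin 2)).contDiffAt
  by_cases hj : m = p.j
  · subst hj
    simpa only [root_j] using (contDiff_apply ℂ ℂ (1 : Fin 2)).contDiffAt
  by_cases hk : m = p.k
  · subst hk
    simpa only [root_k] using contDiffAt_const
  simp only [p.root_of_ne _ hi hj hk]
  refine contDiffAt_const.mul ?_
  refine ContDiffAt.comp z (g := fun w : ℂ => w ^ ((A.b m : ℂ)⁻¹))
    (contDiffAt_cpow_inv (hz m hi hj hk)) ?_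
  exact ((A.L m).contDiff.comp p.contDiff_vec).contDiffAt.div_const _

/-- The chart. -/
noncomputable def chart : OpenPartialHomeomorph A.Surface ℂ² where
  toFun := lift p.coord p.coord_smul
  invFun z := proj (p.point z)
  source := p.source
  target := p.target
  map_source' q hq := by
    obtain ⟨x, rfl⟩ := proj_surjective q
    intro m hi hj hk
    rw [lift_proj, p.L_vec_coord hq.1]
    exact pow_mem_slitPlane (hq.2 m hi hj hk)
  map_target' z hz := p.mem_point hz
  left_inv' q hq := by
    obtain ⟨x, rfl⟩ := proj_surjective q
    exact proj_eq_of (inv_ne_zero hq.1) fun m => p.root_coord hq m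
  right_inv' z hz := by
    rw [lift_proj]
    ext a
    fin_cases a <;> simp [coord]
  open_source := p.isOpen_source
  open_target := p.isOpen_target
  continuousOn_toFun q hq := by
    obtain ⟨x, rfl⟩ := proj_surjective q
    refine (isOpenQuotientMap_proj.continuousAt_comp_iff.1 ?_).continuousWithinAt
    have hk : x.y p.k ≠ 0 := hq.1
    have h : ∀ m, ContinuousAt (fun x : A.Cone => x.y m / x.y p.k ^ A.d m) x := fun m =>
      (Cone.continuous_y_apply m).continuousAt.div
        ((Cone.continuous_y_apply p.k).pow _).continuousAt (pow_ne_zero _ hk)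
    refine continuousAt_pi.2 fun a => ?_
    fin_cases a
    · exact h p.i
    · exact h p.j
  continuousOn_invFun := by
    refine continuous_proj.comp_continuousOn ?_
    have : ContinuousOn (fun z => (p.vec z, p.root z)) p.target :=
      (p.contDiff_vec (n := 0)).continuous.continuousOn.prodMk (continuousOn_pi.2 fun m z hz =>
        (p.contDiffAt_root (n := 0) hz m).continuousAt.continuousWithinAt)
    exact continuousOn_iff_continuous_domRestrict.2
      ((continuousOn_iff_continuous_domRestrict.1 this).subtype_mk _)

@[simp] theorem chart_proj (x : A.Cone) : p.chart (proj x) = p.coord x := rfl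

end ChartIndex

theorem exists_chartIndex (x : A.Cone) : ∃ p : A.ChartIndex, p.Mem x := by
  classical
  obtain ⟨i, j, hij, h⟩ := x.exists_pair
  obtain ⟨k, hki, hkj, hk⟩ := A.exists_weight_one i j
  refine ⟨⟨i, j, k, hij, hki, hkj, hk,
    -- Centring each branch at the normalized root of `x` makes the quotient tested against the
    -- sector equal to `1`. The default `1` only keeps `c m` nonzero; vanishing roots are
    -- coordinates and need no branch.
    fun m => if x.y m = 0 then 1 else x.y m / x.y k ^ A.d m, fun m => ?_⟩, h k hki hkj,
    fun m hi hj _ => ?_⟩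
  · have := h k hki hkj
    split_ifs with hm
    · exact one_ne_zero
    · exact div_ne_zero hm (pow_ne_zero _ this)
  · have h1 := h m hi hj
    have h2 := pow_ne_zero (A.d m) (h k hki hkj)
    simp only [if_neg h1]
    rw [div_self (div_ne_zero h1 h2)]
    exact one_mem_sector _

theorem exists_chart (q : A.Surface) : ∃ p : A.ChartIndex, q ∈ p.chart.source := by
  obtain ⟨x, rfl⟩ := proj_surjective q
  exact exists_chartIndex x

noncomputable instance : ChartedSpace ℂ² A.Surface where
  atlas := range ChartIndex.chart
  chartAt q := (exists_chart q).choose.chart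
  mem_chart_source q := (exists_chart q).choose_spec
  chart_mem_atlas _ := mem_range_self _

theorem mem_atlas_iff {e : OpenPartialHomeomorph A.Surface ℂ²} :
    e ∈ atlas ℂ² A.Surface ↔ ∃ p : A.ChartIndex, p.chart = e := Iff.rfl

theorem contDiffAt_transition {n : ℕ∞ω} (p p' : A.ChartIndex) {z : ℂ²} (hz : z ∈ p.target)
    (hz' : p'.Mem (p.point z)) : ContDiffAt ℂ n (fun z => p'.coord (p.point z)) z := by
  refine contDiffAt_pi.2 fun a => ?_
  have hk : p.root z p'.k ≠ 0 := hz'.1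
  have h : ∀ m, ContDiffAt ℂ n (fun z => p.root z m / p.root z p'.k ^ A.d m) z := fun m =>
    (p.contDiffAt_root hz m).div ((p.contDiffAt_root hz p'.k).pow _) (pow_ne_zero _ hk)
  fin_cases a
  · exact h p'.i
  · exact h p'.j

instance : IsManifold 𝓘(ℂ, ℂ²) ω A.Surface := by
  refine isManifold_of_contDiffOn _ _ _ ?_
  rintro _ _ ⟨p, rfl⟩ ⟨p', rfl⟩
  intro z hz
  have hz1 : z ∈ p.target := hz.1.1
  have hz2 : p'.Mem (p.point z) := hz.1.2
  exact (contDiffAt_transition p p' hz1 hz2).contDiffWithinAt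

instance : IsManifold 𝓘(ℂ, ℂ²) 1 A.Surface := IsManifold.of_le (n := ω) le_top

theorem mdifferentiableAt_chart (p : A.ChartIndex) {x : A.Cone} (hx : p.Mem x) :
    MDifferentiableAt 𝓘(ℂ, ℂ²) 𝓘(ℂ, ℂ²) p.chart (proj x) :=
  mdifferentiableAt_atlas (mem_atlas_iff.2 ⟨p, rfl⟩) hx

theorem mdifferentiableAt_chart_symm (p : A.ChartIndex) {z : ℂ²} (hz : z ∈ p.target) :
    MDifferentiableAt 𝓘(ℂ, ℂ²) 𝓘(ℂ, ℂ²) (fun z => proj (p.point z)) z :=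
  mdifferentiableAt_atlas_symm (mem_atlas_iff.2 ⟨p, rfl⟩) hz

theorem ChartIndex.coord_mem_target (p : A.ChartIndex) {x : A.Cone} (hx : p.Mem x) :
    p.coord x ∈ p.target :=
  p.chart.map_source (x := proj x) hx

theorem ChartIndex.proj_point_coord (p : A.ChartIndex) {x : A.Cone} (hx : p.Mem x) :
    proj (p.point (p.coord x)) = proj x :=
  p.chart.left_inv (x := proj x) hx

/-- Holomorphy can be tested in any chart of the atlas around the point, not only in the preferred
one. -/
theorem mdifferentiableAt_iff (p : A.ChartIndex) {f : A.Surface → ℂ} {x : A.Cone} (hx : p.Mem x) :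
    MDifferentiableAt 𝓘(ℂ, ℂ²) 𝓘(ℂ, ℂ) f (proj x) ↔
      DifferentiableAt ℂ (fun z => f (proj (p.point z))) (p.coord x) := by
  rw [← mdifferentiableAt_iff_differentiableAt]
  constructor
  · intro h
    rw [← p.proj_point_coord hx] at h
    exact h.comp (p.coord x) (mdifferentiableAt_chart_symm p (p.coord_mem_target hx))
  · intro h
    have h' : MDifferentiableAt 𝓘(ℂ, ℂ²) 𝓘(ℂ, ℂ)
        ((fun z => f (proj (p.point z))) ∘ p.chart) (proj x) :=
      MDifferentiableAt.comp (proj x) h (mdifferentiableAt_chart p hx)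
    refine h'.congr_of_eventuallyEq ?_
    filter_upwards [p.chart.open_source.mem_nhds hx] with q hq
    exact congrArg f (p.chart.left_inv hq).symm

end Charts

end BranchData

end K3Uniformization

namespace K3Uniformization

open Set Metric Filter Topology MeasureTheory

namespace BranchData

/-! ### The nowhere vanishing two-form -/

section TwoForm

local notation "ℂ³" => (Fin 3 → ℂ)
local notation "ℂ²" => (Fin 2 → ℂ)

variable {A : BranchData}

namespace ChartIndex

variable (p : A.ChartIndex)

/-- The determinant of the dual basis. -/
noncomputable def dualDet : ℂ := (Matrix.of ![p.Dk, p.Di, p.Dj]).det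

theorem dualDet_ne_zero : p.dualDet ≠ 0 := by
  intro h
  obtain ⟨c, hc, hc'⟩ := Matrix.exists_vecMul_eq_zero_iff.2 h
  have hsum : c 0 • p.Dk + c 1 • p.Di + c 2 • p.Dj = 0 := by
    rw [← hc', Matrix.vecMul_eq_sum, Fin.sum_univ_three]
    rfl
  refine hc ?_
  have h0 := congrArg (A.L p.k) hsum
  have h1 := congrArg (A.L p.i) hsum
  have h2 := congrArg (A.L p.j) hsum
  simp only [map_add, map_smul, p.Di_spec, p.Dj_spec, p.Dk_spec, smul_eq_mul, mul_one, mul_zero,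
    add_zero, zero_add, map_zero] at h0 h1 h2
  ext a
  fin_cases a <;> assumption

/-- The coefficient of the two-form in the chart. -/
noncomputable def coeff (z : ℂ²) : ℂ :=
  A.b p.i * A.b p.j * p.dualDet /
    ∏ m ∈ Finset.univ.filter fun m => m ≠ p.i ∧ m ≠ p.j, p.root z m ^ (A.b m - 1)

theorem root_ne_zero {z : ℂ²} (hz : z ∈ p.target) {m : Fin 6} (hi : m ≠ p.i) (hj : m ≠ p.j) :
    p.root z m ≠ 0 := by
  by_cases hk : m = p.k
  · subst hk
    simp
  · have h := ((p.mem_point hz).2 m hi hj hk).1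
    intro h0
    exact h (by rw [point_y, h0, zero_div, zero_div])

theorem prod_root_ne_zero {z : ℂ²} (hz : z ∈ p.target) :
    ∏ m ∈ Finset.univ.filter (fun m => m ≠ p.i ∧ m ≠ p.j), p.root z m ^ (A.b m - 1) ≠ 0 :=
  Finset.prod_ne_zero_iff.2 fun _ hm => pow_ne_zero _
    (p.root_ne_zero hz (Finset.mem_filter.1 hm).2.1 (Finset.mem_filter.1 hm).2.2)

theorem coeff_ne_zero {z : ℂ²} (hz : z ∈ p.target) : p.coeff z ≠ 0 := by
  refine div_ne_zero (mul_ne_zero (mul_ne_zero ?_ ?_) p.dualDet_ne_zero) (p.prod_root_ne_zero hz)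
  · exact_mod_cast A.b_ne_zero p.i
  · exact_mod_cast A.b_ne_zero p.j

theorem differentiableAt_coeff {z : ℂ²} (hz : z ∈ p.target) : DifferentiableAt ℂ p.coeff z := by
  have h : ContDiffAt ℂ 1 (fun z => ∏ m ∈ Finset.univ.filter fun m => m ≠ p.i ∧ m ≠ p.j,
      p.root z m ^ (A.b m - 1)) z :=
    contDiffAt_prod fun m _ => (p.contDiffAt_root hz m).pow _
  exact (contDiffAt_const.div h (p.prod_root_ne_zero hz)).differentiableAt one_ne_zero

/-- Multiplied by `∏ y m ^ (b m - 1)`, the two-form becomes the pullback of `det (v, dv, dv)`: the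
right side is the determinant of `vec` and its two partial derivatives. The powers of the
coordinates coming from the derivatives cancel against the denominator, which leaves no pole along
the ramification. -/
theorem coeff_mul_prod {z : ℂ²} (hz : z ∈ p.target) :
    p.coeff z * ∏ m, p.root z m ^ (A.b m - 1) =
      A.b p.i * z 0 ^ (A.b p.i - 1) * (A.b p.j * z 1 ^ (A.b p.j - 1)) * p.dualDet := by
  have h : ∏ m, p.root z m ^ (A.b m - 1) = (z 0 ^ (A.b p.i - 1) * z 1 ^ (A.b p.j - 1)) *
      ∏ m ∈ Finset.univ.filter (fun m => m ≠ p.i ∧ m ≠ p.j), p.root z m ^ (A.b m - 1) := by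
    have h1 : (Finset.univ.filter fun m : Fin 6 => ¬ (m ≠ p.i ∧ m ≠ p.j)) = {p.i, p.j} := by
      ext m
      simp
      tauto
    rw [← Finset.prod_filter_not_mul_prod_filter Finset.univ (fun m => m ≠ p.i ∧ m ≠ p.j), h1,
      Finset.prod_pair p.hij, root_i, root_j]
  have := p.prod_root_ne_zero hz
  rw [h, coeff]
  field_simp

theorem hasFDerivAt_vec (z : ℂ²) : HasFDerivAt p.vec
    ((ContinuousLinearMap.proj (R := ℂ) (φ := fun _ : Fin 2 => ℂ) 0).smulRight
        ((A.b p.i * z 0 ^ (A.b p.i - 1)) • p.Di) +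
      (ContinuousLinearMap.proj (R := ℂ) (φ := fun _ : Fin 2 => ℂ) 1).smulRight
        ((A.b p.j * z 1 ^ (A.b p.j - 1)) • p.Dj)) z := by
  have h : ∀ (a : Fin 2) (n : ℕ) (w : ℂ³), HasFDerivAt (fun z : ℂ² => z a ^ n • w)
      ((ContinuousLinearMap.proj (R := ℂ) (φ := fun _ : Fin 2 => ℂ) a).smulRight
        ((n * z a ^ (n - 1)) • w)) z := by
    intro a n w
    have h1 : HasFDerivAt (fun z : ℂ² => z a)
        (ContinuousLinearMap.proj (R := ℂ) (φ := fun _ : Fin 2 => ℂ) a) z :=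
      (ContinuousLinearMap.proj (R := ℂ) (φ := fun _ : Fin 2 => ℂ) a).hasFDerivAt
    refine ((h1.pow n).smul_const w).congr_fderiv ?_
    ext e
    simp
    ring
  exact ((h 0 _ _).const_add p.Dk).add (h 1 _ _)

end ChartIndex

theorem det_clm_two (f : ℂ² →L[ℂ] ℂ²) : f.det =
    f (Pi.single 0 1) 0 * f (Pi.single 1 1) 1 - f (Pi.single 1 1) 0 * f (Pi.single 0 1) 1 := by
  rw [ContinuousLinearMap.det, ← LinearMap.det_toMatrix', Matrix.det_fin_two]
  simp [LinearMap.toMatrix'_apply]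

/-- The transformation rule of `det (v, dv, dv)` under a change of coordinates and a rescaling of
`v` by a function `Λ`: the derivatives of `Λ` contribute multiples of the first row and drop out. -/
theorem det_combination {V V0 V1 W W0 W1 : ℂ³} {Λ l0 l1 α β γ δ : ℂ} (hW : W = Λ • V)
    (h0 : α • W0 + γ • W1 = l0 • V + Λ • V0) (h1 : β • W0 + δ • W1 = l1 • V + Λ • V1) :
    (α * δ - β * γ) * (Matrix.of ![W, W0, W1]).det = Λ ^ 3 * (Matrix.of ![V, V0, V1]).det := by
  have e1 : (α * δ - β * γ) * (Matrix.of ![W, W0, W1]).det =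
      (Matrix.of ![W, α • W0 + γ • W1, β • W0 + δ • W1]).det := by
    simp [Matrix.det_fin_three]
    ring
  rw [e1, h0, h1, hW]
  simp [Matrix.det_fin_three]
  ring

theorem det_vec (p : A.ChartIndex) (z : ℂ²) (s t : ℂ) :
    (Matrix.of ![p.vec z, s • p.Di, t • p.Dj]).det = s * t * p.dualDet := by
  simp [Matrix.det_fin_three, ChartIndex.vec, ChartIndex.dualDet]
  ring

theorem coeff_change_of_ne_zero (p p' : A.ChartIndex) {z : ℂ²} (hz : z ∈ p.target)
    (hz' : p'.Mem (p.point z)) (h0 : z 0 ≠ 0) (h1 : z 1 ≠ 0) :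
    p.coeff z = p'.coeff (p'.coord (p.point z)) *
      (fderiv ℂ (fun z => p'.coord (p.point z)) z).det := by
  have hψ : HasFDerivAt (fun z => p'.coord (p.point z))
      (fderiv ℂ (fun z => p'.coord (p.point z)) z) z :=
    ((contDiffAt_transition p p' hz hz' (n := 1)).differentiableAt one_ne_zero).hasFDerivAt
  set D := fderiv ℂ (fun z => p'.coord (p.point z)) z with hD
  have hk : p.root z p'.k ≠ 0 := hz'.1
  have hkev : ∀ᶠ w in 𝓝 z, p.root w p'.k ≠ 0 :=
    (p.contDiffAt_root (n := 0) hz p'.k).continuousAt.eventually_ne hk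
  have heq : ∀ᶠ w in 𝓝 z, p'.vec (p'.coord (p.point w)) =
      ((p.root w p'.k)⁻¹ ^ A.N) • p.vec w :=
    hkev.mono fun w hw => p'.vec_coord (x := p.point w) hw
  have hΛ : DifferentiableAt ℂ (fun w => (p.root w p'.k)⁻¹ ^ A.N) z :=
    (((p.contDiffAt_root (n := 1) hz p'.k).differentiableAt one_ne_zero).inv hk).pow _
  have hd1 := (p'.hasFDerivAt_vec (p'.coord (p.point z))).comp z hψ
  have hd2 := (hΛ.hasFDerivAt.smul (p.hasFDerivAt_vec z)).congr_of_eventuallyEq heq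
  have hd := hd1.unique hd2
  set Λ := (p.root z p'.k)⁻¹ with hΛdef
  have hΛ0 : Λ ≠ 0 := inv_ne_zero hk
  set ψ := p'.coord (p.point z) with hψdef
  set dΛ := fderiv ℂ (fun w => (p.root w p'.k)⁻¹ ^ A.N) z
  have e0 := congrArg (fun f : ℂ² →L[ℂ] ℂ³ => f (Pi.single 0 1)) hd
  have e1 := congrArg (fun f : ℂ² →L[ℂ] ℂ³ => f (Pi.single 1 1)) hd
  simp at e0 e1
  have hcomb := det_combination (V := p.vec z) (W := p'.vec ψ)
    (V0 := (A.b p.i * z 0 ^ (A.b p.i - 1)) • p.Di) (V1 := (A.b p.j * z 1 ^ (A.b p.j - 1)) • p.Dj)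
    (W0 := (A.b p'.i * ψ 0 ^ (A.b p'.i - 1)) • p'.Di)
    (W1 := (A.b p'.j * ψ 1 ^ (A.b p'.j - 1)) • p'.Dj) (Λ := Λ ^ A.N)
    (l0 := dΛ (Pi.single 0 1)) (l1 := dΛ (Pi.single 1 1))
    (α := D (Pi.single 0 1) 0) (β := D (Pi.single 1 1) 0) (γ := D (Pi.single 0 1) 1)
    (δ := D (Pi.single 1 1) 1) heq.self_of_nhds
    (by rw [e0, add_comm]) (by rw [e1, add_comm])
  rw [← det_clm_two, det_vec, det_vec, ← p.coeff_mul_prod hz,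
    ← p'.coeff_mul_prod (p'.coord_mem_target hz')] at hcomb
  -- The Calabi–Yau condition enters here: the denominators rescale with exponent `∑ d m * (b m - 1)
  -- = 3 * N`, exactly as the determinant does.
  have hprod : ∏ m, p'.root ψ m ^ (A.b m - 1) =
      (Λ ^ A.N) ^ 3 * ∏ m, p.root z m ^ (A.b m - 1) := by
    rw [← pow_mul, mul_comm A.N 3, ← A.sum_eq, ← Finset.prod_pow_eq_pow_sum, ← Finset.prod_mul_distrib]
    refine Finset.prod_congr rfl fun m _ => ?_
    rw [p'.root_coord hz', mul_pow, pow_mul]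
    rfl
  rw [hprod] at hcomb
  have hne : ∏ m, p.root z m ^ (A.b m - 1) ≠ 0 := by
    refine Finset.prod_ne_zero_iff.2 fun m _ => pow_ne_zero _ ?_
    by_cases hi : m = p.i
    · subst hi; simpa using h0
    by_cases hj : m = p.j
    · subst hj; simpa using h1
    exact p.root_ne_zero hz hi hj
  have hΛ3 : (Λ ^ A.N) ^ 3 ≠ 0 := pow_ne_zero _ (pow_ne_zero _ hΛ0)
  refine mul_right_cancel₀ hne (mul_left_cancel₀ hΛ3 ?_)
  rw [← hcomb]
  ring

/-- On the ramification curves the product of roots cannot be cancelled. The identity is carried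
there by continuity along the direction `(1, 1)`, which leaves both coordinate axes at once. -/
theorem coeff_change (p p' : A.ChartIndex) {z : ℂ²} (hz : z ∈ p.target)
    (hz' : p'.Mem (p.point z)) :
    p.coeff z = p'.coeff (p'.coord (p.point z)) *
      (fderiv ℂ (fun z => p'.coord (p.point z)) z).det := by
  have hψ := contDiffAt_transition p p' hz hz' (n := 2)
  refine eq_of_eventuallyEq_line (E := ℂ²) (q := z) (e := ![1, 1]) (f := p.coeff)
    (g := fun z => p'.coeff (p'.coord (p.point z)) *
      (fderiv ℂ (fun z => p'.coord (p.point z)) z).det) (p.differentiableAt_coeff hz).continuousAt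
      ?_ ?_
  · refine ContinuousAt.mul ?_ ?_
    · exact ContinuousAt.comp (f := fun z => p'.coord (p.point z)) (g := p'.coeff)
        (p'.differentiableAt_coeff (p'.coord_mem_target hz')).continuousAt hψ.continuousAt
    · have : ContinuousAt (fderiv ℂ (fun z => p'.coord (p.point z))) z :=
        (hψ.fderiv_right (m := 0) (by norm_num)).continuousAt
      simp only [det_clm_two]
      have h : ∀ e a, ContinuousAt
          (fun w => fderiv ℂ (fun z => p'.coord (p.point z)) w e a) z := fun e a =>
        ((continuous_apply a).continuousAt).comp (this.clm_apply continuousAt_const)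
      exact ((h _ _).mul (h _ _)).sub ((h _ _).mul (h _ _))
  · have hopen : IsOpen (p.chart.target ∩ p.chart.symm ⁻¹' p'.chart.source) :=
      p.chart.isOpen_inter_preimage_symm p'.chart.open_source
    have hmem := eventually_add_smul_mem (hopen.mem_nhds (x := z) ⟨hz, hz'⟩) (![1, 1] : ℂ²)
    have hne : ∀ a : Fin 2, ∀ᶠ t : ℂ in 𝓝[≠] 0, (z + t • (![1, 1] : ℂ²)) a ≠ 0 := by
      intro a
      have h1 : (![1, 1] : ℂ²) a = 1 := by fin_cases a <;> rfl
      simp only [Pi.add_apply, Pi.smul_apply, h1, smul_eq_mul, mul_one]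
      by_cases ha : z a = 0
      · filter_upwards [self_mem_nhdsWithin] with t ht
        simpa [ha] using ht
      · refine nhdsWithin_le_nhds (ContinuousAt.eventually_ne (by fun_prop) ?_)
        simpa using ha
    filter_upwards [hmem, hne 0, hne 1] with t ht h0 h1
    exact coeff_change_of_ne_zero p p' ht.1 ht.2 h0 h1

open Classical in
/-- The two-form of the surface. -/
noncomputable def twoForm : HolomorphicTwoForm A.Surface where
  -- Several indices can give the same chart, for instance because `c k` is irrelevant. Any choice
  -- works, since `coeff_change` holds for all pairs of indices.
  coeff e := if h : ∃ p : A.ChartIndex, p.chart = e then h.choose.coeff else 0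
  holomorphic e he := by
    obtain ⟨h1⟩ : Nonempty (∃ p : A.ChartIndex, p.chart = e) := ⟨he⟩
    rw [dif_pos h1]
    have h2 := h1.choose_spec
    intro z hz
    rw [← h2] at hz
    exact (h1.choose.differentiableAt_coeff hz).differentiableWithinAt
  change e he e' he' q hq := by
    obtain ⟨h1⟩ : Nonempty (∃ p : A.ChartIndex, p.chart = e) := ⟨he⟩
    obtain ⟨h1'⟩ : Nonempty (∃ p : A.ChartIndex, p.chart = e') := ⟨he'⟩
    rw [dif_pos h1, dif_pos h1']
    generalize hp : h1.choose = p
    generalize hp' : h1'.choose = p'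
    have h2 := h1.choose_spec
    have h2' := h1'.choose_spec
    rw [hp] at h2
    rw [hp'] at h2'
    subst h2 h2'
    have hz : p.chart q ∈ p.target := p.chart.map_source hq.1
    have hq' : proj (p.point (p.chart q)) = q := p.chart.left_inv hq.1
    have hz' : p'.Mem (p.point (p.chart q)) := by
      rw [← ChartIndex.proj_mem_source, hq']
      exact hq.2
    have := coeff_change p p' hz hz'
    rw [← p'.chart_proj, hq'] at this
    exact this

theorem twoForm_nowhereVanishing : (twoForm (A := A)).NowhereVanishing := by
  intro e he z hz
  obtain ⟨h1⟩ : Nonempty (∃ p : A.ChartIndex, p.chart = e) := ⟨he⟩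
  simp only [twoForm, dif_pos h1]
  have h2 := h1.choose_spec
  rw [← h2] at hz
  exact h1.choose.coeff_ne_zero hz

end TwoForm

end BranchData

end K3Uniformization

namespace K3Uniformization

open Set Metric Filter Topology MeasureTheory

namespace BranchData

/-! ### The deck group, the branched covering and connectedness -/

section DeckGroup

local notation "ℂ³" => (Fin 3 → ℂ)
local notation "ℂ²" => (Fin 2 → ℂ)

variable {A : BranchData}

variable (A) in
/-- The group of changes of the roots. -/
abbrev Deck : Type := ∀ i, rootsOfUnity (A.b i) ℂ

instance (i : Fin 6) : NeZero (A.b i) := ⟨A.b_ne_zero i⟩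

noncomputable instance (i : Fin 6) : Fintype (rootsOfUnity (A.b i) ℂ) := Fintype.ofFinite _

theorem Deck.pow_eq_one (g : A.Deck) (i : Fin 6) : ((g i : ℂˣ) : ℂ) ^ A.b i = 1 :=
  (mem_rootsOfUnity' _ _).1 (g i).2

instance : MulAction A.Deck A.Cone where
  smul g x := Cone.mk x.v (fun i => ((g i : ℂˣ) : ℂ) * x.y i) x.v_ne_zero fun i => by
    rw [mul_pow, g.pow_eq_one, one_mul, x.y_pow]
  one_smul x := Cone.ext rfl (funext fun i => one_mul (x.y i))
  mul_smul g g' x := Cone.ext rfl (funext fun i => by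
    change (((g * g') i : ℂˣ) : ℂ) * x.y i = ((g i : ℂˣ) : ℂ) * (((g' i : ℂˣ) : ℂ) * x.y i)
    simp [mul_assoc])

@[simp] theorem Cone.deck_smul_v (g : A.Deck) (x : A.Cone) : (g • x).v = x.v := rfl

@[simp] theorem Cone.deck_smul_y (g : A.Deck) (x : A.Cone) (i : Fin 6) :
    (g • x).y i = ((g i : ℂˣ) : ℂ) * x.y i := rfl

theorem deck_smul_comm (g : A.Deck) (c : ℂˣ) (x : A.Cone) : g • c • x = c • g • x :=
  Cone.ext rfl (funext fun _ => mul_left_comm _ _ _)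

instance : ContinuousConstSMul A.Deck A.Cone where
  continuous_const_smul _ := Cone.continuous_mk Cone.continuous_v fun i =>
    continuous_const.mul (Cone.continuous_y_apply i)

instance : MulAction A.Deck A.Surface where
  smul g := lift (fun x => proj (g • x)) fun c x => by rw [deck_smul_comm, proj_smul]
  one_smul q := by
    obtain ⟨x, rfl⟩ := proj_surjective q
    exact congrArg proj (one_smul _ x)
  mul_smul g g' q := by
    obtain ⟨x, rfl⟩ := proj_surjective q
    exact congrArg proj (mul_smul g g' x)

theorem deck_smul_proj (g : A.Deck) (x : A.Cone) : g • proj x = proj (g • x) := rfl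

instance : ContinuousConstSMul A.Deck A.Surface where
  continuous_const_smul g := isOpenQuotientMap_proj.isQuotientMap.continuous_iff.2
    (continuous_proj.comp (continuous_const_smul g))

theorem exists_cone_over {v : ℂ³} (hv : v ≠ 0) : ∃ x : A.Cone, x.v = v := by
  choose y hy using fun i => IsAlgClosed.exists_pow_nat_eq (A.L i v)
    (Nat.pos_of_ne_zero (A.b_ne_zero i))
  exact ⟨Cone.mk v y hv hy, rfl⟩

/-- Two `b i`-th roots of a nonzero number differ by a root of unity; for a vanishing root the
choice is free, and `1` is taken. -/
theorem exists_deck_smul_eq {x x' : A.Cone} (h : x.v = x'.v) : ∃ g : A.Deck, g • x' = x := by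
  have key : ∀ i, ∃ ζ : rootsOfUnity (A.b i) ℂ, ((ζ : ℂˣ) : ℂ) * x'.y i = x.y i := by
    intro i
    have h1 : x.y i ^ A.b i = x'.y i ^ A.b i := by rw [x.y_pow, x'.y_pow, h]
    by_cases h0 : x'.y i = 0
    · refine ⟨1, ?_⟩
      rw [h0, mul_zero]
      rw [h0, zero_pow (A.b_ne_zero i)] at h1
      exact (pow_eq_zero_iff (A.b_ne_zero i)).1 h1 |>.symm
    · have h2 : (x.y i / x'.y i) ^ A.b i = 1 := by
        rw [div_pow, h1, div_self (pow_ne_zero _ h0)]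
      have h3 : x.y i / x'.y i ≠ 0 := fun h => by
        rw [h, zero_pow (A.b_ne_zero i)] at h2
        exact zero_ne_one h2
      exact ⟨⟨Units.mk0 _ h3, (mem_rootsOfUnity' _ _).2 h2⟩, div_mul_cancel₀ _ h0⟩
  choose g hg using key
  exact ⟨g, Cone.ext h.symm (funext hg)⟩

/-- The branched covering of the projective plane. -/
noncomputable def cover : A.Surface → ProjectivePlane :=
  lift (fun x => Projectivization.mk ℂ x.v x.v_ne_zero) fun c _ =>
    (Projectivization.mk_eq_mk_iff ℂ _ _ _ _).2 ⟨c ^ A.N, rfl⟩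

@[simp] theorem cover_proj (x : A.Cone) :
    cover (proj x) = Projectivization.mk ℂ x.v x.v_ne_zero := rfl

/-- Proportional vectors become equal after acting on one of the points with an `N`-th root of the
proportionality factor; then the deck group acts transitively on the fibre. -/
theorem cover_eq_iff {q q' : A.Surface} : cover q = cover q' ↔ ∃ g : A.Deck, g • q' = q := by
  constructor
  · intro h
    obtain ⟨x, rfl⟩ := proj_surjective q
    obtain ⟨x', rfl⟩ := proj_surjective q'
    obtain ⟨a, ha⟩ := (Projectivization.mk_eq_mk_iff ℂ _ _ _ _).1 h
    obtain ⟨c, hc⟩ := IsAlgClosed.exists_pow_nat_eq (a : ℂ) (Nat.pos_of_ne_zero A.N_ne_zero)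
    have hc0 : c ≠ 0 := fun h0 => a.ne_zero (by rw [← hc, h0, zero_pow A.N_ne_zero])
    obtain ⟨g, hg⟩ := exists_deck_smul_eq (x := x) (x' := Units.mk0 c hc0 • x') (by
      rw [Cone.smul_v, Units.val_mk0, hc, ← ha]
      rfl)
    refine ⟨g, ?_⟩
    rw [← proj_smul (Units.mk0 c hc0) x', deck_smul_proj, hg]
  · rintro ⟨g, rfl⟩
    obtain ⟨x, rfl⟩ := proj_surjective q'
    rfl

/-- The projection of the cone to `ℂ³ ∖ 0`. -/
def Cone.base (x : A.Cone) : {v : ℂ³ // v ≠ 0} := ⟨x.v, x.v_ne_zero⟩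

theorem Cone.continuous_base : Continuous (Cone.base : A.Cone → _) :=
  Cone.continuous_v.subtype_mk _

theorem Cone.base_surjective : Function.Surjective (Cone.base : A.Cone → _) := fun v =>
  (exists_cone_over v.2).imp fun _ h => Subtype.ext h

theorem Cone.isClosedMap_base : IsClosedMap (Cone.base : A.Cone → _) := by
  have : LocallyCompactSpace {v : ℂ³ // v ≠ 0} := isOpen_compl_singleton.locallyCompactSpace
  refine (isProperMap_iff_isCompact_preimage.2 ⟨Cone.continuous_base, fun K hK => ?_⟩).isClosedMap
  have h := isCompact_cone_preimage (A := A) (hK.image continuous_subtype_val) (by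
    rintro ⟨v, -, hv⟩
    exact v.2 hv)
  convert h using 1
  ext x
  constructor
  · exact fun hx => ⟨_, hx, rfl⟩
  · rintro ⟨w, hw, hw'⟩
    have : x.base = w := Subtype.ext hw'.symm
    rw [mem_preimage, this]
    exact hw

theorem Cone.isQuotientMap_base : IsQuotientMap (Cone.base : A.Cone → _) :=
  Cone.isClosedMap_base.isQuotientMap Cone.continuous_base Cone.base_surjective

/-- The projection of `ℂ³ ∖ 0` to the projective plane. -/
noncomputable def planeProj (v : {v : ℂ³ // v ≠ 0}) : ProjectivePlane := Projectivization.mk ℂ v.1 v.2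

theorem isQuotientMap_planeProj : IsQuotientMap planeProj :=
  ⟨⟨rfl⟩, fun p => p.ind fun v hv => ⟨⟨v, hv⟩, rfl⟩⟩

theorem continuous_cover : Continuous (cover : A.Surface → _) :=
  isOpenQuotientMap_proj.isQuotientMap.continuous_iff.2
    (isQuotientMap_planeProj.continuous.comp Cone.continuous_base)

theorem isQuotientMap_cover : IsQuotientMap (cover : A.Surface → _) :=
  IsQuotientMap.of_comp continuous_proj continuous_cover
    (isQuotientMap_planeProj.comp Cone.isQuotientMap_base)

theorem isClosedMap_cover : IsClosedMap (cover : A.Surface → _) := by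
  intro s hs
  rw [← isQuotientMap_planeProj.isClosed_preimage]
  have h : planeProj ⁻¹' (cover '' s) = Cone.base '' (proj ⁻¹' s : Set A.Cone) := by
    ext v
    constructor
    · rintro ⟨q, hq, hq'⟩
      obtain ⟨x, hx⟩ := Cone.base_surjective (A := A) v
      obtain ⟨g, hg⟩ := cover_eq_iff.1 (show cover q = cover (proj x) by
        rw [hq', ← hx]
        rfl)
      exact ⟨g • x, by rwa [mem_preimage, ← deck_smul_proj, hg], hx⟩
    · rintro ⟨x, hx, rfl⟩
      exact ⟨proj x, hx, rfl⟩
  rw [h]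
  exact Cone.isClosedMap_base _ (hs.preimage continuous_proj)

theorem isOpenMap_cover : IsOpenMap (cover : A.Surface → _) := by
  intro s hs
  rw [← isQuotientMap_cover.isOpen_preimage]
  have h : cover ⁻¹' (cover '' s) = ⋃ g : A.Deck, (fun q : A.Surface => g • q) ⁻¹' s := by
    ext q
    simp only [mem_preimage, mem_image, mem_iUnion]
    constructor
    · rintro ⟨q', hq', h⟩
      obtain ⟨g, rfl⟩ := cover_eq_iff.1 h
      exact ⟨g, hq'⟩
    · rintro ⟨g, hg⟩
      exact ⟨_, hg, cover_eq_iff.2 ⟨g, rfl⟩⟩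
  rw [h]
  exact isOpen_iUnion fun g => hs.preimage (continuous_const_smul g)

theorem exists_L_eq_zero (i : Fin 6) : ∃ x : A.Cone, x.y i = 0 := by
  have : ∀ i : Fin 6, ∃ j k : Fin 6, j ≠ i ∧ j ≠ k ∧ i ≠ k := by decide
  obtain ⟨j, k, h1, h2, h3⟩ := this i
  obtain ⟨e, he, he', -⟩ := exists_dual (A := A) h1 h2 h3
  obtain ⟨x, hx⟩ := exists_cone_over (A := A) (v := e) fun h => by simp [h] at he
  exact ⟨x, (x.y_eq_zero_iff i).2 (by rw [hx, he'])⟩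

instance : ConnectedSpace ProjectivePlane := by
  have h : IsConnected ({0}ᶜ : Set ℂ³) := isConnected_compl_singleton_of_one_lt_rank (by
    rw [← Module.finrank_eq_rank]
    have : Module.finrank ℝ ℂ³ = 6 := by
      simp [Module.finrank_pi_fintype, Complex.finrank_real_complex]
    rw [this]
    norm_num) 0
  have : ConnectedSpace {v : ℂ³ // v ≠ 0} := isConnected_iff_connectedSpace.1 h
  exact isQuotientMap_planeProj.surjective.connectedSpace isQuotientMap_planeProj.continuous

/-- A component is open and closed, and `cover` is an open and closed map, so the component meets
every fibre. The change of a single root `y i` fixes the points over `L i = 0`, one of which lies in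
the component, so it preserves the component. These changes generate the deck group, which is
transitive on fibres. -/
instance : ConnectedSpace A.Surface := by
  have : LocallyConnectedSpace A.Surface := ChartedSpace.locallyConnectedSpace ℂ² A.Surface
  obtain ⟨x₀, -⟩ := exists_L_eq_zero (A := A) 0
  set C := connectedComponent (proj x₀) with hC
  have hCo : IsOpen C := isOpen_connectedComponent
  have himg : cover '' C = univ := IsClopen.eq_univ
    ⟨isClosedMap_cover _ isClosed_connectedComponent, isOpenMap_cover _ hCo⟩
    ⟨_, proj x₀, mem_connectedComponent, rfl⟩
  have hsingle : ∀ i (ζ : rootsOfUnity (A.b i) ℂ), ∀ q ∈ C, (Pi.mulSingle i ζ : A.Deck) • q ∈ C := by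
    intro i ζ
    obtain ⟨x, hx⟩ := exists_L_eq_zero (A := A) i
    obtain ⟨q, hq, hq'⟩ := himg.symm.subset (mem_univ (cover (proj x)))
    obtain ⟨g, hg⟩ := cover_eq_iff.1 hq'
    have hfix : (Pi.mulSingle i ζ : A.Deck) • q = q := by
      rw [← hg, deck_smul_proj, deck_smul_proj]
      refine congrArg proj (Cone.ext rfl (funext fun m => ?_))
      rw [Cone.deck_smul_y]
      by_cases hm : m = i
      · subst hm
        simp [hx]
      · simp [Pi.mulSingle_eq_of_ne hm]
    have hsub : (fun q : A.Surface => (Pi.mulSingle i ζ : A.Deck) • q) '' C ⊆ C := by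
      have h1 := (isPreconnected_connectedComponent (x := proj x₀)).image
        (fun q : A.Surface => (Pi.mulSingle i ζ : A.Deck) • q)
        (continuous_const_smul _).continuousOn
      have h2 := h1.subset_connectedComponent (x := q) ⟨q, hq, hfix⟩
      rwa [← connectedComponent_eq hq] at h2
    exact fun q hq => hsub (mem_image_of_mem _ hq)
  let S : Submonoid A.Deck :=
    { carrier := {g | ∀ q ∈ C, g • q ∈ C}
      one_mem' := fun q hq => by rwa [one_smul]
      mul_mem' := fun {g g'} hg hg' q hq => by
        rw [mul_smul]
        exact hg _ (hg' _ hq) }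
  have hall : ∀ g : A.Deck, g ∈ S := fun g => by
    rw [← Finset.univ_prod_mulSingle g]
    exact Submonoid.prod_mem _ fun i _ => hsingle i (g i)
  refine connectedSpace_iff_connectedComponent.2 ⟨proj x₀, eq_univ_of_forall fun q => ?_⟩
  obtain ⟨q', hq', h⟩ := himg.symm.subset (mem_univ (cover q))
  obtain ⟨g, rfl⟩ := cover_eq_iff.1 h.symm
  exact hall g _ hq'

end DeckGroup

end BranchData

end K3Uniformization

namespace K3Uniformization

open Set Metric Filter Topology MeasureTheory

namespace BranchData

/-! ### The quotient by the deck group and the isotropy orders -/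

section Uniformization

local notation "ℂ³" => (Fin 3 → ℂ)
local notation "ℂ²" => (Fin 2 → ℂ)

variable {A : BranchData}

theorem L_ne_zero (i : Fin 6) : A.L i ≠ 0 := by
  have : ∀ i : Fin 6, ∃ j k : Fin 6, i ≠ j ∧ i ≠ k ∧ j ≠ k := by decide
  obtain ⟨j, k, h1, h2, h3⟩ := this i
  obtain ⟨e, he, -⟩ := exists_dual (A := A) h1 h2 h3
  exact fun h => by simp [h] at he

variable (A) in
theorem exists_generic_vector : ∃ e : ℂ³, ∀ i, A.L i e ≠ 0 := by
  classical
  by_contra! h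
  refine Subspace.biUnion_ne_univ_of_top_notMem (k := ℂ) (E := ℂ³)
    (s := Finset.univ.image fun i => LinearMap.ker (A.L i : ℂ³ →ₗ[ℂ] ℂ)) ?_
    (eq_univ_of_forall fun v => ?_)
  · simp only [Finset.mem_image, Finset.mem_univ, true_and, not_exists]
    intro i hi
    exact A.L_ne_zero i (ContinuousLinearMap.coe_injective (LinearMap.ker_eq_top.1 hi))
  · obtain ⟨i, hi⟩ := h v
    simp only [mem_iUnion]
    exact ⟨_, Finset.mem_image_of_mem _ (Finset.mem_univ i), hi⟩

variable (A) in
theorem eventually_L_ne_zero : ∃ e : ℂ³, ∀ v : ℂ³, ∀ᶠ t : ℂ in 𝓝[≠] 0, ∀ i, A.L i (v + t • e) ≠ 0 := by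
  obtain ⟨e, he⟩ := A.exists_generic_vector
  refine ⟨e, fun v => eventually_all.2 fun i => ?_⟩
  simp only [map_add, map_smul, smul_eq_mul]
  by_cases hv : A.L i v = 0
  · filter_upwards [self_mem_nhdsWithin] with t ht
    rw [hv, zero_add]
    exact mul_ne_zero ht (he i)
  · refine nhdsWithin_le_nhds (ContinuousAt.eventually_ne (by fun_prop) ?_)
    simpa using hv

theorem exists_cone_ne_zero : ∃ x : A.Cone, ∀ i, x.y i ≠ 0 := by
  obtain ⟨e, he⟩ := A.exists_generic_vector
  obtain ⟨x, hx⟩ := exists_cone_over (A := A) (v := e) fun h => he 0 (by simp [h])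
  exact ⟨x, fun i hi => he i (by rw [← hx]; exact (x.y_eq_zero_iff i).1 hi)⟩

open Classical in
/-- A local section of the cone over `ℂ³ ∖ 0` through `x`, holomorphic near `x.v` if no root of `x`
vanishes. -/
noncomputable def Cone.localSection (x : A.Cone) (v : ℂ³) : A.Cone :=
  if h : v ≠ 0 ∧ ∀ i, x.y i ≠ 0 then
    Cone.mk v (fun i => x.y i * (A.L i v / A.L i x.v) ^ ((A.b i : ℂ)⁻¹)) h.1 fun i => by
      have : A.L i x.v ≠ 0 := fun h' => h.2 i ((x.y_eq_zero_iff i).2 h')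
      rw [mul_pow, Complex.cpow_nat_inv_pow _ (A.b_ne_zero i), x.y_pow, mul_div_cancel₀ _ this]
  else x

theorem Cone.localSection_v {x : A.Cone} (hx : ∀ i, x.y i ≠ 0) {v : ℂ³} (hv : v ≠ 0) :
    (x.localSection v).v = v := by
  rw [localSection, dif_pos ⟨hv, hx⟩, mk_v]

theorem Cone.localSection_y {x : A.Cone} (hx : ∀ i, x.y i ≠ 0) {v : ℂ³} (hv : v ≠ 0) (i : Fin 6) :
    (x.localSection v).y i = x.y i * (A.L i v / A.L i x.v) ^ ((A.b i : ℂ)⁻¹) := by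
  rw [localSection, dif_pos ⟨hv, hx⟩, mk_y]

theorem Cone.localSection_self {x : A.Cone} (hx : ∀ i, x.y i ≠ 0) : x.localSection x.v = x := by
  refine Cone.ext (localSection_v hx x.v_ne_zero) (funext fun i => ?_)
  have : A.L i x.v ≠ 0 := fun h' => hx i ((x.y_eq_zero_iff i).2 h')
  rw [localSection_y hx x.v_ne_zero, div_self this, Complex.one_cpow, mul_one]

theorem Cone.deck_smul_localSection {x : A.Cone} (hx : ∀ i, x.y i ≠ 0) {v : ℂ³} (hv : v ≠ 0)
    (g : A.Deck) : g • x.localSection v = (g • x).localSection v := by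
  have hgx : ∀ i, (g • x).y i ≠ 0 := fun i => mul_ne_zero (Units.ne_zero _) (hx i)
  refine Cone.ext ?_ (funext fun i => ?_)
  · rw [deck_smul_v, localSection_v hx hv, localSection_v hgx hv]
  · rw [deck_smul_y, localSection_y hx hv, localSection_y hgx hv, deck_smul_y, deck_smul_v, mul_assoc]

theorem Cone.contDiffAt_localSection_y {x : A.Cone} (hx : ∀ i, x.y i ≠ 0) (i : Fin 6) :
    ContDiffAt ℂ 1 (fun v => (x.localSection v).y i) x.v := by
  have h0 : A.L i x.v ≠ 0 := fun h' => hx i ((x.y_eq_zero_iff i).2 h')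
  have h : ContDiffAt ℂ 1 (fun v => x.y i * (A.L i v / A.L i x.v) ^ ((A.b i : ℂ)⁻¹)) x.v := by
    refine contDiffAt_const.mul (ContDiffAt.comp x.v (g := fun w : ℂ => w ^ ((A.b i : ℂ)⁻¹))
      (contDiffAt_cpow_inv ?_) ((A.L i).contDiff.contDiffAt.div_const _))
    rw [div_self h0]
    exact Complex.one_mem_slitPlane
  refine h.congr_of_eventuallyEq ?_
  filter_upwards [isOpen_compl_singleton.mem_nhds x.v_ne_zero] with v hv
  exact localSection_y hx hv i

theorem Cone.continuousAt_localSection {x : A.Cone} (hx : ∀ i, x.y i ≠ 0) :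
    ContinuousAt x.localSection x.v := by
  refine (IsInducing.subtypeVal (Y := ℂ³ × (Fin 6 → ℂ))).continuousAt_iff.2 ?_
  have h1 : ContinuousAt (fun v => (x.localSection v).v) x.v := by
    refine continuousAt_id.congr ?_
    filter_upwards [isOpen_compl_singleton.mem_nhds x.v_ne_zero] with v hv
    exact (localSection_v hx hv).symm
  exact h1.prodMk (continuousAt_pi.2 fun i => (contDiffAt_localSection_y hx i).continuousAt)

/-- Where no root vanishes, holomorphic functions on the surface descend to holomorphic functions of
`v`, since the roots are locally holomorphic in `v`. -/
theorem Cone.differentiableAt_comp_localSection {x : A.Cone} (hx : ∀ i, x.y i ≠ 0)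
    {F : A.Surface → ℂ} (hF : MDifferentiableAt 𝓘(ℂ, ℂ²) 𝓘(ℂ, ℂ) F (proj x)) :
    DifferentiableAt ℂ (fun v => F (proj (x.localSection v))) x.v := by
  obtain ⟨p, hp⟩ := exists_chartIndex x
  have h1 := (mdifferentiableAt_iff p hp).1 hF
  have h2 : DifferentiableAt ℂ (fun v => p.coord (x.localSection v)) x.v := by
    have h : ∀ m, DifferentiableAt ℂ (fun v => (x.localSection v).y m /
        (x.localSection v).y p.k ^ A.d m) x.v := fun m =>
      ((contDiffAt_localSection_y hx m).div ((contDiffAt_localSection_y hx p.k).pow _)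
        (pow_ne_zero _ (by rw [localSection_self hx]; exact hx _))).differentiableAt one_ne_zero
    refine differentiableAt_pi.2 fun a => ?_
    fin_cases a
    · exact h p.i
    · exact h p.j
  have h3 : DifferentiableAt ℂ ((fun z => F (proj (p.point z))) ∘
      fun v => p.coord (x.localSection v)) x.v := by
    refine DifferentiableAt.comp x.v ?_ h2
    rw [localSection_self hx]
    exact h1
  refine h3.congr_of_eventuallyEq ?_
  have h4 : ∀ᶠ v in 𝓝 x.v, p.Mem (x.localSection v) :=
    (continuousAt_localSection hx).eventually_mem (by
      rw [localSection_self hx]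
      exact p.isOpen_mem.mem_nhds hp)
  filter_upwards [h4] with v hv
  exact congrArg F (p.proj_point_coord hv).symm

theorem mdifferentiableAt_deck_smul (g : A.Deck) (q : A.Surface) :
    MDifferentiableAt 𝓘(ℂ, ℂ²) 𝓘(ℂ, ℂ²) (fun q : A.Surface => g • q) q := by
  obtain ⟨x, rfl⟩ := proj_surjective q
  obtain ⟨p, hp⟩ := exists_chartIndex x
  obtain ⟨p', hp'⟩ := exists_chartIndex (g • x)
  have hpt : proj (g • p.point (p.coord x)) = proj (g • x) := by
    rw [← deck_smul_proj, p.proj_point_coord hp, deck_smul_proj]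
  have hmem : p'.Mem (g • p.point (p.coord x)) := by
    rw [← ChartIndex.proj_mem_source, hpt]
    exact hp'
  have h1 : DifferentiableAt ℂ (fun z => p'.coord (g • p.point z)) (p.coord x) := by
    have hz := p.coord_mem_target hp
    have h : ∀ m, DifferentiableAt ℂ (fun z => (g m : ℂˣ) * p.root z m /
        ((g p'.k : ℂˣ) * p.root z p'.k) ^ A.d m) (p.coord x) := fun m =>
      ((contDiffAt_const.mul (p.contDiffAt_root (n := 1) hz m)).div
        ((contDiffAt_const.mul (p.contDiffAt_root (n := 1) hz p'.k)).pow _)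
        (pow_ne_zero _ hmem.1)).differentiableAt one_ne_zero
    refine differentiableAt_pi.2 fun a => ?_
    fin_cases a
    · exact h p'.i
    · exact h p'.j
  have h2 : MDifferentiableAt 𝓘(ℂ, ℂ²) 𝓘(ℂ, ℂ²)
      ((fun z => p'.coord (g • p.point z)) ∘ p.chart) (proj x) :=
    MDifferentiableAt.comp (proj x) h1.mdifferentiableAt (mdifferentiableAt_chart p hp)
  have h3 : MDifferentiableAt 𝓘(ℂ, ℂ²) 𝓘(ℂ, ℂ²)
      ((fun z => proj (p'.point z)) ∘ ((fun z => p'.coord (g • p.point z)) ∘ p.chart)) (proj x) :=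
    MDifferentiableAt.comp (proj x)
      (mdifferentiableAt_chart_symm p' (p'.coord_mem_target hmem)) h2
  refine h3.congr_of_eventuallyEq ?_
  have h4 : ∀ᶠ q in 𝓝 (proj x), g • q ∈ p'.source :=
    (continuous_const_smul g).continuousAt.eventually_mem (p'.isOpen_source.mem_nhds hp')
  filter_upwards [h4, p.chart.open_source.mem_nhds hp] with q hq hq'
  have h5 : proj (g • p.point (p.chart q)) = g • q := by
    rw [← deck_smul_proj]
    exact congrArg _ (p.chart.left_inv hq')
  rw [← h5] at hq ⊢
  exact (p'.proj_point_coord hq).symm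

theorem isOpen_coneSet {U : Set ProjectivePlane} (hU : IsOpen U) : IsOpen (coneSet U) := by
  have h : coneSet U = Subtype.val '' (planeProj ⁻¹' U) := by
    ext v
    constructor
    · rintro ⟨hv, hvU⟩
      exact ⟨⟨v, hv⟩, hvU, rfl⟩
    · rintro ⟨w, hw, rfl⟩
      exact ⟨w.2, hw⟩
  rw [h]
  exact isOpen_compl_singleton.isOpenMap_subtype_val _ (hU.preimage isQuotientMap_planeProj.continuous)

theorem coneFun_v (f : ProjectivePlane → ℂ) (x : A.Cone) : coneFun f x.v = f (cover (proj x)) :=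
  dif_pos x.v_ne_zero

theorem mem_coneSet_iff {U : Set ProjectivePlane} {x : A.Cone} :
    x.v ∈ coneSet U ↔ cover (proj x) ∈ U :=
  ⟨fun h => h.2, fun h => ⟨x.v_ne_zero, h⟩⟩

/-- A function on an open subset of `ℂ³ ∖ 0` is continuous if its pullback to the cone is. -/
theorem continuousOn_of_cone {C : Set ℂ³} (hC : IsOpen C) (h0 : (0 : ℂ³) ∉ C) {H : ℂ³ → ℂ}
    (h : ContinuousOn (fun x : A.Cone => H x.v) {x | x.v ∈ C}) : ContinuousOn H C := by
  have h1 : ContinuousOn (fun v : {v : ℂ³ // v ≠ 0} => H v) (Subtype.val ⁻¹' C) :=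
    ((Cone.isQuotientMap_base (A := A)).continuousOn_isOpen_iff
      (hC.preimage continuous_subtype_val)).2 h
  intro v hv
  have hv0 : v ≠ 0 := fun h => h0 (h ▸ hv)
  have h2 : ContinuousAt (H ∘ (Subtype.val : {v : ℂ³ // v ≠ 0} → ℂ³)) ⟨v, hv0⟩ :=
    (h1 ⟨v, hv0⟩ hv).continuousAt ((hC.preimage continuous_subtype_val).mem_nhds hv)
  exact ((isOpen_compl_singleton.isOpenEmbedding_subtypeVal.continuousAt_iff).1 h2).continuousWithinAt

/-- A continuous function on an open subset of `ℂ³ ∖ 0` is holomorphic if it is so off the lines. -/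
theorem differentiableOn_of_cone {C : Set ℂ³} (hC : IsOpen C) (h0 : (0 : ℂ³) ∉ C) {H : ℂ³ → ℂ}
    (h : ContinuousOn (fun x : A.Cone => H x.v) {x | x.v ∈ C})
    (hd : ∀ x : A.Cone, x.v ∈ C → (∀ i, x.y i ≠ 0) → DifferentiableAt ℂ H x.v) :
    DifferentiableOn ℂ H C := by
  refine differentiableOn_of_continuousOn_off_hyperplanes hC A.L Finset.univ
    (fun i _ => A.L_ne_zero i) (continuousOn_of_cone hC h0 h) fun v hv hL => ?_
  obtain ⟨x, rfl⟩ := exists_cone_over (A := A) (v := v) fun h => h0 (h ▸ hv)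
  exact hd x hv fun i hi => hL i (Finset.mem_univ i) ((x.y_eq_zero_iff i).1 hi)

theorem zero_notMem_coneSet (U : Set ProjectivePlane) : (0 : ℂ³) ∉ coneSet U := fun h => h.1 rfl

/-- Pulling back is composition with the polynomial map `vec`. For the converse, local sections give
holomorphy off the lines, and the quotient topology gives continuity everywhere; Riemann's theorem
then crosses the lines. -/
theorem holomorphicOnPlane_iff {U : Set ProjectivePlane} (hU : IsOpen U) (f : ProjectivePlane → ℂ) :
    HolomorphicOnPlane f U ↔ MDifferentiableOn 𝓘(ℂ, ℂ²) 𝓘(ℂ, ℂ)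
      (fun q : A.Surface => f (cover q)) (cover ⁻¹' U) := by
  have hUo : IsOpen (cover ⁻¹' U : Set A.Surface) := hU.preimage continuous_cover
  constructor
  · intro h q hq
    obtain ⟨x, rfl⟩ := proj_surjective q
    obtain ⟨p, hp⟩ := exists_chartIndex x
    refine MDifferentiableAt.mdifferentiableWithinAt ((mdifferentiableAt_iff p hp).2 ?_)
    have h1 : (fun z => f (cover (proj (p.point z)))) = coneFun f ∘ p.vec := by
      ext z
      exact (coneFun_v f (p.point z)).symm
    rw [h1]
    refine DifferentiableAt.comp _ (h.differentiableAt ((isOpen_coneSet hU).mem_nhds ?_))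
      ((p.contDiff_vec (n := 1)).differentiable one_ne_zero _)
    refine mem_coneSet_iff (x := p.point (p.coord x)).2 ?_
    rw [p.proj_point_coord hp]
    exact hq
  · intro h
    refine differentiableOn_of_cone (A := A) (isOpen_coneSet hU) (zero_notMem_coneSet U) ?_ ?_
    · simp only [coneFun_v]
      exact h.continuousOn.comp continuous_proj.continuousOn fun x hx => mem_coneSet_iff.1 hx
    · intro x hx hy
      have h1 := Cone.differentiableAt_comp_localSection hy
        ((h _ (mem_coneSet_iff.1 hx)).mdifferentiableAt (hUo.mem_nhds (mem_coneSet_iff.1 hx)))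
      refine h1.congr_of_eventuallyEq ?_
      filter_upwards [isOpen_compl_singleton.mem_nhds x.v_ne_zero] with v hv
      rw [← coneFun_v f, Cone.localSection_v hy hv]

variable (A) in
/-- The group of the uniformization. -/
abbrev DeckImage : Subgroup (Equiv.Perm A.Surface) := (MulAction.toPermHom A.Deck A.Surface).range

theorem card_deck_fixing (x : A.Cone) :
    Nat.card {h : A.Deck // ∀ i, x.y i ≠ 0 → h i = 1} = ∏ i, if A.L i x.v = 0 then A.b i else 1 := by
  rw [Nat.card_congr (Equiv.subtypePiEquivPi (p := fun i (ζ : rootsOfUnity (A.b i) ℂ) =>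
    x.y i ≠ 0 → ζ = 1)), Nat.card_pi]
  refine Finset.prod_congr rfl fun i _ => ?_
  split_ifs with h
  · have hi : x.y i = 0 := (x.y_eq_zero_iff i).2 h
    exact (Nat.card_congr (Equiv.subtypeUnivEquiv
      (p := fun ζ : rootsOfUnity (A.b i) ℂ => x.y i ≠ 0 → ζ = 1) fun _ h => absurd hi h)).trans
      (Complex.card_rootsOfUnity (A.b i))
  · have hi : x.y i ≠ 0 := fun h' => h ((x.y_eq_zero_iff i).1 h')
    exact Nat.card_eq_one_iff_unique.2 ⟨⟨fun a b => Subtype.ext (by rw [a.2 hi, b.2 hi])⟩,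
      ⟨⟨1, fun _ => rfl⟩⟩⟩

/-- The deck group does not act faithfully: the elements with components `c ^ d i`, `c ^ N = 1`,
come from `ℂˣ` and act trivially. Each automorphism fixing `proj x` has exactly one representative
that is trivial at every nonzero root of `x`, and such representatives are free at the vanishing
roots. -/
theorem card_stabilizer (x : A.Cone) : Nat.card (MulAction.stabilizer A.DeckImage (proj x)) =
    ∏ i, if A.L i x.v = 0 then A.b i else 1 := by
  rw [← card_deck_fixing]
  symm
  have hfix : ∀ h : {h : A.Deck // ∀ i, x.y i ≠ 0 → h i = 1}, h.1 • x = x := fun h =>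
    Cone.ext rfl (funext fun i => by
      rw [Cone.deck_smul_y]
      by_cases hi : x.y i = 0
      · rw [hi, mul_zero]
      · rw [h.2 i hi]
        simp)
  refine Nat.card_congr (Equiv.ofBijective
    (fun h => ⟨⟨MulAction.toPermHom A.Deck A.Surface h.1, h.1, rfl⟩,
      show h.1 • proj x = proj x by rw [deck_smul_proj, hfix h]⟩) ⟨?_, ?_⟩)
  · intro h h' heq
    have heq' : ∀ q : A.Surface, h.1 • q = h'.1 • q := fun q =>
      congrArg (fun s : MulAction.stabilizer A.DeckImage (proj x) => s.1.1 q) heq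
    -- At a point without vanishing roots, equal actions give components that differ by `c ^ d i`.
    -- Both representatives are trivial at a nonzero root of weight one of `x`, hence `c = 1`.
    obtain ⟨x₀, hx₀⟩ := exists_cone_ne_zero (A := A)
    obtain ⟨c, hc⟩ := proj_eq_iff.1 (heq' (proj x₀))
    have hc' : ∀ i, (c : ℂ) ^ A.d i * ((h'.1 i : ℂˣ) : ℂ) = ((h.1 i : ℂˣ) : ℂ) := fun i => by
      have := congrFun (congrArg Cone.y hc) i
      rw [Cone.smul_y, Cone.deck_smul_y, Cone.deck_smul_y, ← mul_assoc] at this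
      exact mul_right_cancel₀ (hx₀ i) this
    obtain ⟨k, hk, hk'⟩ := x.exists_weight_one_ne_zero
    have hc1 : (c : ℂ) = 1 := by simpa [hk, h.2 k hk', h'.2 k hk'] using hc' k
    refine Subtype.ext (funext fun i => Subtype.ext (Units.ext ?_))
    rw [← hc' i, hc1, one_pow, one_mul]
  · rintro ⟨⟨_, g, rfl⟩, hg⟩
    obtain ⟨c, hc⟩ := proj_eq_iff.1 (show proj (g • x) = proj x from hg)
    have hcN : (c : ℂ) ^ A.N = 1 := by
      have h1 := congrArg Cone.v hc
      rw [Cone.smul_v, Cone.deck_smul_v] at h1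
      obtain ⟨a, ha⟩ := Function.ne_iff.1 x.v_ne_zero
      have h2 := congrFun h1 a
      rw [Pi.smul_apply, smul_eq_mul] at h2
      exact mul_right_cancel₀ ha (by rw [h2, one_mul])
    have hcb : ∀ i, c ^ A.d i ∈ rootsOfUnity (A.b i) ℂ := fun i => by
      rw [mem_rootsOfUnity']
      push_cast
      rw [← pow_mul, A.d_mul_b, hcN]
    -- Dividing by the trivially acting element `c ^ d i` makes the representative trivial at the
    -- nonzero roots.
    refine ⟨⟨fun i => g i * ⟨c ^ A.d i, hcb i⟩⁻¹, fun i hi => ?_⟩, ?_⟩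
    · have h1 := congrFun (congrArg Cone.y hc) i
      rw [Cone.smul_y, Cone.deck_smul_y] at h1
      rw [mul_inv_eq_one]
      refine Subtype.ext (Units.ext ?_)
      push_cast
      exact (mul_right_cancel₀ hi h1).symm
    · refine Subtype.ext (Subtype.ext (Equiv.ext fun q => ?_))
      obtain ⟨w, rfl⟩ := proj_surjective q
      refine proj_eq_of (c := ((c⁻¹ : ℂˣ) : ℂ)) (Units.ne_zero _) fun i => ?_
      simp only [Cone.deck_smul_y]
      push_cast
      rw [inv_pow]
      ring

theorem isUniformization {T : Fin 6 → Set ProjectivePlane}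
    (hT : ∀ i v (hv : v ≠ 0), Projectivization.mk ℂ v hv ∈ T i ↔ A.L i v = 0) :
    IsUniformization A.DeckImage (cover : A.Surface → _) (orbifoldWeight T A.b) where
  faithful := inferInstance
  properlyDiscontinuous :=
    have : Finite A.DeckImage := Finite.of_surjective
      (MulAction.toPermHom A.Deck A.Surface).rangeRestrict (MonoidHom.rangeRestrict_surjective _)
    Finite.to_properlyDiscontinuousSMul
  holomorphic_smul := by
    rintro ⟨_, g, rfl⟩ q
    exact mdifferentiableAt_deck_smul g q
  quotientMap := isQuotientMap_cover
  fiber_eq_orbit q q' := by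
    rw [cover_eq_iff]
    constructor
    · rintro ⟨g, rfl⟩
      exact ⟨⟨_, g, rfl⟩, rfl⟩
    · rintro ⟨⟨_, g, rfl⟩, h⟩
      exact ⟨g, h⟩
  holomorphic_iff U hU f := holomorphicOnPlane_iff hU f
  isotropy q := by
    obtain ⟨x, rfl⟩ := proj_surjective q
    rw [card_stabilizer, orbifoldWeight]
    refine Finset.prod_congr rfl fun i _ => ?_
    rw [cover_proj]
    simp only [hT]

end Uniformization

end BranchData

end K3Uniformization

namespace K3Uniformization

open Set Metric Filter Topology MeasureTheory

/-! ### Character sums -/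

section RootsOfUnity

/-- Translation by a primitive root multiplies the sum by a factor different from `1`. -/
theorem sum_rootsOfUnity_pow {b : ℕ} [Fintype (rootsOfUnity b ℂ)] {s t : ℕ} (hb : b ≠ 0)
    (hs : s < b) (ht : t < b) (hst : s ≠ t) :
    ∑ ζ : rootsOfUnity b ℂ, ((ζ : ℂˣ) : ℂ) ^ s * (((ζ : ℂˣ) : ℂ) ^ t)⁻¹ = 0 := by
  have hξ := Complex.isPrimitiveRoot_exp b hb
  set ξ := Complex.exp (2 * Real.pi * Complex.I / b)
  have hξ0 : ξ ≠ 0 := hξ.ne_zero hb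
  let ξ' : rootsOfUnity b ℂ := ⟨Units.mk0 ξ hξ0, (mem_rootsOfUnity' _ _).2 hξ.pow_eq_one⟩
  have h1 : ∑ ζ : rootsOfUnity b ℂ, ((ζ : ℂˣ) : ℂ) ^ s * (((ζ : ℂˣ) : ℂ) ^ t)⁻¹ =
      (ξ ^ s * (ξ ^ t)⁻¹) * ∑ ζ : rootsOfUnity b ℂ, ((ζ : ℂˣ) : ℂ) ^ s * (((ζ : ℂˣ) : ℂ) ^ t)⁻¹ := by
    rw [Finset.mul_sum, ← Equiv.sum_comp (Equiv.mulLeft ξ')]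
    refine Finset.sum_congr rfl fun ζ _ => ?_
    simp only [Equiv.coe_mulLeft, Subgroup.coe_mul, Units.val_mul, mul_pow, mul_inv, ξ',
      Units.val_mk0]
    ring
  have h2 : ξ ^ s * (ξ ^ t)⁻¹ ≠ 1 := fun h =>
    hst (hξ.pow_inj hs ht (by rwa [mul_inv_eq_one₀ (pow_ne_zero _ hξ0)] at h))
  by_contra h3
  exact h2 (mul_right_cancel₀ h3 (by rw [← h1, one_mul]))

/-- The complementary exponents avoid negative powers of the roots while acting on roots of unity as
inverse powers. -/
theorem pow_complement {b : ℕ} {ζ : ℂ} (hζ0 : ζ ≠ 0) (hζ : ζ ^ b = 1) {s : ℕ} (hs : s < b) :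
    ζ ^ (if s = 0 then 0 else b - s) = ζ⁻¹ ^ s := by
  split_ifs with h
  · rw [h, pow_zero, pow_zero]
  · rw [pow_sub₀ _ hζ0 hs.le, hζ, one_mul, inv_pow]

theorem sum_pow_complement {b : ℕ} {ζ : ℂ} (hζ0 : ζ ≠ 0) (hζ : ζ ^ b = 1) :
    ∑ s : Fin b, ζ ^ (if (s : ℕ) = 0 then 0 else b - s) = if ζ = 1 then (b : ℂ) else 0 := by
  simp only [fun s : Fin b => pow_complement hζ0 hζ s.2]
  rw [Fin.sum_univ_eq_sum_range (fun n => ζ⁻¹ ^ n)]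
  split_ifs with h
  · simp [h]
  · have h1 := geom_sum_mul ζ⁻¹ b
    rw [inv_pow, hζ, inv_one, sub_self] at h1
    refine (mul_eq_zero.1 h1).resolve_right fun h2 => h ?_
    rw [← inv_inv ζ, sub_eq_zero.1 h2, inv_one]

end RootsOfUnity

namespace BranchData

/-! ### Expansion of functions in monomials of the roots -/

section Decomposition

local notation "ℂ³" => (Fin 3 → ℂ)
local notation "ℂ²" => (Fin 2 → ℂ)

variable {A : BranchData}

variable (A) in
/-- Exponents of the monomials in the roots that form a basis over the functions of `v`. -/
abbrev Exponent : Type := ∀ i, Fin (A.b i)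

/-- The monomial with given exponents. -/
def Cone.monomial (x : A.Cone) (s : A.Exponent) : ℂ := ∏ i, x.y i ^ (s i : ℕ)

theorem Cone.continuous_monomial (s : A.Exponent) : Continuous fun x : A.Cone => x.monomial s :=
  continuous_finsetProd _ fun i _ => (Cone.continuous_y_apply i).pow _

theorem dense_L_ne_zero : Dense {v : ℂ³ | ∀ i, A.L i v ≠ 0} := by
  obtain ⟨e, he⟩ := A.eventually_L_ne_zero
  intro v
  refine mem_closure_of_tendsto (f := fun t : ℂ => v + t • e) (b := 𝓝[≠] 0) ?_ (he v)
  have : ContinuousAt (fun t : ℂ => v + t • e) 0 := by fun_prop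
  simpa using this.tendsto.mono_left (nhdsWithin_le_nhds (s := {0}ᶜ))

theorem dense_y_ne_zero : Dense {x : A.Cone | ∀ i, x.y i ≠ 0} := by
  intro x
  obtain ⟨p, hp⟩ := exists_chartIndex x
  obtain ⟨c, hc⟩ := proj_eq_iff.1 (p.proj_point_coord hp).symm
  have hcont : ContinuousAt (fun t : ℂ => c • p.point (p.coord x + t • ![1, 1])) 0 := by
    refine ContinuousAt.const_smul ?_ c
    refine (IsInducing.subtypeVal (Y := ℂ³ × (Fin 6 → ℂ))).continuousAt_iff.2 ?_
    have h1 : ContinuousAt (fun z => (p.vec z, p.root z)) (p.coord x) :=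
      (p.contDiff_vec (n := 0)).continuous.continuousAt.prodMk (continuousAt_pi.2 fun m =>
        (p.contDiffAt_root (n := 0) (p.coord_mem_target hp) m).continuousAt)
    refine ContinuousAt.comp (f := fun t : ℂ => p.coord x + t • (![1, 1] : ℂ²))
      (g := fun z => (p.vec z, p.root z)) ?_ (by fun_prop)
    simpa using h1
  have htend := hcont.tendsto.mono_left (nhdsWithin_le_nhds (s := {0}ᶜ))
  rw [zero_smul, add_zero, hc] at htend
  refine mem_closure_of_tendsto htend ?_
  have hne : ∀ a : Fin 2, ∀ᶠ t : ℂ in 𝓝[≠] 0, (p.coord x + t • (![1, 1] : ℂ²)) a ≠ 0 := by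
    intro a
    have h1 : (![1, 1] : ℂ²) a = 1 := by fin_cases a <;> rfl
    simp only [Pi.add_apply, Pi.smul_apply, h1, smul_eq_mul, mul_one]
    by_cases ha : p.coord x a = 0
    · filter_upwards [self_mem_nhdsWithin] with t ht
      simpa [ha] using ht
    · refine nhdsWithin_le_nhds (ContinuousAt.eventually_ne (by fun_prop) ?_)
      simpa using ha
  filter_upwards [hne 0, hne 1, eventually_add_smul_mem
    (p.isOpen_target.mem_nhds (p.coord_mem_target hp)) ![1, 1]] with t h0 h1 ht m
  refine mul_ne_zero (pow_ne_zero _ c.ne_zero) ?_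
  rw [ChartIndex.point_y]
  by_cases hi : m = p.i
  · subst hi
    rwa [p.root_i]
  by_cases hj : m = p.j
  · subst hj
    rwa [p.root_j]
  exact p.root_ne_zero ht hi hj

open Classical in
/-- The sum over the points of the cone over `v`. -/
noncomputable def trace (Φ : A.Cone → ℂ) (v : ℂ³) : ℂ :=
  if h : v ≠ 0 then ∑ g : A.Deck, Φ (g • (exists_cone_over h).choose) else 0

theorem trace_v (Φ : A.Cone → ℂ) (x : A.Cone) : trace Φ x.v = ∑ g : A.Deck, Φ (g • x) := by
  rw [trace, dif_pos x.v_ne_zero]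
  obtain ⟨g₀, hg₀⟩ := exists_deck_smul_eq (exists_cone_over (A := A) x.v_ne_zero).choose_spec
  rw [← hg₀, ← Equiv.sum_comp (Equiv.mulRight g₀) fun g => Φ (g • x)]
  refine Finset.sum_congr rfl fun g _ => ?_
  rw [Equiv.coe_mulRight, mul_smul]

/-- Off the lines the sum over the fibre is a sum over local sections; it is continuous everywhere,
so the lines are removable. -/
theorem differentiableOn_trace {C : Set ℂ³} (hC : IsOpen C) (h0 : (0 : ℂ³) ∉ C) {F : A.Surface → ℂ}
    (hF : ∀ x : A.Cone, x.v ∈ C → MDifferentiableAt 𝓘(ℂ, ℂ²) 𝓘(ℂ, ℂ) F (proj x))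
    (t : Fin 6 → ℕ) :
    DifferentiableOn ℂ (trace fun x : A.Cone => F (proj x) * ∏ i, x.y i ^ t i) C := by
  refine differentiableOn_of_cone (A := A) hC h0 ?_ fun x hx hy => ?_
  · simp only [trace_v]
    refine continuousOn_finsetSum _ fun g _ x hx => ContinuousAt.continuousWithinAt ?_
    refine ContinuousAt.comp (f := fun x : A.Cone => g • x)
      (g := fun x : A.Cone => F (proj x) * ∏ i, x.y i ^ t i) ?_ (continuous_const_smul g).continuousAt
    refine ContinuousAt.mul ?_ (continuous_finsetProd _ fun i _ =>
      (Cone.continuous_y_apply i).pow _).continuousAt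
    exact ContinuousAt.comp (hF (g • x) hx).continuousAt continuous_proj.continuousAt
  · have h : DifferentiableAt ℂ (fun v => ∑ g : A.Deck, F (proj ((g • x).localSection v)) *
        ∏ i, ((g • x).localSection v).y i ^ t i) x.v := by
      refine DifferentiableAt.fun_sum fun g _ => ?_
      have hgx : ∀ i, (g • x).y i ≠ 0 := fun i => mul_ne_zero (Units.ne_zero _) (hy i)
      refine (Cone.differentiableAt_comp_localSection hgx (hF (g • x) hx)).mul ?_
      exact (contDiffAt_prod fun i _ => (Cone.contDiffAt_localSection_y hgx i).pow _).differentiableAt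
        one_ne_zero
    refine h.congr_of_eventuallyEq ?_
    filter_upwards [isOpen_compl_singleton.mem_nhds x.v_ne_zero] with v hv
    have hv' := trace_v (fun x : A.Cone => F (proj x) * ∏ i, x.y i ^ t i) (x.localSection v)
    rw [Cone.localSection_v hy hv] at hv'
    rw [hv']
    simp only [Cone.deck_smul_localSection hy hv]

/-- The monomials belong to distinct characters of the deck group, so averaging against the inverse
character isolates the coefficient `c t`. -/
theorem eq_zero_of_sum_monomial_eq_zero_of_ne_zero {x : A.Cone} (hx : ∀ i, x.y i ≠ 0)
    {c : A.Exponent → ℂ} (h : ∀ g : A.Deck, ∑ s, c s * (g • x).monomial s = 0) (t : A.Exponent) :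
    c t = 0 := by
  have h1 : ∀ g : A.Deck, ∑ s, c s * x.monomial s *
      ∏ i, (((g i : ℂˣ) : ℂ) ^ (s i : ℕ) * (((g i : ℂˣ) : ℂ) ^ (t i : ℕ))⁻¹) = 0 := by
    intro g
    have h2 := congrArg (fun w => w * ∏ i, (((g i : ℂˣ) : ℂ) ^ (t i : ℕ))⁻¹) (h g)
    simp only [zero_mul, Finset.sum_mul] at h2
    rw [← h2]
    refine Finset.sum_congr rfl fun s _ => ?_
    simp only [Cone.monomial, Cone.deck_smul_y, mul_pow, Finset.prod_mul_distrib]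
    ring
  have h3 : ∑ g : A.Deck, ∑ s, c s * x.monomial s *
      ∏ i, (((g i : ℂˣ) : ℂ) ^ (s i : ℕ) * (((g i : ℂˣ) : ℂ) ^ (t i : ℕ))⁻¹) = 0 :=
    Finset.sum_eq_zero fun g _ => h1 g
  rw [Finset.sum_comm] at h3
  simp only [← Finset.mul_sum] at h3
  have h4 : ∀ s : A.Exponent, ∑ g : A.Deck,
      ∏ i, (((g i : ℂˣ) : ℂ) ^ (s i : ℕ) * (((g i : ℂˣ) : ℂ) ^ (t i : ℕ))⁻¹) =
      ∏ i, ∑ ζ : rootsOfUnity (A.b i) ℂ, (((ζ : ℂˣ) : ℂ) ^ (s i : ℕ) * (((ζ : ℂˣ) : ℂ) ^ (t i : ℕ))⁻¹) :=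
    fun s => by rw [Finset.prod_univ_sum, Fintype.piFinset_univ]
  rw [Finset.sum_eq_single t] at h3
  · have h5 : ∑ g : A.Deck, ∏ i, (((g i : ℂˣ) : ℂ) ^ (t i : ℕ) * (((g i : ℂˣ) : ℂ) ^ (t i : ℕ))⁻¹) ≠
        0 := by
      have : ∀ (g : A.Deck) i, ((g i : ℂˣ) : ℂ) ^ (t i : ℕ) * (((g i : ℂˣ) : ℂ) ^ (t i : ℕ))⁻¹ = 1 :=
        fun g i => mul_inv_cancel₀ (pow_ne_zero _ (Units.ne_zero _))
      simp only [this, Finset.prod_const_one, Finset.sum_const, nsmul_eq_mul, mul_one]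
      exact_mod_cast Finset.card_ne_zero_of_mem (Finset.mem_univ (1 : A.Deck))
    have h6 : x.monomial t ≠ 0 := Finset.prod_ne_zero_iff.2 fun i _ => pow_ne_zero _ (hx i)
    exact (mul_eq_zero.1 ((mul_eq_zero.1 h3).resolve_right h5)).resolve_right h6
  · intro s _ hst
    obtain ⟨i, hi⟩ := Function.ne_iff.1 hst
    rw [h4, Finset.prod_eq_zero (Finset.mem_univ i), mul_zero]
    exact sum_rootsOfUnity_pow (A.b_ne_zero i) (s i).2 (t i).2 fun h => hi (Fin.ext h)
  · exact fun h => absurd (Finset.mem_univ t) h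

/-- Uniqueness of the coefficients: it holds off the lines, and density with continuity gives the
rest. Every identity between coefficients below rests on it. -/
theorem eq_zero_of_sum_monomial_eq_zero {C : Set ℂ³} (hC : IsOpen C) (h0 : (0 : ℂ³) ∉ C)
    {h : A.Exponent → ℂ³ → ℂ} (hc : ∀ s, ContinuousOn (h s) C)
    (hz : ∀ x : A.Cone, x.v ∈ C → ∑ s, h s x.v * x.monomial s = 0) (s : A.Exponent) {v : ℂ³}
    (hv : v ∈ C) : h s v = 0 := by
  have hev : ∀ᶠ w in 𝓝[{v : ℂ³ | ∀ i, A.L i v ≠ 0}] v, h s w = 0 := by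
    filter_upwards [self_mem_nhdsWithin, mem_nhdsWithin_of_mem_nhds (hC.mem_nhds hv)] with w hw hwC
    obtain ⟨x, rfl⟩ := exists_cone_over (A := A) (v := w) fun h => h0 (h ▸ hwC)
    exact eq_zero_of_sum_monomial_eq_zero_of_ne_zero (x := x) (c := fun s => h s x.v)
      (fun i hi => hw i ((x.y_eq_zero_iff i).1 hi)) (fun g => hz (g • x) hwC) s
  have : (𝓝[{v : ℂ³ | ∀ i, A.L i v ≠ 0}] v).NeBot := mem_closure_iff_nhdsWithin_neBot.1
    (dense_L_ne_zero (A := A) v)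
  exact tendsto_nhds_unique_of_eventuallyEq
    ((((hc s).continuousAt (hC.mem_nhds hv)).tendsto).mono_left nhdsWithin_le_nhds)
    tendsto_const_nhds hev

/-- A function on an open subset of the surface is a combination of the monomials in the roots,
with coefficients that are functions on an open subset of `ℂ³`. -/
theorem exists_monomial_decomposition {C : Set ℂ³} (hC : IsOpen C) (h0 : (0 : ℂ³) ∉ C)
    {F : A.Surface → ℂ}
    (hF : ∀ x : A.Cone, x.v ∈ C → MDifferentiableAt 𝓘(ℂ, ℂ²) 𝓘(ℂ, ℂ) F (proj x)) :
    ∃ h : A.Exponent → ℂ³ → ℂ, (∀ s, DifferentiableOn ℂ (h s) C) ∧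
      ∀ x : A.Cone, x.v ∈ C → F (proj x) = ∑ s, h s x.v * x.monomial s := by
  classical
  -- Complementary exponents: the monomials with exponents `s` and `t s` multiply to the product of
  -- the forms `L i` with `s i ≠ 0`.
  let t : A.Exponent → Fin 6 → ℕ := fun s i => if (s i : ℕ) = 0 then 0 else A.b i - s i
  let S : A.Exponent → Finset (Fin 6) := fun s => Finset.univ.filter fun i => (s i : ℕ) ≠ 0
  -- The trace projects to the isotypic part of exponent `s`. On `L i = 0` with `s i ≠ 0` every
  -- summand contains a vanishing root, so the trace is divisible by these forms and the quotient is
  -- the coefficient up to the group order.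
  have hK : ∀ s, ∃ K : ℂ³ → ℂ, DifferentiableOn ℂ K C ∧ ∀ v ∈ C,
      trace (fun x : A.Cone => F (proj x) * ∏ i, x.y i ^ t s i) v = (∏ i ∈ S s, A.L i v) * K v := by
    intro s
    refine exists_eq_prod_mul_of_vanishing hC A.L (S s) ?_ (fun i _ => A.L_ne_zero i)
      (differentiableOn_trace hC h0 hF (t s)) ?_
    · intro i _ j _ hij
      have : ∀ i j : Fin 6, ∃ k : Fin 6, i ≠ k ∧ j ≠ k := by decide
      obtain ⟨k, h1, h2⟩ := this i j
      obtain ⟨e, he, he', -⟩ := exists_dual (A := A) hij h1 h2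
      exact ⟨e, he', by rw [he]; exact one_ne_zero⟩
    · intro i hi v hv hL
      obtain ⟨x, rfl⟩ := exists_cone_over (A := A) (v := v) fun h => h0 (h ▸ hv)
      rw [trace_v]
      refine Finset.sum_eq_zero fun g _ => mul_eq_zero_of_right _
        (Finset.prod_eq_zero (Finset.mem_univ i) ?_)
      have hsi : (s i : ℕ) ≠ 0 := (Finset.mem_filter.1 hi).2
      rw [Cone.deck_smul_y, (x.y_eq_zero_iff i).2 hL, mul_zero]
      refine zero_pow ?_
      simp only [t, if_neg hsi]
      have := (s i).2
      omega
  choose K hKd hK using hK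
  have hcard : (Fintype.card A.Deck : ℂ) ≠ 0 := by exact_mod_cast Fintype.card_ne_zero
  have hcard' : (Fintype.card A.Deck : ℂ) = ∏ i, (A.b i : ℂ) := by
    rw [Fintype.card_pi]
    push_cast
    refine Finset.prod_congr rfl fun i _ => ?_
    rw [← Nat.card_eq_fintype_card, Complex.card_rootsOfUnity]
  have hoff : ∀ x : A.Cone, x.v ∈ C → (∀ i, x.y i ≠ 0) →
      ∑ s, K s x.v * x.monomial s = Fintype.card A.Deck * F (proj x) := by
    intro x hx hy
    have h1 : ∀ s, K s x.v * x.monomial s =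
        ∑ g : A.Deck, F (proj (g • x)) * ∏ i, ((g i : ℂˣ) : ℂ) ^ t s i := by
      intro s
      have hne : ∏ i ∈ S s, A.L i x.v ≠ 0 := Finset.prod_ne_zero_iff.2 fun i _ h =>
        hy i ((x.y_eq_zero_iff i).2 h)
      have h2 : x.monomial s * ∏ i, x.y i ^ t s i = ∏ i ∈ S s, A.L i x.v := by
        rw [Cone.monomial, ← Finset.prod_mul_distrib, Finset.prod_filter]
        refine Finset.prod_congr rfl fun i _ => ?_
        by_cases hi : (s i : ℕ) = 0
        · simp only [t, hi, if_true, pow_zero, mul_one, ne_eq, not_true_eq_false, if_false]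
        · simp only [t, if_neg hi, ne_eq, hi, not_false_eq_true, if_true]
          rw [← pow_add, Nat.add_sub_cancel' (s i).2.le, x.y_pow]
      refine mul_left_cancel₀ hne ?_
      rw [← mul_assoc, ← hK s x.v hx, trace_v, ← h2, Finset.sum_mul, Finset.mul_sum]
      refine Finset.sum_congr rfl fun g _ => ?_
      simp only [Cone.deck_smul_y, mul_pow, Finset.prod_mul_distrib]
      ring
    simp only [h1]
    rw [Finset.sum_comm]
    simp only [← Finset.mul_sum]
    -- Summing all characters annihilates every `g ≠ 1`, so only `F (proj x)` times the group order
    -- survives.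
    have h3 : ∀ g : A.Deck, ∑ s : A.Exponent, ∏ i, ((g i : ℂˣ) : ℂ) ^ t s i =
        ∏ i, if ((g i : ℂˣ) : ℂ) = 1 then (A.b i : ℂ) else 0 := by
      intro g
      rw [← Fintype.piFinset_univ, ← Finset.prod_univ_sum (fun _ => Finset.univ)
        (fun i (s : Fin (A.b i)) => ((g i : ℂˣ) : ℂ) ^ (if (s : ℕ) = 0 then 0 else A.b i - s))]
      exact Finset.prod_congr rfl fun i _ => sum_pow_complement (Units.ne_zero _) (g.pow_eq_one i)
    simp only [h3]
    rw [Finset.sum_eq_single 1]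
    · have : ∀ i, (((1 : A.Deck) i : ℂˣ) : ℂ) = 1 := fun _ => rfl
      simp only [this, if_true, one_smul]
      rw [hcard', mul_comm]
    · intro g _ hg
      obtain ⟨i, hi⟩ := Function.ne_iff.1 hg
      rw [Finset.prod_eq_zero (Finset.mem_univ i), mul_zero]
      refine if_neg fun h => hi (Subtype.ext (Units.ext h))
    · exact fun h => absurd (Finset.mem_univ _) h
  refine ⟨fun s v => K s v / Fintype.card A.Deck, fun s => ?_, fun x hx => ?_⟩
  · simp only [div_eq_mul_inv]
    exact (hKd s).mul_const _
  have : (𝓝[{x : A.Cone | ∀ i, x.y i ≠ 0}] x).NeBot := mem_closure_iff_nhdsWithin_neBot.1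
    (dense_y_ne_zero x)
  refine tendsto_nhds_unique_of_eventuallyEq (l := 𝓝[{x : A.Cone | ∀ i, x.y i ≠ 0}] x)
    (f := fun x : A.Cone => F (proj x))
    (g := fun x : A.Cone => ∑ s, K s x.v / Fintype.card A.Deck * x.monomial s) ?_ ?_ ?_
  · have : ContinuousAt (fun x : A.Cone => F (proj x)) x :=
      ContinuousAt.comp (hF x hx).continuousAt continuous_proj.continuousAt
    exact this.tendsto.mono_left nhdsWithin_le_nhds
  · have : ContinuousAt (fun x : A.Cone => ∑ s, K s x.v / Fintype.card A.Deck * x.monomial s) x := by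
      refine tendsto_finsetSum _ fun s _ => ContinuousAt.mul (ContinuousAt.div_const ?_ _)
        (Cone.continuous_monomial s).continuousAt
      exact ContinuousAt.comp (((hKd s).differentiableAt (hC.mem_nhds hx)).continuousAt)
        Cone.continuous_v.continuousAt
    exact this.tendsto.mono_left nhdsWithin_le_nhds
  · filter_upwards [self_mem_nhdsWithin, mem_nhdsWithin_of_mem_nhds
      ((hC.preimage Cone.continuous_v).mem_nhds hx)] with w hw hwC
    have h1 := hoff w hwC hw
    rw [← mul_right_inj' hcard, ← h1, Finset.mul_sum]
    refine Finset.sum_congr rfl fun s _ => ?_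
    field_simp

end Decomposition

end BranchData

end K3Uniformization

namespace K3Uniformization

open Set Metric Filter Topology MeasureTheory

namespace BranchData

/-! ### Vanishing of `H¹` of the structure sheaf -/

section Cohomology

local notation "ℂ³" => (Fin 3 → ℂ)
local notation "ℂ²" => (Fin 2 → ℂ)

variable {A : BranchData}

theorem finite_cover_fiber (p : ProjectivePlane) : (cover ⁻¹' {p} : Set A.Surface).Finite := by
  obtain ⟨q, rfl⟩ := isQuotientMap_cover.surjective (f := (cover : A.Surface → _)) p
  refine (finite_range fun g : A.Deck => g • q).subset fun q' hq' => ?_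
  exact cover_eq_iff.1 hq'

/-- Each open cover of the surface has, over a neighbourhood of each point of the plane, a locally
constant choice of a member. -/
theorem exists_locally_constant_index {ι : Type*} {U : ι → Set A.Surface} (hU : ∀ i, IsOpen (U i))
    (hcov : ⋃ i, U i = univ) (p : ProjectivePlane) :
    ∃ (V : Set ProjectivePlane) (idx : A.Surface → ι), IsOpen V ∧ p ∈ V ∧
      ∀ q, cover q ∈ V → q ∈ U (idx q) ∧ ∀ᶠ q' in 𝓝 q, idx q' = idx q := by
  classical
  have hex : ∀ q : A.Surface, ∃ i, q ∈ U i := fun q => mem_iUnion.1 (hcov ▸ mem_univ q)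
  choose a ha using hex
  obtain ⟨O, hO, hdisj⟩ := (finite_cover_fiber (A := A) p).t2_separation
  let W : A.Surface → Set A.Surface := fun q => O q ∩ U (a q)
  have hWo : ∀ q, IsOpen (W q) := fun q => (hO q).2.inter (hU _)
  have hWq : ∀ q, q ∈ W q := fun q => ⟨(hO q).1, ha q⟩
  let B : Set A.Surface := ⋃ q ∈ (cover ⁻¹' {p} : Set A.Surface), W q
  have hB : IsOpen B := isOpen_biUnion fun q _ => hWo q
  let idx : A.Surface → ι := fun x =>
    if h : ∃ q, cover q = p ∧ x ∈ W q then a h.choose else a x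
  have hidx : ∀ q, cover q = p → ∀ x ∈ W q, idx x = a q := by
    intro q hq x hx
    have h : ∃ q, cover q = p ∧ x ∈ W q := ⟨q, hq, hx⟩
    have heq : h.choose = q := by
      by_contra hne
      exact Set.disjoint_left.1 (hdisj (show h.choose ∈ cover ⁻¹' {p} from h.choose_spec.1)
        (show q ∈ cover ⁻¹' {p} from hq) hne) h.choose_spec.2.1 hx.1
    simp only [idx, dif_pos h, heq]
  -- Closedness of `cover` yields a neighbourhood of `p` whose preimage lies in the disjoint open
  -- sets around the finitely many points of the fibre.
  refine ⟨(cover '' Bᶜ)ᶜ, idx, (isClosedMap_cover _ hB.isClosed_compl).isOpen_compl, ?_, ?_⟩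
  · rintro ⟨q, hq, hqp⟩
    exact hq (mem_biUnion (show q ∈ cover ⁻¹' {p} from hqp) (hWq q))
  · intro x hx
    have hxB : x ∈ B := by
      by_contra h
      exact hx ⟨x, h, rfl⟩
    obtain ⟨q, hq, hxq⟩ := mem_iUnion₂.1 hxB
    rw [hidx q hq x hxq]
    refine ⟨hxq.2, ?_⟩
    filter_upwards [(hWo q).mem_nhds hxq] with x' hx'
    exact hidx q hq x' hx'

theorem smul_mem_coneSet {V : Set ProjectivePlane} {μ : ℂ} (hμ : μ ≠ 0) {v : ℂ³}
    (hv : v ∈ coneSet V) : μ • v ∈ coneSet V := by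
  obtain ⟨hv0, hvV⟩ := hv
  refine ⟨smul_ne_zero hμ hv0, ?_⟩
  rwa [(Projectivization.mk_eq_mk_iff ℂ (μ • v) v _ hv0).2 ⟨Units.mk0 μ hμ, rfl⟩]

theorem Cone.monomial_smul (c : ℂˣ) (x : A.Cone) (s : A.Exponent) :
    (c • x).monomial s = (c : ℂ) ^ (∑ i, A.d i * s i) * x.monomial s := by
  simp only [monomial, smul_y, mul_pow, Finset.prod_mul_distrib, ← pow_mul,
    Finset.prod_pow_eq_pow_sum]

/-- Cocycles for covers that are pulled back from the projective plane are coboundaries. -/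
theorem cover_cocycle_is_coboundary {ι : Type*} (V : ι → Set ProjectivePlane)
    (hV : ∀ a, IsOpen (V a)) (hcov : ∀ p, ∃ a, p ∈ V a) (F : ι → ι → A.Surface → ℂ)
    (hF : ∀ a b q, cover q ∈ V a ∩ V b → MDifferentiableAt 𝓘(ℂ, ℂ²) 𝓘(ℂ, ℂ) (F a b) q)
    (hcoc : ∀ a b c q, cover q ∈ V a ∩ V b ∩ V c → F a b q + F b c q = F a c q) :
    ∃ G : ι → A.Surface → ℂ,
      (∀ a q, cover q ∈ V a → MDifferentiableAt 𝓘(ℂ, ℂ²) 𝓘(ℂ, ℂ) (G a) q) ∧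
      ∀ a b q, cover q ∈ V a ∩ V b → F a b q = G b q - G a q := by
  let C : ι → Set ℂ³ := fun a => coneSet (V a)
  have hC : ∀ a, IsOpen (C a) := fun a => isOpen_coneSet (hV a)
  have hC0 : ∀ a, (0 : ℂ³) ∉ C a := fun a => zero_notMem_coneSet _
  have hCC : ∀ a b, IsOpen (C a ∩ C b) := fun a b => (hC a).inter (hC b)
  have hCC0 : ∀ a b, (0 : ℂ³) ∉ C a ∩ C b := fun a b h => hC0 a h.1
  have hdec : ∀ a b, ∃ h : A.Exponent → ℂ³ → ℂ, (∀ s, DifferentiableOn ℂ (h s) (C a ∩ C b)) ∧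
      ∀ x : A.Cone, x.v ∈ C a ∩ C b → F a b (proj x) = ∑ s, h s x.v * x.monomial s :=
    fun a b => exists_monomial_decomposition (hCC a b) (hCC0 a b) fun x hx =>
      hF a b _ ⟨mem_coneSet_iff.1 hx.1, mem_coneSet_iff.1 hx.2⟩
  choose h hhd hh using hdec
  have hhcoc : ∀ s a b c, ∀ v ∈ C a ∩ C b ∩ C c, h a b s v + h b c s v = h a c s v := by
    intro s a b c v hv
    have h1 := eq_zero_of_sum_monomial_eq_zero (A := A) (C := C a ∩ C b ∩ C c)
      ((hCC a b).inter (hC c)) (fun h => hC0 a h.1.1)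
      (h := fun s v => h a b s v + h b c s v - h a c s v)
      (fun s => ((((hhd a b s).mono fun v hv => hv.1).continuousOn).add
        (((hhd b c s).mono fun v hv => ⟨hv.1.2, hv.2⟩).continuousOn)).sub
        (((hhd a c s).mono fun v hv => ⟨hv.1.1, hv.2⟩).continuousOn)) (by
        intro x hx
        have h2 := hcoc a b c (proj x)
          ⟨⟨mem_coneSet_iff.1 hx.1.1, mem_coneSet_iff.1 hx.1.2⟩, mem_coneSet_iff.1 hx.2⟩
        rw [hh a b x hx.1, hh b c x ⟨hx.1.2, hx.2⟩, hh a c x ⟨hx.1.1, hx.2⟩] at h2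
        simp only [sub_mul, add_mul, Finset.sum_sub_distrib, Finset.sum_add_distrib]
        rw [h2, sub_self]) s hv
    exact sub_eq_zero.1 h1
  -- Functions on the surface are invariant under `ℂˣ`, while the monomial has weight `∑ d i * s i`;
  -- by uniqueness the coefficient has the opposite weight.
  have hhhom : ∀ (l : ℂˣ) s a b, ∀ v ∈ C a ∩ C b,
      h a b s ((l : ℂ) ^ A.N • v) = ((l : ℂ) ^ (∑ i, A.d i * s i))⁻¹ * h a b s v := by
    intro l s a b v hv
    have hlN : (l : ℂ) ^ A.N ≠ 0 := pow_ne_zero _ l.ne_zero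
    have hmem : ∀ w ∈ C a ∩ C b, (l : ℂ) ^ A.N • w ∈ C a ∩ C b := fun w hw =>
      ⟨smul_mem_coneSet hlN hw.1, smul_mem_coneSet hlN hw.2⟩
    have h1 := eq_zero_of_sum_monomial_eq_zero (A := A) (hCC a b) (hCC0 a b)
      (h := fun s v => h a b s ((l : ℂ) ^ A.N • v) * (l : ℂ) ^ (∑ i, A.d i * s i) - h a b s v)
      (fun s => ContinuousOn.sub (ContinuousOn.mul ((hhd a b s).continuousOn.comp
        (continuous_const_smul _).continuousOn hmem) continuousOn_const) (hhd a b s).continuousOn) (by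
        intro x hx
        have h2 : F a b (proj (l • x)) = F a b (proj x) := by rw [proj_smul]
        rw [hh a b x hx, hh a b (l • x) (hmem _ hx)] at h2
        simp only [Cone.monomial_smul, Cone.smul_v] at h2
        simp only [sub_mul, Finset.sum_sub_distrib]
        rw [← h2, sub_eq_zero]
        exact Finset.sum_congr rfl fun s _ => by ring) s hv
    rw [eq_inv_mul_iff_mul_eq₀ (pow_ne_zero _ l.ne_zero), mul_comm]
    exact sub_eq_zero.1 h1
  have hcore : ∀ s, ∃ g : ι → ℂ³ → ℂ, (∀ a, DifferentiableOn ℂ (g a) (C a)) ∧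
      (∀ a b, ∀ v ∈ C a ∩ C b, h a b s v = g b v - g a v) ∧
      ∀ μ c : ℂ, μ ≠ 0 → (∀ a b, ∀ v ∈ C a ∩ C b, h a b s (μ • v) = c * h a b s v) →
        ∀ a, ∀ v ∈ C a, g a (μ • v) = c * g a v := fun s =>
    conical_cocycle_is_coboundary C hC hC0 (fun a μ hμ v hv => smul_mem_coneSet hμ hv)
      (fun v hv => (hcov (Projectivization.mk ℂ v hv)).imp fun a ha => ⟨hv, ha⟩)
      (fun a b => h a b s) (fun a b => hhd a b s) (hhcoc s)
  choose g hgd hg hghom using hcore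
  -- The preserved homogeneity makes the weights of coefficient and monomial cancel, so the sum
  -- descends to the surface.
  let Φ : ι → A.Cone → ℂ := fun a x => ∑ s, g s a x.v * x.monomial s
  have hΦ : ∀ a (l : ℂˣ) x, x.v ∈ C a → Φ a (l • x) = Φ a x := by
    intro a l x hx
    refine Finset.sum_congr rfl fun s _ => ?_
    have hl := pow_ne_zero (∑ i, A.d i * s i) l.ne_zero
    rw [Cone.smul_v, hghom s _ _ (pow_ne_zero _ l.ne_zero) (hhhom l s) a x.v hx, Cone.monomial_smul]
    field_simp
  let G : ι → A.Surface → ℂ := fun a q => Φ a (proj_surjective q).choose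
  have hG : ∀ a x, x.v ∈ C a → G a (proj x) = Φ a x := by
    intro a x hx
    obtain ⟨l, hl⟩ := proj_eq_iff.1 (proj_surjective (proj x)).choose_spec
    simp only [G]
    rw [← hl, hΦ a l x hx]
  refine ⟨G, ?_, ?_⟩
  · intro a q hq
    obtain ⟨x, rfl⟩ := proj_surjective q
    obtain ⟨p, hp⟩ := exists_chartIndex x
    refine (mdifferentiableAt_iff p hp).2 ?_
    have hz := p.coord_mem_target hp
    have hmem : p.vec (p.coord x) ∈ C a := by
      refine (mem_coneSet_iff (x := p.point (p.coord x))).2 ?_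
      rwa [p.proj_point_coord hp]
    have h1 : DifferentiableAt ℂ (fun z => ∑ s : A.Exponent, g s a (p.vec z) *
        ∏ i, p.root z i ^ (s i : ℕ)) (p.coord x) := by
      refine DifferentiableAt.fun_sum fun s _ => DifferentiableAt.mul ?_ ?_
      · exact DifferentiableAt.comp (p.coord x)
          ((hgd s a).differentiableAt ((hC a).mem_nhds hmem))
          ((p.contDiff_vec (n := 1)).differentiable one_ne_zero _)
      · exact (contDiffAt_prod fun i _ => (p.contDiffAt_root hz i).pow _).differentiableAt one_ne_zero
    refine h1.congr_of_eventuallyEq ?_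
    filter_upwards [((hC a).preimage (p.contDiff_vec (n := 0)).continuous).mem_nhds hmem] with z hz
    exact hG a (p.point z) hz
  · intro a b q hq
    obtain ⟨x, rfl⟩ := proj_surjective q
    have hxa : x.v ∈ C a := mem_coneSet_iff.2 hq.1
    have hxb : x.v ∈ C b := mem_coneSet_iff.2 hq.2
    rw [hh a b x ⟨hxa, hxb⟩, hG a x hxa, hG b x hxb]
    simp only [Φ, ← Finset.sum_sub_distrib, ← sub_mul]
    exact Finset.sum_congr rfl fun s _ => by rw [hg s a b x.v ⟨hxa, hxb⟩]

theorem structureSheafH1Vanishes : StructureSheafH1Vanishes A.Surface := by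
  intro ι U hU hcov f hf hcoc
  have hfat : ∀ i j q, q ∈ U i ∩ U j → MDifferentiableAt 𝓘(ℂ, ℂ²) 𝓘(ℂ, ℂ) (f i j) q :=
    fun i j q hq => (hf i j q hq).mdifferentiableAt (((hU i).inter (hU j)).mem_nhds hq)
  choose V idx hVo hpV hidx using exists_locally_constant_index hU hcov
  obtain ⟨G, hGd, hG⟩ := cover_cocycle_is_coboundary V hVo (fun p => ⟨p, hpV p⟩)
    (fun a b q => f (idx a q) (idx b q) q)
    (by
      intro a b q hq
      refine (hfat (idx a q) (idx b q) q ⟨(hidx a q hq.1).1, (hidx b q hq.2).1⟩).congr_of_eventuallyEq ?_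
      filter_upwards [(hidx a q hq.1).2, (hidx b q hq.2).2] with q' h1 h2
      rw [h1, h2])
    (fun a b c q hq => hcoc _ _ _ q ⟨⟨(hidx a q hq.1.1).1, (hidx b q hq.1.2).1⟩, (hidx c q hq.2).1⟩)
  -- With `p` in place of `cover q` the expression does not depend on `p`, as long as `cover q ∈ V
  -- p`: the change of `f (idx p q) j` is compensated by that of `G p`. Fixing `p` near a point
  -- makes it holomorphic.
  refine ⟨fun j q => f (idx (cover q) q) j q + G (cover q) q, ?_, ?_⟩
  · intro j q hq
    refine MDifferentiableAt.mdifferentiableWithinAt ?_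
    set p := cover q with hp
    have hqV : cover q ∈ V p := hpV p
    have h1 : MDifferentiableAt 𝓘(ℂ, ℂ²) 𝓘(ℂ, ℂ) (fun q' => f (idx p q) j q' + G p q') q :=
      (hfat (idx p q) j q ⟨(hidx p q hqV).1, hq⟩).add (hGd p q hqV)
    refine h1.congr_of_eventuallyEq ?_
    filter_upwards [(hidx p q hqV).2, (hU j).mem_nhds hq,
      ((hVo p).preimage continuous_cover).mem_nhds hqV] with q' h2 h3 h4
    have h5 := hpV (cover q')
    have h6 := hG (cover q') p q' ⟨h5, h4⟩
    have h7 := hcoc (idx (cover q') q') (idx p q') j q'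
      ⟨⟨(hidx _ q' h5).1, (hidx p q' h4).1⟩, h3⟩
    rw [← h2]
    linear_combination h6 - h7
  · intro i j q hq
    have h1 := hcoc (idx (cover q) q) i j q ⟨⟨(hidx _ q (hpV _)).1, hq.1⟩, hq.2⟩
    linear_combination h1

theorem isK3Surface : IsK3Surface A.Surface where
  t2 := inferInstance
  compact := inferInstance
  connected := inferInstance
  complexManifold := inferInstance
  canonical_trivial := ⟨twoForm, twoForm_nowhereVanishing⟩
  irregularity_zero := structureSheafH1Vanishes

end Cohomology

end BranchData

/-! ### From line arrangements to branch data -/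

section Arrangement

/-- The linear form with given coefficients. -/
noncomputable def linearForm (a : Fin 3 → ℂ) : (Fin 3 → ℂ) →L[ℂ] ℂ :=
  ∑ m, a m • ContinuousLinearMap.proj (R := ℂ) (φ := fun _ : Fin 3 => ℂ) m

theorem linearForm_apply (a v : Fin 3 → ℂ) : linearForm a v = ∑ m, a m * v m := by
  simp [linearForm]

theorem mk_mem_line_iff (a : Fin 3 → ℂ) {v : Fin 3 → ℂ} (hv : v ≠ 0) :
    Projectivization.mk ℂ v hv ∈ {p : ProjectivePlane | ∑ m, a m * p.rep m = 0} ↔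
      linearForm a v = 0 := by
  obtain ⟨c, hc⟩ := Projectivization.exists_smul_eq_mk_rep ℂ v hv
  change ∑ m, a m * (Projectivization.mk ℂ v hv).rep m = 0 ↔ _
  rw [← linearForm_apply, ← hc, Units.smul_def, map_smul, smul_eq_zero]
  exact or_iff_right c.ne_zero

theorem uniformizedByK3_of_weights {T : Fin 6 → Set ProjectivePlane} (hline : ∀ i, IsLine (T i))
    (hgen : InGeneralPosition T) {b d : Fin 6 → ℕ} {N : ℕ} (hN : N ≠ 0)
    (hdb : ∀ i, d i * b i = N) (hd : ∀ k : Fin 6, k < 3 → d k = 1)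
    (hsum : ∑ i, d i * (b i - 1) = 3 * N) : UniformizedByK3 (orbifoldWeight T b) := by
  choose a _ ha using hline
  have hT : ∀ i v (hv : v ≠ 0), Projectivization.mk ℂ v hv ∈ T i ↔ linearForm (a i) v = 0 :=
    fun i v hv => by rw [ha i, mk_mem_line_iff]
  let A : BranchData :=
    { L := fun i => linearForm (a i)
      b := b
      d := d
      N := N
      N_ne_zero := hN
      d_mul_b := hdb
      d_eq_one := hd
      sum_eq := hsum
      independent := by
        intro i j k hij hik hjk v hi hj hk
        by_contra hv
        have : Projectivization.mk ℂ v hv ∈ T i ∩ T j ∩ T k :=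
          ⟨⟨(hT i v hv).2 hi, (hT j v hv).2 hj⟩, (hT k v hv).2 hk⟩
        rw [hgen.2 i j k hij hik hjk] at this
        exact this }
  exact ⟨A.Surface, inferInstance, inferInstance, A.DeckImage, inferInstance, inferInstance,
    BranchData.cover, A.isK3Surface, BranchData.isUniformization (A := A) hT⟩

end Arrangement

end K3Uniformization

theorem mainTheorem8 (T : Fin 6 → Set K3Uniformization.ProjectivePlane)
    (hline : ∀ i, K3Uniformization.IsLine (T i))
    (hgen : K3Uniformization.InGeneralPosition T) :
    K3Uniformization.UniformizedByK3
        (K3Uniformization.orbifoldWeight T ![6, 6, 6, 2, 1, 1]) ∧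
      K3Uniformization.UniformizedByK3
        (K3Uniformization.orbifoldWeight T ![4, 4, 4, 4, 1, 1]) ∧
      K3Uniformization.UniformizedByK3
        (K3Uniformization.orbifoldWeight T ![2, 2, 2, 2, 2, 2]) :=
  -- In each case `N` is the least common multiple of the orders and `d i = N / b i`; the sums `∑ d
  -- i * (b i - 1)` are `18`, `12` and `6`, that is `3 * N`.
  ⟨K3Uniformization.uniformizedByK3_of_weights hline hgen (d := ![1, 1, 1, 3, 6, 6]) (N := 6)
      (by decide) (by decide) (by decide) (by decide),
    K3Uniformization.uniformizedByK3_of_weights hline hgen (d := ![1, 1, 1, 1, 4, 4]) (N := 4)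
      (by decide) (by decide) (by decide) (by decide),
    K3Uniformization.uniformizedByK3_of_weights hline hgen (d := ![1, 1, 1, 1, 1, 1]) (N := 2)
      (by decide) (by decide) (by decide) (by decide)⟩
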